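/- Let $1\le m\le n$, and for a subset $K=\{k_1<\dots<k_p\}$ of $\{1,\dots,n\}$ and quaternions $q_1,\dots,q_n$ write $q_K:=q_{k_1}\cdots q_{k_p}$, with $q_\emptyset:=1$. Let $\mathbb S_{\mathbb H}=\{J\in\mathbb H: J^2=-1\}$. **Slice regular functions.** Let $D\subset\mathbb C^n$ be open and invariant under the conjugation of each coordinate, and let $\Omega_D=\{(\alpha_1+J_1\beta_1,\dots,\alpha_n+J_n\beta_n): (\alpha_h+i\beta_h)_h\in D,\ J_1,\dots,J_n\in\mathbb S_{\mathbb H}\}\subset\mathbb H^n$. A stem function on $D$ is a map $F=\sum_{K\subset\{1,\dots,n\}}e_KF_K:D\to\mathbb H\otimes\mathbb R^{2^n}$ such that, for all $K$ and $h$, $F_K$ changes by the factor $(-1)^{|K\cap\{h\}|}$ when $z_h$ is replaced by $\bar z_h$. It induces the slice function $f:\Omega_D\to\mathbb H$, $f(\alpha+J\beta)=\sum_K J_KF_K(\alpha+i\beta)$. It is holomorphic if it is of class $C^1$ and $\frac12\left(\frac{\partial F}{\partial\alpha_h}+\mathcal J_h\frac{\partial F}{\partial\beta_h}\right)=0$ for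 every $h$, where $\mathcal J_h(e_Kq)=(-1)^{|K\cap\{h\}|}e_{K\Delta\{h\}}q$. A slice function is slice regular if it is induced by a holomorphic stem function. **Components.** The product of stem functions is $F\otimes G=\sum_{K,H}(-1)^{|H\cap K|}e_{K\Delta H}F_KG_H$. Let $Z_j(z)=\alpha_j+e_j\beta_j$ and let $Z_K$ be the ordered $\otimes$-product of the $Z_k$, $k\in K$. Put $M=\{1,\dots,m\}$. For $f$ slice regular, induced by $F$, and $K\subset M$, let $\mathcal S^m_K(f)$ be the slice function induced by $(Z_K\otimes F)'_M$, where $G'_M(z)=\big(\prod_{h\in M}\beta_h\big)^{-1}\sum_{T\cap M=\emptyset}e_TG_{T\cup M}(z)$. This defines $\mathcal S^m_K(f)$ at the points of $\Omega_D$ whose first $m$ coordinates are all non-real, and at the other points of $\Omega_D$ its value is given by continuous extension. **Statement.** Let $f$ be slice regular on $\Omega_D$, let $a=(a_1,\dots,a_n)\in\mathbb H^n$ and $r_1,\dots,r_n\ge 0$, and suppose that the product of the closed balls $\{x\in\mathbb H:|x-a_i|\le r_i\}$, $i=1,\dots,n$, is contained in $\Omega_D$. Let $\sigma$ be the three-dimensional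 Hausdorff measure on the unit sphere $\mathbb S^3\subset\mathbb H\cong\mathbb R^4$, normalized so that $\sigma(\mathbb S^3)=1$, and let $\sigma^m$ be its $m$-fold product. Then every $\mathcal S^m_K(f)$, $K\subset M$, does extend continuously to $\Omega_D$, the integrals below exist, and $$f(a)=\sum_{K\subset\{1,\dots,m\}}(-1)^{|K^c|}\,\overline a_{K^c}\int_{(\mathbb S^3)^m}\mathcal S^m_K(f)(a_1+r_1\lambda_1,\dots,a_m+r_m\lambda_m,a_{m+1},\dots,a_n)\,d\sigma^m(\lambda),$$ where $K^c=\{1,\dots,m\}\setminus K$ and $\overline a_{K^c}$ is the ordered product of the conjugates $\overline{a_k}$, $k\in K^c$. -/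

import Mathlib

noncomputable section

namespace SeveralQuaternions

open scoped Quaternion symmDiff MeasureTheory Topology

/-- The quaternions carry their Borel sigma-algebra. -/
instance instMeasurableSpaceQuaternion : MeasurableSpace ℍ[ℝ] := borel ℍ[ℝ]

instance instBorelSpaceQuaternion : BorelSpace ℍ[ℝ] := ⟨rfl⟩

/-- The ordered product `q_K = q_{k_1} ⋯ q_{k_p}`, where `K = {k_1 < ⋯ < k_p}`; it is `1` for
`K = ∅`. -/
def orderedProd {n : ℕ} (K : Finset (Fin n)) (q : Fin n → ℍ[ℝ]) : ℍ[ℝ] :=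
  ((K.sort (· ≤ ·)).map q).prod

/-- The set of square roots of `-1` in the quaternions. -/
def imagUnits : Set ℍ[ℝ] := {J | J * J = -1}

/-- The point `(α_1 + J_1 β_1, …, α_n + J_n β_n)`, where `z_h = α_h + i β_h`. -/
def slicePoint {n : ℕ} (z : Fin n → ℂ) (J : Fin n → ℍ[ℝ]) : Fin n → ℍ[ℝ] :=
  fun h => ((z h).re : ℍ[ℝ]) + J h * ((z h).im : ℍ[ℝ])

/-- The circularization `Ω_D ⊆ ℍⁿ` of `D ⊆ ℂⁿ`. -/
def circularization {n : ℕ} (D : Set (Fin n → ℂ)) : Set (Fin n → ℍ[ℝ]) :=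
  {x | ∃ z ∈ D, ∃ J : Fin n → ℍ[ℝ], (∀ h, J h ∈ imagUnits) ∧ x = slicePoint z J}

/-- Complex conjugation of the `h`-th coordinate of `ℂⁿ`. -/
def conjAt {n : ℕ} (h : Fin n) (z : Fin n → ℂ) : Fin n → ℂ :=
  Function.update z h (starRingEnd ℂ (z h))

/-- The real vector space `ℍ ⊗ ℝ^(2^n)`: the element `∑_K e_K v_K`, with `K` running over the
subsets of the index set, is represented by the family of its components `v_K`. -/
abbrev StemValue (n : ℕ) : Type := Finset (Fin n) → ℍ[ℝ]

/-- `F = ∑_K e_K F_K` is a stem function on `D`: the set `D` is invariant under the conjugation of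
each coordinate, and each `F_K` is odd in the imaginary part of `z_h` for `h ∈ K` and even
for `h ∉ K`. -/
structure IsStemFunction {n : ℕ} (D : Set (Fin n → ℂ)) (F : (Fin n → ℂ) → StemValue n) :
    Prop where
  conjAt_mem_iff : ∀ (h : Fin n) (z : Fin n → ℂ), conjAt h z ∈ D ↔ z ∈ D
  parity : ∀ z ∈ D, ∀ (K : Finset (Fin n)) (h : Fin n),
    F (conjAt h z) K = (-1 : ℝ) ^ (K ∩ {h}).card • F z K

/-- `f` is, on `Ω_D`, the slice function induced by the stem function `F` on `D`:
`f(α + Jβ) = ∑_K J_K F_K(α + iβ)`. -/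
def IsInducedBy {n : ℕ} (D : Set (Fin n → ℂ)) (F : (Fin n → ℂ) → StemValue n)
    (f : (Fin n → ℍ[ℝ]) → ℍ[ℝ]) : Prop :=
  ∀ z ∈ D, ∀ J : Fin n → ℍ[ℝ], (∀ h, J h ∈ imagUnits) →
    f (slicePoint z J) = ∑ K : Finset (Fin n), orderedProd K J * F z K

/-- The complex structure `𝓙_h`, given by `𝓙_h (q e_K) = (-1)^|K ∩ {h}| q e_(K ∆ {h})`; the
component of `𝓙_h v` along `e_L` comes from `K = L ∆ {h}`. -/
def complexStructure {n : ℕ} (h : Fin n) (v : StemValue n) : StemValue n :=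
  fun L => (-1 : ℝ) ^ ((L ∆ {h}) ∩ {h}).card • v (L ∆ {h})

/-- The partial derivative `∂F/∂α_h`. -/
def partialRe {n : ℕ} (h : Fin n) (F : (Fin n → ℂ) → StemValue n) (z : Fin n → ℂ) :
    StemValue n :=
  fderiv ℝ F z (Pi.single h 1)

/-- The partial derivative `∂F/∂β_h`. -/
def partialIm {n : ℕ} (h : Fin n) (F : (Fin n → ℂ) → StemValue n) (z : Fin n → ℂ) :
    StemValue n :=
  fderiv ℝ F z (Pi.single h Complex.I)

/-- The operator `∂̄_h = (∂/∂α_h + 𝓙_h ∂/∂β_h) / 2`. -/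
def stemDbar {n : ℕ} (h : Fin n) (F : (Fin n → ℂ) → StemValue n) (z : Fin n → ℂ) :
    StemValue n :=
  (1 / 2 : ℝ) • (partialRe h F z + complexStructure h (partialIm h F z))

/-- A holomorphic stem function on the open set `D`: it is of class `C¹` and `∂̄_h F = 0` for
every `h`. -/
structure IsHolomorphicStem {n : ℕ} (D : Set (Fin n → ℂ)) (F : (Fin n → ℂ) → StemValue n) :
    Prop where
  isStem : IsStemFunction D F
  contDiffOn : ContDiffOn ℝ 1 F D
  dbar_eq_zero : ∀ (h : Fin n), ∀ z ∈ D, stemDbar h F z = 0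

/-- The product of `ℍ ⊗ ℝ^(2^n)` that defines the product of stem functions:
`(∑_K e_K v_K) ⊗ (∑_H e_H w_H) = ∑_(K,H) (-1)^|H ∩ K| e_(K ∆ H) v_K w_H`. -/
def stemMul {n : ℕ} (v w : StemValue n) : StemValue n :=
  fun L => ∑ K : Finset (Fin n), ∑ H : Finset (Fin n),
    if K ∆ H = L then (-1 : ℝ) ^ (H ∩ K).card • (v K * w H) else 0

/-- The stem function `Z_j(z) = α_j + e_j β_j`, which induces the coordinate function `x_j`. -/
def stemCoord {n : ℕ} (j : Fin n) (z : Fin n → ℂ) : StemValue n :=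
  Pi.single ∅ ((z j).re : ℍ[ℝ]) + Pi.single {j} ((z j).im : ℍ[ℝ])

/-- The ordered product `Z_K = Z_{k_1} ⊗ ⋯ ⊗ Z_{k_p}`, which induces the slice product of the
coordinate functions with index in `K`. -/
def stemMonomial {n : ℕ} (K : Finset (Fin n)) (z : Fin n → ℂ) : StemValue n :=
  ((K.sort (· ≤ ·)).map fun j => stemCoord j z).foldr stemMul (Pi.single ∅ 1)

/-- The stem function `F'_H = β_H⁻¹ ∑_(T ∩ H = ∅) e_T F_(T ∪ H)` of the iterated spherical
derivative. It has a meaning where `β_h ≠ 0` for all `h ∈ H`. -/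
def sphericalDerivStem {n : ℕ} (H : Finset (Fin n)) (F : (Fin n → ℂ) → StemValue n)
    (z : Fin n → ℂ) : StemValue n :=
  fun T => if Disjoint T H then (∏ h ∈ H, (z h).im)⁻¹ • F z (T ∪ H) else 0

/-- The stem function `G^H_K(F) = (Z_K ⊗ F)'_H`. -/
def almansiStem {n : ℕ} (H K : Finset (Fin n)) (F : (Fin n → ℂ) → StemValue n) :
    (Fin n → ℂ) → StemValue n :=
  sphericalDerivStem H fun z => stemMul (stemMonomial K z) (F z)

/-- The representation `x_h = α_h + J_h β_h` of a quaternionic vector with `β_h = |Im x_h| ≥ 0`: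
the complex numbers `α_h + i β_h`. -/
def canonicalPoint {n : ℕ} (x : Fin n → ℍ[ℝ]) : Fin n → ℂ :=
  fun h => ⟨(x h).re, ‖(x h).im‖⟩

/-- The representation `x_h = α_h + J_h β_h` of a quaternionic vector with `β_h = |Im x_h| ≥ 0`:
the imaginary units `J_h`. If `x_h` is real, the unit is irrelevant, and `0` stands in its
place. -/
def canonicalUnit {n : ℕ} (x : Fin n → ℍ[ℝ]) : Fin n → ℍ[ℝ] :=
  fun h => ‖(x h).im‖⁻¹ • (x h).im

/-- The slice function induced by a stem function, as an explicit function of `x`. -/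
def sliceMap {n : ℕ} (F : (Fin n → ℂ) → StemValue n) (x : Fin n → ℍ[ℝ]) : ℍ[ℝ] :=
  ∑ K : Finset (Fin n), orderedProd K (canonicalUnit x) * F (canonicalPoint x) K

theorem orderedProd_smul {n : ℕ} (K : Finset (Fin n)) (c : Fin n → ℝ) (q : Fin n → ℍ[ℝ]) :
    orderedProd K (fun h => c h • q h) = (∏ h ∈ K, c h) • orderedProd K q := by
  have key : ∀ l : List (Fin n), (l.map fun h => c h • q h).prod
      = (l.map c).prod • (l.map q).prod := by
    intro l
    induction l with
    | nil => simp
    | cons x l ih =>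
      rw [List.map_cons, List.prod_cons, ih, smul_mul_smul_comm, List.map_cons, List.prod_cons,
        List.map_cons, List.prod_cons]
  have h2 : ((K.sort (· ≤ ·)).map c).prod = ∏ h ∈ K, c h := by
    rw [Finset.prod, ← Finset.sort_eq K (· ≤ ·), Multiset.map_coe, Multiset.prod_coe]
  rw [orderedProd, key, h2, orderedProd]

theorem IsStemFunction.conj_finset {n : ℕ} {D : Set (Fin n → ℂ)} {F : (Fin n → ℂ) → StemValue n}
    (hF : IsStemFunction D F) {z : Fin n → ℂ} (hz : z ∈ D) (S : Finset (Fin n)) :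
    (fun h => if h ∈ S then starRingEnd ℂ (z h) else z h) ∈ D ∧ ∀ K : Finset (Fin n),
      F (fun h => if h ∈ S then starRingEnd ℂ (z h) else z h) K
        = (∏ h ∈ K, if h ∈ S then (-1 : ℝ) else 1) • F z K := by
  induction S using Finset.induction_on with
  | empty => simpa using hz
  | insert s S hs ih =>
    obtain ⟨h1, h2⟩ := ih
    have e : (fun h => if h ∈ insert s S then starRingEnd ℂ (z h) else z h)
        = conjAt s (fun h => if h ∈ S then starRingEnd ℂ (z h) else z h) := by
      funext h
      by_cases hh : h = s
      · subst hh; simp [conjAt, hs]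
      · simp [conjAt, hh]
    rw [e]
    refine ⟨(hF.conjAt_mem_iff s _).2 h1, fun K => ?_⟩
    rw [hF.parity _ h1, h2, smul_smul]
    congr 1
    have : ∀ h ∈ K, (if h ∈ insert s S then (-1 : ℝ) else 1)
        = (if h = s then (-1 : ℝ) else 1) * (if h ∈ S then (-1 : ℝ) else 1) := by
      intro h _
      by_cases hh : h = s
      · subst hh; simp [hs]
      · simp [hh]
    rw [Finset.prod_congr rfl this, Finset.prod_mul_distrib, Finset.prod_ite]
    by_cases hK : s ∈ K
    · simp [hK]
    · simp [hK]

theorem imagUnits_props {J : ℍ[ℝ]} (hJ : J ∈ imagUnits) : J.re = 0 ∧ ‖J‖ = 1 := by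
  have hJ' : J * J = -1 := hJ
  have hn : ‖J‖ = 1 := by
    have := congrArg norm hJ'
    rw [norm_mul, norm_neg, norm_one] at this
    nlinarith [norm_nonneg J]
  have h0 := congrArg QuaternionAlgebra.re hJ'
  have h1 := congrArg QuaternionAlgebra.imI hJ'
  have h2 := congrArg QuaternionAlgebra.imJ hJ'
  have h3 := congrArg QuaternionAlgebra.imK hJ'
  simp at h0 h1 h2 h3
  refine ⟨?_, hn⟩
  by_contra hre
  have i1 : J.imI = 0 := by
    have : J.re * J.imI = 0 := by linarith
    exact (mul_eq_zero.1 this).resolve_left hre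
  have i2 : J.imJ = 0 := by
    have : J.re * J.imJ = 0 := by linarith
    exact (mul_eq_zero.1 this).resolve_left hre
  have i3 : J.imK = 0 := by
    have : J.re * J.imK = 0 := by linarith
    exact (mul_eq_zero.1 this).resolve_left hre
  rw [i1, i2, i3] at h0
  nlinarith

/-- For a stem function, the explicit formula gives the induced slice function: the value does not
depend on the representation `x = α + Jβ`. -/
theorem isInducedBy_sliceMap {n : ℕ} {D : Set (Fin n → ℂ)} {F : (Fin n → ℂ) → StemValue n}
    (hF : IsStemFunction D F) : IsInducedBy D F (sliceMap F) := by
  intro z hz J hJ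
  have him : ∀ h, (slicePoint z J h).im = (z h).im • J h := by
    intro h
    have := (imagUnits_props (hJ h)).1
    ext <;> simp [slicePoint, this, mul_comm]
  have hre : ∀ h, (slicePoint z J h).re = (z h).re := by
    intro h
    have := (imagUnits_props (hJ h)).1
    simp [slicePoint, this]
  have hnorm : ∀ h, ‖(slicePoint z J h).im‖ = |(z h).im| := by
    intro h
    rw [him, norm_smul, (imagUnits_props (hJ h)).2, mul_one, Real.norm_eq_abs]
  set S : Finset (Fin n) := Finset.univ.filter fun h => (z h).im < 0 with hS
  have hcp : canonicalPoint (slicePoint z J)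
      = fun h => if h ∈ S then starRingEnd ℂ (z h) else z h := by
    funext h
    by_cases hh : (z h).im < 0
    · apply Complex.ext <;> simp [canonicalPoint, hS, hh, hre, hnorm, abs_of_neg]
    · apply Complex.ext <;>
        simp [canonicalPoint, hS, hh, hre, hnorm, abs_of_nonneg (not_lt.1 hh)]
  have hcu : canonicalUnit (slicePoint z J) = fun h => (|(z h).im|⁻¹ * (z h).im) • J h := by
    funext h
    rw [canonicalUnit, hnorm, him, smul_smul]
  rw [sliceMap, hcp, hcu]
  refine Finset.sum_congr rfl fun K _ => ?_
  rw [orderedProd_smul, (hF.conj_finset hz S).2 K, smul_mul_smul_comm, ← Finset.prod_mul_distrib]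
  by_cases h0 : ∃ h ∈ K, (z h).im = 0
  · obtain ⟨h, hK, h0⟩ := h0
    have e : conjAt h z = z := by
      rw [conjAt, Complex.conj_eq_iff_im.2 h0, Function.update_eq_self]
    have p := hF.parity z hz K h
    rw [e, Finset.inter_singleton_of_mem hK, Finset.card_singleton, pow_one, neg_one_smul] at p
    have : F z K = 0 := by
      have h2 : (2 : ℝ) • F z K = 0 := by
        rw [two_smul]
        nth_rewrite 2 [p]
        exact add_neg_cancel _
      exact (smul_eq_zero.1 h2).resolve_left two_ne_zero
    simp [this]
  · push Not at h0
    rw [Finset.prod_eq_one, one_smul]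
    intro h hK
    have := h0 h hK
    by_cases hh : (z h).im < 0
    · simp only [hS, Finset.mem_filter, Finset.mem_univ, hh, true_and, if_true, abs_of_neg hh]
      field_simp
    · simp only [hS, Finset.mem_filter, Finset.mem_univ, hh, true_and, if_false, abs_of_nonneg (not_lt.1 hh)]
      field_simp

/-- The points of `Ω_D` whose coordinates with index in `H` are all non-real. -/
def nonrealPart {n : ℕ} (D : Set (Fin n → ℂ)) (H : Finset (Fin n)) : Set (Fin n → ℍ[ℝ]) :=
  {x | x ∈ circularization D ∧ ∀ h ∈ H, (x h).im ≠ 0}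

open Classical in
/-- The component `𝓢^H_K(f) = (x_K ⊙ f)'_(s,H)` of the slice function `f` induced by `F`. Where the
coordinates with index in `H` are non-real it is the slice function induced by `G^H_K(F)`; at the
other points of `Ω_D` it is the continuous extension. -/
def almansiComponent {n : ℕ} (D : Set (Fin n → ℂ)) (H K : Finset (Fin n))
    (F : (Fin n → ℂ) → StemValue n) (x : Fin n → ℍ[ℝ]) : ℍ[ℝ] :=
  if x ∈ nonrealPart D H then sliceMap (almansiStem H K F) x
  else extendFrom (nonrealPart D H) (sliceMap (almansiStem H K F)) x

/-- The unit sphere `𝕊³` of the quaternions. -/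
abbrev unitSphere : Type := Metric.sphere (0 : ℍ[ℝ]) 1

/-- The three-dimensional Hausdorff measure of `𝕊³`, normalized to total mass one. -/
def sphereMeasure : MeasureTheory.Measure unitSphere :=
  (μH[3] (Set.univ : Set unitSphere))⁻¹ • μH[3]

/-- The first `m` of the `n` indices. -/
def initialSegment (n m : ℕ) : Finset (Fin n) := Finset.univ.filter fun i => (i : ℕ) < m

/-- The point `a + r_1 λ_1 + ⋯ + r_m λ_m`: the `i`-th coordinate is moved by `r_i λ_i` if it is one
of the first `m`, and kept otherwise. -/
def shiftedPoint {n : ℕ} (m : ℕ) (a : Fin n → ℍ[ℝ]) (r : Fin n → ℝ) (lam : Fin m → unitSphere) :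
    Fin n → ℍ[ℝ] :=
  fun i => if h : (i : ℕ) < m then a i + r i • (lam ⟨i, h⟩ : ℍ[ℝ]) else a i

end SeveralQuaternions

end

noncomputable section

namespace SeveralQuaternions

open scoped Quaternion symmDiff MeasureTheory Topology

set_option maxSynthPendingDepth 3

/-! ### Parametric integrals over compact sets -/

section ParametricIntegral

open MeasureTheory Metric Set

/-! The formula combines two facts. The first is an Almansi-type decomposition, valid at every point
of `Ω_D`: `f(x)` is the sum over `K ⊆ M` of `(-1)^|M \ K|` times the ordered product of the
conjugates of `x_k`, `k ∈ M \ K`, times the component `𝓢_K(f)(x)`. The second is that each component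
is harmonic separately in every `x_h` with `h ∈ M`. Evaluating the decomposition at `a` and
replacing each component by its mean over spheres, one variable at a time, gives the theorem.

The decomposition is linear algebra. In one variable it reads `β (J w_1 + w_0) = (α w_1 + β w_0) -
(α - β J) w_1`, where `α w_1 + β w_0` is the `e_1`-component of `Z ⊗ w`.
`sum_orderedProd_stemListMul` iterates this over `M`, peeling off the largest index so that
noncommutativity causes no trouble. Dividing by the product of the `β_h` needs non-real coordinates;
density and continuity remove this restriction in `sliceMap_eq_sum_quotientSliceMap`.

For harmonicity, fix all variables but `z_h`. The component becomes a combination, with coefficients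
independent of `x_h`, of quotients `v(z) / Im z`, where `u + i v` satisfies the Cauchy-Riemann
equations, `u` is even and `v` is odd under conjugation. Subtracting the Cauchy integrals with poles
`z` and its conjugate (`im_eq_im_mul_integral`) writes the quotient as an integral over a circle
with kernel `1 / ((ζ - z)(ζ - conj z))`. With `z = Re x + i |Im x|` the denominator is `ζ² - 2 ζ Re
x + |x|²`, formally `|x - ζ|²`. The kernel is thus a complex translate of the Newtonian kernel
`|x|⁻²` of four-dimensional space and is harmonic in `x`, including across the real axis
(`sum_kernelDeriv₂`, `harmonicAt_comp_sliceCoord`).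

To treat several variables, the same Cauchy formula shows that dividing by one `Im z_h` keeps a stem
function of class `C¹` and holomorphic in the other variables (`IsHolomorphicStemIn.stemQuotient`),
so the division can be iterated. The resulting continuous quotients also provide the continuous
extension of the components (`eqOn_almansiComponent`).

The mean value property is obtained from the invariance of the sphere measure under right
multiplication by unit quaternions (`integral_sphere_of_harmonicOnNhd`), and
`integral_pi_eq_of_integral_update` passes from one sphere to a product of spheres. -/

/-- A small closed ball times `s` is compact, so a continuous kernel is bounded on it. This constant
is the dominating function in the parametric integrals. -/
theorem exists_bound_nhds_of_isCompact {Y : Type*} [TopologicalSpace Y] {s : Set Y}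
    {E F : Type*} [PseudoMetricSpace E] [ProperSpace E]
    [NormedAddCommGroup F] (hs : IsCompact s) {U : Set E} (hU : IsOpen U) {K : E → Y → F}
    (hK : ContinuousOn (fun p : E × Y => K p.1 p.2) (U ×ˢ s)) {x₀ : E} (hx₀ : x₀ ∈ U) :
    ∃ C : ℝ, ∃ δ > 0, ball x₀ δ ⊆ U ∧ ∀ x ∈ ball x₀ δ, ∀ y ∈ s, ‖K x y‖ ≤ C := by
  obtain ⟨δ, hδ, hsub⟩ := Metric.nhds_basis_closedBall.mem_iff.1 (hU.mem_nhds hx₀)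
  obtain ⟨C, hC⟩ := ((isCompact_closedBall x₀ δ).prod hs).exists_bound_of_continuousOn
    (hK.mono (prod_mono hsub subset_rfl))
  exact ⟨C, δ, hδ, ball_subset_closedBall.trans hsub,
    fun x hx y hy => hC (x, y) ⟨ball_subset_closedBall hx, hy⟩⟩

variable {Y : Type*} [TopologicalSpace Y] [MeasurableSpace Y] [OpensMeasurableSpace Y]
  {μ : Measure Y} [IsFiniteMeasureOnCompacts μ] {s : Set Y}

theorem continuousOn_setIntegral_of_isCompact {E F : Type*} [PseudoMetricSpace E] [ProperSpace E]
    [NormedAddCommGroup F] [NormedSpace ℝ F]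
    (hs : IsCompact s) (hsm : MeasurableSet s) {U : Set E} (hU : IsOpen U) {K : E → Y → F}
    (hK : ContinuousOn (fun p : E × Y => K p.1 p.2) (U ×ˢ s)) :
    ContinuousOn (fun x => ∫ y in s, K x y ∂μ) U := by
  intro x₀ hx₀
  obtain ⟨C, δ, hδ, hsub, hC⟩ := exists_bound_nhds_of_isCompact hs hU hK hx₀
  refine ContinuousAt.continuousWithinAt ?_
  refine continuousAt_of_dominated (bound := fun _ => C) ?_ ?_ ?_ ?_
  · filter_upwards [hU.mem_nhds hx₀] with x hx
    refine ContinuousOn.aestronglyMeasurable_of_isCompact ?_ hs hsm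
    exact hK.comp (f := fun y => (x, y)) (by fun_prop) fun y hy => ⟨hx, hy⟩
  · filter_upwards [ball_mem_nhds x₀ hδ] with x hx
    filter_upwards [ae_restrict_mem hsm] with y hy using hC x hx y hy
  · exact integrableOn_const (hs.measure_lt_top.ne)
  · filter_upwards [ae_restrict_mem hsm] with y hy
    have : ContinuousOn (fun x => K x y) U :=
      hK.comp (f := fun x => (x, y)) (by fun_prop) fun x hx => ⟨hx, hy⟩
    exact this.continuousAt (hU.mem_nhds hx₀)

theorem hasFDerivAt_setIntegral_of_isCompact {E F : Type*} [NormedAddCommGroup E]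
    [NormedSpace ℝ E] [ProperSpace E] [NormedAddCommGroup F] [NormedSpace ℝ F]
    (hs : IsCompact s) (hsm : MeasurableSet s) {U : Set E} (hU : IsOpen U) {K : E → Y → F}
    {K' : E → Y → E →L[ℝ] F}
    (hK : ContinuousOn (fun p : E × Y => K p.1 p.2) (U ×ˢ s))
    (hK' : ContinuousOn (fun p : E × Y => K' p.1 p.2) (U ×ˢ s))
    (hd : ∀ x ∈ U, ∀ y ∈ s, HasFDerivAt (fun x => K x y) (K' x y) x) {x₀ : E} (hx₀ : x₀ ∈ U) :
    HasFDerivAt (fun x => ∫ y in s, K x y ∂μ) (∫ y in s, K' x₀ y ∂μ) x₀ := by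
  obtain ⟨C, δ, hδ, hsub, hC⟩ := exists_bound_nhds_of_isCompact hs hU hK' hx₀
  have hm : ∀ x ∈ U, ContinuousOn (K x) s := fun x hx =>
    hK.comp (f := fun y => (x, y)) (by fun_prop) fun y hy => ⟨hx, hy⟩
  refine hasFDerivAt_integral_of_dominated_of_fderiv_le (bound := fun _ => C)
    (ball_mem_nhds x₀ hδ) ?_ ?_ ?_ ?_ ?_ ?_
  · filter_upwards [hU.mem_nhds hx₀] with x hx
    exact (hm x hx).aestronglyMeasurable_of_isCompact hs hsm
  · exact (hm x₀ hx₀).integrableOn_compact' hs hsm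
  · refine ContinuousOn.aestronglyMeasurable_of_isCompact ?_ hs hsm
    exact hK'.comp (f := fun y => (x₀, y)) (by fun_prop) fun y hy => ⟨hx₀, hy⟩
  · filter_upwards [ae_restrict_mem hsm] with y hy x hx using hC x hx y hy
  · exact integrableOn_const (hs.measure_lt_top.ne)
  · filter_upwards [ae_restrict_mem hsm] with y hy x hx using hd x (hsub hx) y hy

theorem hasDerivAt_setIntegral_of_isCompact {F : Type*} [NormedAddCommGroup F] [NormedSpace ℝ F]
    (hs : IsCompact s) (hsm : MeasurableSet s) {U : Set ℝ} (hU : IsOpen U) {K K' : ℝ → Y → F}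
    (hK : ContinuousOn (fun p : ℝ × Y => K p.1 p.2) (U ×ˢ s))
    (hK' : ContinuousOn (fun p : ℝ × Y => K' p.1 p.2) (U ×ˢ s))
    (hd : ∀ x ∈ U, ∀ y ∈ s, HasDerivAt (fun x => K x y) (K' x y) x) {x₀ : ℝ} (hx₀ : x₀ ∈ U) :
    HasDerivAt (fun x => ∫ y in s, K x y ∂μ) (∫ y in s, K' x₀ y ∂μ) x₀ := by
  have hK'' : ContinuousOn (fun p : ℝ × Y => ContinuousLinearMap.toSpanSingleton ℝ (K' p.1 p.2))
      (U ×ˢ s) :=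
    (ContinuousLinearMap.toSpanSingletonCLE (𝕜 := ℝ) (E := F)).continuous.comp_continuousOn hK'
  have h := (hasFDerivAt_setIntegral_of_isCompact (μ := μ) hs hsm hU hK hK''
    (fun x hx y hy => (hd x hx y hy).hasFDerivAt) hx₀).hasDerivAt
  -- Evaluating the integral of operator-valued maps needs completeness of `F`; without it every
  -- Bochner integral is zero by convention and the claim is trivial.
  by_cases hF : CompleteSpace F
  · rw [ContinuousLinearMap.integral_apply] at h
    · simpa using h
    · refine ContinuousOn.integrableOn_compact' hs hsm ?_
      exact hK''.comp (by fun_prop : ContinuousOn (fun y => (x₀, y)) s) fun y hy => ⟨hx₀, hy⟩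
  · simpa [integral, hF] using hasDerivAt_const x₀ (0 : F)

/-- The open set `V` around `s` gives meaning to joint `C¹` regularity; the derivative in `x` alone
is the joint derivative restricted to the first factor. -/
theorem contDiffOn_setIntegral_of_isCompact {E Y F : Type*} [NormedAddCommGroup E]
    [NormedSpace ℝ E] [ProperSpace E] [NormedAddCommGroup Y] [NormedSpace ℝ Y] [MeasurableSpace Y]
    [OpensMeasurableSpace Y] [NormedAddCommGroup F] [NormedSpace ℝ F] {μ : Measure Y}
    [IsFiniteMeasureOnCompacts μ] {s V : Set Y} (hs : IsCompact s) (hsm : MeasurableSet s)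
    (hV : IsOpen V) (hsV : s ⊆ V) {U : Set E} (hU : IsOpen U) {K : E → Y → F}
    (hK : ContDiffOn ℝ 1 (fun p : E × Y => K p.1 p.2) (U ×ˢ V)) :
    ContDiffOn ℝ 1 (fun x => ∫ y in s, K x y ∂μ) U ∧
      ∀ x ∈ U, fderiv ℝ (fun x => ∫ y in s, K x y ∂μ) x
        = ∫ y in s, fderiv ℝ (fun x => K x y) x ∂μ := by
  have hUV : IsOpen (U ×ˢ V) := hU.prod hV
  set K' : E → Y → E →L[ℝ] F := fun x y =>
    (fderiv ℝ (fun p : E × Y => K p.1 p.2) (x, y)).comp (ContinuousLinearMap.inl ℝ E Y) with hK'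
  have hd : ∀ x ∈ U, ∀ y ∈ V, HasFDerivAt (fun x => K x y) (K' x y) x := fun x hx y hy =>
    HasFDerivAt.comp (f := fun x => (x, y)) x
      ((hK.differentiableOn one_ne_zero).differentiableAt
        (hUV.mem_nhds ⟨hx, hy⟩)).hasFDerivAt (hasFDerivAt_prodMk_left x y)
  have hc : ContinuousOn (fun p : E × Y => K' p.1 p.2) (U ×ˢ s) := by
    have h1 := (hK.continuousOn_fderiv_of_isOpen hUV le_rfl).mono
      (prod_mono subset_rfl hsV)
    exact h1.clm_comp continuousOn_const
  have hmain : ∀ x ∈ U, HasFDerivAt (fun x => ∫ y in s, K x y ∂μ) (∫ y in s, K' x y ∂μ) x :=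
    fun x hx => hasFDerivAt_setIntegral_of_isCompact hs hsm hU
      (hK.continuousOn.mono (prod_mono subset_rfl hsV)) hc
      (fun x hx y hy => hd x hx y (hsV hy)) hx
  refine ⟨?_, fun x hx => ?_⟩
  · rw [show (1 : WithTop ℕ∞) = 0 + 1 from (zero_add 1).symm,
      contDiffOn_succ_iff_fderiv_of_isOpen hU]
    refine ⟨fun x hx => (hmain x hx).differentiableAt.differentiableWithinAt, by simp, ?_⟩
    rw [contDiffOn_zero]
    exact (continuousOn_setIntegral_of_isCompact hs hsm hU hc).congr fun x hx => (hmain x hx).fderiv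
  · rw [(hmain x hx).fderiv]
    exact setIntegral_congr_fun hsm fun y hy => (hd x hx y (hsV hy)).fderiv.symm

end ParametricIntegral

/-! ### The normalized measure of the unit sphere -/

section SphereMeasure

open MeasureTheory Metric Set

theorem exists_cos_sin_eq {a b c : ℝ} (hc : 0 ≤ c) (h : a ^ 2 + b ^ 2 = c ^ 2) :
    ∃ θ ∈ Icc (-Real.pi) Real.pi, a = c * Real.cos θ ∧ b = c * Real.sin θ := by
  have hn : ‖(⟨a, b⟩ : ℂ)‖ = c := by
    rw [← sq_eq_sq₀ (norm_nonneg _) hc, ← h, ← Complex.normSq_eq_norm_sq, Complex.normSq_mk]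
    ring
  refine ⟨Complex.arg ⟨a, b⟩, ⟨(Complex.neg_pi_lt_arg _).le, Complex.arg_le_pi _⟩, ?_, ?_⟩
  · have := Complex.norm_mul_cos_arg ⟨a, b⟩
    rw [hn] at this; exact this.symm
  · have := Complex.norm_mul_sin_arg ⟨a, b⟩
    rw [hn] at this; exact this.symm

theorem norm_sq_eq (x : ℍ[ℝ]) : ‖x‖ ^ 2 = x.re ^ 2 + x.imI ^ 2 + x.imJ ^ 2 + x.imK ^ 2 := by
  rw [sq, ← Quaternion.normSq_eq_norm_mul_self, Quaternion.normSq_def']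

/-- Spherical coordinates on the unit sphere of the quaternions. -/
def sphericalCoordMap (t : Fin 3 → ℝ) : ℍ[ℝ] :=
  (Real.cos (t 0) : ℝ) • (⟨1, 0, 0, 0⟩ : ℍ[ℝ])
    + (Real.sin (t 0) * Real.cos (t 1)) • (⟨0, 1, 0, 0⟩ : ℍ[ℝ])
    + (Real.sin (t 0) * (Real.sin (t 1) * Real.cos (t 2))) • (⟨0, 0, 1, 0⟩ : ℍ[ℝ])
    + (Real.sin (t 0) * (Real.sin (t 1) * Real.sin (t 2))) • (⟨0, 0, 0, 1⟩ : ℍ[ℝ])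

theorem sphere_subset_image_sphericalCoordMap :
    sphere (0 : ℍ[ℝ]) 1 ⊆ sphericalCoordMap '' (Icc (fun _ => -Real.pi) fun _ => Real.pi) := by
  intro x hx
  have hx1 : x.re ^ 2 + x.imI ^ 2 + x.imJ ^ 2 + x.imK ^ 2 = 1 := by
    rw [← norm_sq_eq, mem_sphere_zero_iff_norm.1 hx, one_pow]
  -- Nested polar coordinates: `(re, p)` lies on the unit circle, `(imI, q)` on the circle of radius
  -- `p`, and `(imJ, imK)` on the circle of radius `q`.
  set p : ℝ := √(x.imI ^ 2 + x.imJ ^ 2 + x.imK ^ 2)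
  set q : ℝ := √(x.imJ ^ 2 + x.imK ^ 2)
  have hp : p ^ 2 = x.imI ^ 2 + x.imJ ^ 2 + x.imK ^ 2 := Real.sq_sqrt (by positivity)
  have hq : q ^ 2 = x.imJ ^ 2 + x.imK ^ 2 := Real.sq_sqrt (by positivity)
  obtain ⟨t₀, h₀, h₀c, h₀s⟩ := exists_cos_sin_eq (a := x.re) (b := p) zero_le_one (by linarith)
  obtain ⟨t₁, h₁, h₁c, h₁s⟩ :=
    exists_cos_sin_eq (a := x.imI) (b := q) (c := p) (Real.sqrt_nonneg _)
      (show _ = p ^ 2 by linarith)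
  obtain ⟨t₂, h₂, h₂c, h₂s⟩ :=
    exists_cos_sin_eq (a := x.imJ) (b := x.imK) (c := q) (Real.sqrt_nonneg _)
      (show _ = q ^ 2 by linarith)
  clear_value p q
  refine ⟨![t₀, t₁, t₂], ⟨fun i => ?_, fun i => ?_⟩, ?_⟩
  · fin_cases i <;> simp [h₀.1, h₁.1, h₂.1]
  · fin_cases i <;> simp [h₀.2, h₁.2, h₂.2]
  · rw [one_mul] at h₀c h₀s
    subst h₀s
    subst h₁s
    ext
    · rw [h₀c]; simp [sphericalCoordMap]
    · rw [h₁c]; simp [sphericalCoordMap]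
    · rw [h₂c]; simp [sphericalCoordMap, mul_assoc]
    · rw [h₂s]; simp [sphericalCoordMap, mul_assoc]

/-- Spherical coordinates are Lipschitz on a compact cube of dimension three, whose Hausdorff
measure is Lebesgue measure, and their image covers the sphere. -/
theorem hausdorffMeasure_unitSphere_lt_top : μH[3] (univ : Set unitSphere) < ⊤ := by
  have h0 : μH[3] (univ : Set unitSphere) = μH[3] (sphere (0 : ℍ[ℝ]) 1) := by
    have := (isometry_subtype_coe (s := sphere (0 : ℍ[ℝ]) 1)).hausdorffMeasure_image
      (d := 3) (Or.inl (by norm_num)) univ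
    rw [← this, image_univ, Subtype.range_coe]
  have hcd : ContDiff ℝ 1 sphericalCoordMap := by
    unfold sphericalCoordMap
    fun_prop
  set B : Set (Fin 3 → ℝ) := Icc (fun _ => -Real.pi) fun _ => Real.pi
  obtain ⟨C, hC⟩ := (isCompact_Icc (a := fun _ : Fin 3 => -Real.pi)
    (b := fun _ => Real.pi)).exists_bound_of_continuousOn
      (hcd.continuous_fderiv one_ne_zero).continuousOn
  have hlip : LipschitzOnWith C.toNNReal sphericalCoordMap B :=
    Convex.lipschitzOnWith_of_nnnorm_fderiv_le
      (fun x _ => (hcd.differentiable one_ne_zero).differentiableAt)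
      (fun x hx => by
        rw [← NNReal.coe_le_coe, coe_nnnorm]
        exact (hC x hx).trans (Real.le_coe_toNNReal C)) (convex_Icc _ _)
  rw [h0]
  refine (measure_mono sphere_subset_image_sphericalCoordMap).trans_lt
    ((hlip.hausdorffMeasure_image_le (d := 3) (by norm_num)).trans_lt ?_)
  have hv : (μH[3] : Measure (Fin 3 → ℝ)) = volume := by
    have := hausdorffMeasure_pi_real (ι := Fin 3)
    simpa using this
  rw [hv]
  exact ENNReal.mul_lt_top (by simp) (isCompact_Icc.measure_lt_top)

/-- The projection to the three imaginary coordinates is 1-Lipschitz, so it does not increase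
Hausdorff measure, and its image contains a cube of positive volume. -/
theorem hausdorffMeasure_unitSphere_pos : 0 < μH[3] (univ : Set unitSphere) := by
  set p : unitSphere → (Fin 3 → ℝ) := fun x => ![(x : ℍ[ℝ]).imI, (x : ℍ[ℝ]).imJ, (x : ℍ[ℝ]).imK]
  have hp : LipschitzWith 1 p := by
    refine LipschitzWith.of_dist_le_mul fun x y => ?_
    rw [NNReal.coe_one, one_mul, Subtype.dist_eq, dist_eq_norm (x : ℍ[ℝ])]
    have h := norm_sq_eq ((x : ℍ[ℝ]) - y)
    refine (dist_pi_le_iff (norm_nonneg _)).2 fun i => ?_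
    fin_cases i
    all_goals
      simp only [p, Real.dist_eq]
      refine abs_le_of_sq_le_sq ?_ (norm_nonneg _)
      rw [h]
      simp
      nlinarith [sq_nonneg ((x : ℍ[ℝ]).re - (y : ℍ[ℝ]).re),
        sq_nonneg ((x : ℍ[ℝ]).imI - (y : ℍ[ℝ]).imI),
        sq_nonneg ((x : ℍ[ℝ]).imJ - (y : ℍ[ℝ]).imJ),
        sq_nonneg ((x : ℍ[ℝ]).imK - (y : ℍ[ℝ]).imK)]
  have hsub : Icc (fun _ : Fin 3 => (0 : ℝ)) (fun _ => 1 / 2) ⊆ p '' univ := by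
    intro t ht
    -- The side `1/2` keeps the sum of three squares at most `3/4`, which leaves room for a real
    -- part.
    have ht' : ∀ i, t i ^ 2 ≤ 1 / 4 := fun i => by
      have h1 : 0 ≤ t i := ht.1 i
      have h2 : t i ≤ 1 / 2 := ht.2 i
      nlinarith
    have hnn : 0 ≤ 1 - t 0 ^ 2 - t 1 ^ 2 - t 2 ^ 2 := by linarith [ht' 0, ht' 1, ht' 2]
    obtain ⟨x, hx, h0, h1, h2⟩ : ∃ x : ℍ[ℝ], x.re = √(1 - t 0 ^ 2 - t 1 ^ 2 - t 2 ^ 2) ∧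
        x.imI = t 0 ∧ x.imJ = t 1 ∧ x.imK = t 2 := ⟨⟨_, _, _, _⟩, rfl, rfl, rfl, rfl⟩
    refine ⟨⟨x, ?_⟩, mem_univ _, ?_⟩
    · refine mem_sphere_zero_iff_norm.2 ?_
      rw [← sq_eq_sq₀ (norm_nonneg _) zero_le_one, norm_sq_eq, hx, h0, h1, h2,
        Real.sq_sqrt hnn]
      ring
    · funext i; fin_cases i <;> simp [p, h0, h1, h2]
  have hv : (μH[3] : Measure (Fin 3 → ℝ)) = volume := by
    have := hausdorffMeasure_pi_real (ι := Fin 3)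
    simpa using this
  have h1 := hp.hausdorffMeasure_image_le (d := 3) (by norm_num) univ
  simp only [ENNReal.coe_one, ENNReal.one_rpow, one_mul] at h1
  refine lt_of_lt_of_le ?_ ((measure_mono hsub).trans h1)
  rw [hv, Real.volume_Icc_pi]
  simp [ENNReal.pow_pos]

instance instIsProbabilityMeasureSphereMeasure : IsProbabilityMeasure sphereMeasure := by
  refine ⟨?_⟩
  rw [sphereMeasure, Measure.smul_apply, smul_eq_mul]
  exact ENNReal.inv_mul_cancel hausdorffMeasure_unitSphere_pos.ne'
    hausdorffMeasure_unitSphere_lt_top.ne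

/-- Right multiplication by a unit quaternion, as an isometry of the unit sphere. -/
def sphereMulRight (u : ℍ[ℝ]) (hu : ‖u‖ = 1) : unitSphere ≃ᵢ unitSphere :=
  IsometryEquiv.mk' (fun x => ⟨x * u, by simp [norm_mul, hu]⟩)
    (fun x => ⟨x * u⁻¹, by simp [norm_mul, hu]⟩)
    (fun x => Subtype.ext (by
      have : u ≠ 0 := norm_ne_zero_iff.1 (by rw [hu]; exact one_ne_zero)
      simp [this]))
    (Isometry.of_dist_eq fun x y => by
      rw [Subtype.dist_eq, Subtype.dist_eq, dist_eq_norm, dist_eq_norm, ← sub_mul, norm_mul, hu,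
        mul_one])

/-- Isometries preserve Hausdorff measure. This is the only symmetry of the sphere that the mean
value property uses. -/
theorem integral_sphereMeasure_mul_right {F : Type*} [NormedAddCommGroup F] [NormedSpace ℝ F]
    (u : ℍ[ℝ]) (hu : ‖u‖ = 1) (g : ℍ[ℝ] → F) :
    ∫ x : unitSphere, g (x * u) ∂sphereMeasure = ∫ x : unitSphere, g x ∂sphereMeasure := by
  have h := (sphereMulRight u hu).measurePreserving_hausdorffMeasure 3
  rw [sphereMeasure, integral_smul_measure, integral_smul_measure,
    ← h.integral_comp (sphereMulRight u hu).toHomeomorph.measurableEmbedding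
      (fun x : unitSphere => g x)]
  rfl

end SphereMeasure

/-! ### The mean value property of harmonic functions on the quaternions -/

section MeanValue

open MeasureTheory Metric Set InnerProductSpace Laplacian

variable {F : Type*} [NormedAddCommGroup F] [NormedSpace ℝ F]

theorem norm_cos_add_sin_mul {e : ℍ[ℝ]} (he : e * e = -1) (θ : ℝ) :
    ‖(Real.cos θ : ℍ[ℝ]) + Real.sin θ • e‖ = 1 := by
  obtain ⟨h1, h2⟩ := imagUnits_props he
  have h3 := norm_sq_eq e
  rw [h1, h2] at h3
  rw [← sq_eq_sq₀ (norm_nonneg _) zero_le_one, norm_sq_eq]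
  simp [h1]
  nlinarith [Real.sin_sq_add_cos_sq θ]

/-- Differentiating the invariance of the sphere measure under right multiplication by
`cos θ + e sin θ`. -/
theorem integral_fderiv_mul_imagUnit_eq_zero {V : Set ℍ[ℝ]}
    (hVs : sphere (0 : ℍ[ℝ]) 1 ⊆ V) {g : ℍ[ℝ] → F} {g' : ℍ[ℝ] → ℍ[ℝ] →L[ℝ] F}
    (hg : ∀ x ∈ V, HasFDerivAt g (g' x) x) (hg' : ContinuousOn g' V) {e : ℍ[ℝ]}
    (he : e * e = -1) :
    ∫ x : unitSphere, g' x (x * e) ∂sphereMeasure = 0 := by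
  set c : ℝ → ℍ[ℝ] := fun θ => (Real.cos θ : ℍ[ℝ]) + Real.sin θ • e with hc
  set c' : ℝ → ℍ[ℝ] := fun θ => ((-Real.sin θ : ℝ) : ℍ[ℝ]) + Real.cos θ • e with hc'
  have hcoe : ∀ s : ℝ, (s : ℍ[ℝ]) = s • (1 : ℍ[ℝ]) := fun s => by ext <;> simp
  have hcd : ∀ θ, HasDerivAt c (c' θ) θ := by
    intro θ
    simp only [hc, hc', hcoe]
    exact ((Real.hasDerivAt_cos θ).smul_const _).add ((Real.hasDerivAt_sin θ).smul_const _)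
  have hmem : ∀ (θ : ℝ) (x : unitSphere), (x : ℍ[ℝ]) * c θ ∈ V := fun θ x => hVs (by
    rw [mem_sphere_zero_iff_norm, norm_mul, norm_cos_add_sin_mul he, mul_one]
    exact mem_sphere_zero_iff_norm.1 x.2)
  have hcc : Continuous c := continuous_iff_continuousAt.2 fun θ => (hcd θ).continuousAt
  have hcc' : Continuous c' := by
    simp only [hc', hcoe]
    fun_prop
  have hgc : ContinuousOn g V := fun x hx => (hg x hx).continuousAt.continuousWithinAt
  have hmul : Continuous fun p : ℝ × unitSphere => (p.2 : ℍ[ℝ]) * c p.1 := by fun_prop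
  have key := hasDerivAt_setIntegral_of_isCompact (μ := sphereMeasure) (s := univ)
    isCompact_univ MeasurableSet.univ (U := univ) isOpen_univ
    (K := fun θ x => g (x * c θ)) (K' := fun θ x => g' (x * c θ) (x * c' θ))
    ((hgc.comp_continuous hmul fun p => hmem p.1 p.2).continuousOn)
    ((((hg'.comp_continuous hmul fun p => hmem p.1 p.2)).clm_apply
      (by fun_prop)).continuousOn)
    (fun θ _ x _ => (hg _ (hmem θ x)).comp_hasDerivAt θ ((hcd θ).const_mul _)) (mem_univ 0)
  simp only [Measure.restrict_univ] at key
  have hconst : (fun θ => ∫ x : unitSphere, g (x * c θ) ∂sphereMeasure)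
      = fun _ => ∫ x : unitSphere, g x ∂sphereMeasure :=
    funext fun θ => integral_sphereMeasure_mul_right _ (norm_cos_add_sin_mul he θ) g
  rw [hconst] at key
  have := key.unique (hasDerivAt_const _ _)
  simpa [hc, hc'] using this

/-- The quaternion units `1, i, j, k`. -/
def quatBasis (l : Fin 4) : ℍ[ℝ] :=
  ⟨if l = 0 then 1 else 0, if l = 1 then 1 else 0, if l = 2 then 1 else 0, if l = 3 then 1 else 0⟩

@[simp] theorem re_quatBasis (l : Fin 4) : (quatBasis l).re = if l = 0 then 1 else 0 := rfl
@[simp] theorem imI_quatBasis (l : Fin 4) : (quatBasis l).imI = if l = 1 then 1 else 0 := rfl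
@[simp] theorem imJ_quatBasis (l : Fin 4) : (quatBasis l).imJ = if l = 2 then 1 else 0 := rfl
@[simp] theorem imK_quatBasis (l : Fin 4) : (quatBasis l).imK = if l = 3 then 1 else 0 := rfl

theorem quatBasis_zero : quatBasis 0 = 1 := by
  ext <;> simp

theorem quatBasis_mul_self {l : Fin 4} (hl : l ≠ 0) : quatBasis l * quatBasis l = -1 := by
  fin_cases l
  · exact absurd rfl hl
  all_goals ext <;> simp

theorem orthonormal_mul_quatBasis {x : ℍ[ℝ]} (hx : ‖x‖ = 1) :
    Orthonormal ℝ fun i => x * quatBasis i := by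
  have h := norm_sq_eq x
  rw [hx] at h
  rw [orthonormal_iff_ite]
  intro i j
  rw [Quaternion.inner_def]
  fin_cases i <;> fin_cases j <;> simp <;> linarith

/-- The orthonormal basis `x, xi, xj, xk` given by a unit quaternion `x`. -/
def mulQuatBasis {x : ℍ[ℝ]} (hx : ‖x‖ = 1) : OrthonormalBasis (Fin 4) ℝ ℍ[ℝ] :=
  OrthonormalBasis.mk (orthonormal_mul_quatBasis hx) (by
    rw [(orthonormal_mul_quatBasis hx).linearIndependent.span_eq_top_of_card_eq_finrank'
      (by simp [Quaternion.finrank_eq_four])])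

/-- The frame is adapted to the sphere: `x` is the normal direction, and `xi`, `xj`, `xk` are the
tangent directions generated by right multiplication. -/
theorem laplacian_eq_sum_mul_quatBasis (h : ℍ[ℝ] → F) {x : ℍ[ℝ]} (hx : ‖x‖ = 1) (y : ℍ[ℝ]) :
    Δ h y = ∑ i, fderiv ℝ (fderiv ℝ h) y (x * quatBasis i) (x * quatBasis i) := by
  rw [laplacian_eq_iteratedFDeriv_orthonormalBasis h (mulQuatBasis hx)]
  simp [iteratedFDeriv_two_apply, mulQuatBasis]

/-- The mean value property on spheres of the quaternions. -/
theorem integral_sphere_of_harmonicOnNhd [CompleteSpace F] {h : ℍ[ℝ] → F} {a : ℍ[ℝ]} {r : ℝ}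
    (hr : 0 ≤ r) (hh : HarmonicOnNhd h (closedBall a r)) :
    ∫ x : unitSphere, h (a + r • (x : ℍ[ℝ])) ∂sphereMeasure = h a := by
  set O : Set ℍ[ℝ] := {x | HarmonicAt h x} with hO
  have hOo : IsOpen O := isOpen_setOfPred_harmonicAt h
  set V : Set (ℝ × ℍ[ℝ]) := {p | a + p.1 • p.2 ∈ O}
  -- The radii are allowed to range over an open set `I` around `[0, r]`, so that two-sided
  -- derivatives exist at both endpoints.
  obtain ⟨I, hIo, hIr, hI⟩ : ∃ I : Set ℝ, IsOpen I ∧ Icc 0 r ⊆ I ∧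
      ∀ t ∈ I, ∀ x ∈ sphere (0 : ℍ[ℝ]) 1, a + t • x ∈ O := by
    have hVo : IsOpen V := hOo.preimage (by fun_prop)
    obtain ⟨I, W, hIo, -, hIr, hW, hIW⟩ := generalized_tube_lemma (isCompact_Icc (a := 0) (b := r))
      (isCompact_sphere (0 : ℍ[ℝ]) 1) hVo (by
        rintro ⟨t, x⟩ ⟨ht, hx⟩
        refine hh _ ?_
        simp only [mem_sphere_zero_iff_norm] at hx
        simpa [norm_smul, hx, abs_of_nonneg ht.1] using ht.2)
    exact ⟨I, hIo, hIr, fun t ht x hx => hIW (mk_mem_prod ht (hW hx))⟩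
  set h₁ := fderiv ℝ h
  set h₂ := fderiv ℝ h₁
  have hd1 : ∀ x ∈ O, HasFDerivAt h (h₁ x) x := fun x hx =>
    (hx.1.differentiableAt two_ne_zero).hasFDerivAt
  have hcd1 : ∀ x ∈ O, ContDiffAt ℝ 1 h₁ x := fun x hx =>
    hx.1.fderiv_right (m := 1) (by norm_num)
  have hd2 : ∀ x ∈ O, HasFDerivAt h₁ (h₂ x) x := fun x hx =>
    ((hcd1 x hx).differentiableAt one_ne_zero).hasFDerivAt
  have hc : ContinuousOn h O := fun x hx => (hd1 x hx).continuousAt.continuousWithinAt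
  have hc1 : ContinuousOn h₁ O := fun x hx => (hd2 x hx).continuousAt.continuousWithinAt
  have hc2 : ContinuousOn h₂ O := fun x hx =>
    ((hcd1 x hx).fderiv_right (m := 0) (by norm_num)).continuousAt.continuousWithinAt
  have hline : ContinuousOn (fun p : ℝ × unitSphere => a + p.1 • (p.2 : ℍ[ℝ])) (I ×ˢ univ) := by
    fun_prop
  have hmaps : MapsTo (fun p : ℝ × unitSphere => a + p.1 • (p.2 : ℍ[ℝ])) (I ×ˢ univ) O :=
    fun p hp => hI p.1 hp.1 _ p.2.2
  have hcoe : ContinuousOn (fun p : ℝ × unitSphere => (p.2 : ℍ[ℝ])) (I ×ˢ univ) := by fun_prop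
  have hlined : ∀ (t : ℝ) (x : ℍ[ℝ]), HasDerivAt (fun t : ℝ => a + t • x) x t := fun t x => by
    simpa using ((hasDerivAt_id t).smul_const x).const_add a
  -- `φ` is the mean over the sphere of radius `t`, and `ψ`, `χ` are its first and second
  -- derivatives; the aim is `ψ = 0`.
  set φ : ℝ → F := fun t => ∫ x : unitSphere, h (a + t • (x : ℍ[ℝ])) ∂sphereMeasure
  set ψ : ℝ → F := fun t => ∫ x : unitSphere, h₁ (a + t • (x : ℍ[ℝ])) x ∂sphereMeasure
  set χ : ℝ → F := fun t => ∫ x : unitSphere, h₂ (a + t • (x : ℍ[ℝ])) x x ∂sphereMeasure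
  have hφ : ∀ t ∈ I, HasDerivAt φ (ψ t) t := fun t ht => by
    have := hasDerivAt_setIntegral_of_isCompact (μ := sphereMeasure) (s := univ)
      isCompact_univ MeasurableSet.univ hIo
      (K := fun t x => h (a + t • (x : ℍ[ℝ]))) (K' := fun t x => h₁ (a + t • (x : ℍ[ℝ])) x)
      (hc.comp hline hmaps) ((hc1.comp hline hmaps).clm_apply hcoe)
      (fun t ht x _ => (hd1 _ (hI t ht x x.2)).comp_hasDerivAt t (hlined t x)) ht
    simpa only [Measure.restrict_univ] using this
  have hψ : ∀ t ∈ I, HasDerivAt ψ (χ t) t := fun t ht => by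
    have := hasDerivAt_setIntegral_of_isCompact (μ := sphereMeasure) (s := univ)
      isCompact_univ MeasurableSet.univ hIo
      (K := fun t x => h₁ (a + t • (x : ℍ[ℝ])) x) (K' := fun t x => h₂ (a + t • (x : ℍ[ℝ])) x x)
      ((hc1.comp hline hmaps).clm_apply hcoe)
      (((hc2.comp hline hmaps).clm_apply hcoe).clm_apply hcoe)
      (fun t ht x _ => by
        simpa [Function.comp_def] using ((hd2 _ (hI t ht x x.2)).clm_apply
          (hasFDerivAt_const (x : ℍ[ℝ]) _)).comp_hasDerivAt t (hlined t x)) ht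
    simpa only [Measure.restrict_univ] using this
  -- Rotation invariance is applied to `x ↦ h₁(a + t x)(x e)`. Its derivative along `x e` is `t
  -- h₂(xe, xe) + h₁(x e e)`, and `x e e = -x`, so the second term integrates to `-ψ`.
  have hone : ∀ t ∈ I, ∀ e : ℍ[ℝ], e * e = -1 →
      t • ∫ x : unitSphere, h₂ (a + t • (x : ℍ[ℝ])) (x * e) (x * e) ∂sphereMeasure = ψ t := by
    intro t ht e he
    have hg : ∀ x ∈ {x : ℍ[ℝ] | a + t • x ∈ O}, HasFDerivAt (fun x => h₁ (a + t • x) (x * e))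
        ((h₁ (a + t • x)).comp ((ContinuousLinearMap.mul ℝ ℍ[ℝ]).flip e)
          + (t • h₂ (a + t • x)).flip (x * e)) x := by
      intro x hx
      have h3 : HasFDerivAt (fun x : ℍ[ℝ] => a + t • x) (t • ContinuousLinearMap.id ℝ ℍ[ℝ]) x :=
        ((hasFDerivAt_id x).const_smul t).const_add a
      have h4 : HasFDerivAt (fun x => h₁ (a + t • x)) (t • h₂ (a + t • x)) x := by
        have := HasFDerivAt.comp (g := h₁) x (hd2 _ hx) h3
        rwa [ContinuousLinearMap.comp_smul, ContinuousLinearMap.comp_id] at this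
      exact h4.clm_apply ((ContinuousLinearMap.mul ℝ ℍ[ℝ]).flip e).hasFDerivAt
    have hcont : ContinuousOn (fun x : ℍ[ℝ] => a + t • x) {x : ℍ[ℝ] | a + t • x ∈ O} := by
      fun_prop
    have hcc : Continuous fun x : ℍ[ℝ] => x * e := by fun_prop
    have key := integral_fderiv_mul_imagUnit_eq_zero
      (fun x hx => hI t ht x hx) hg
      (((hc1.comp hcont fun x hx => hx).clm_comp continuousOn_const).add
        ((ContinuousLinearMap.flipₗᵢ ℝ ℍ[ℝ] ℍ[ℝ] F).continuous.comp_continuousOn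
          ((hc2.comp hcont fun x hx => hx).const_smul t) |>.clm_apply hcc.continuousOn)) he
    simp only [add_apply, ContinuousLinearMap.comp_apply,
      ContinuousLinearMap.flip_apply, ContinuousLinearMap.mul_apply', smul_apply,
      mul_assoc, he, mul_neg, mul_one, map_neg] at key
    rw [integral_add, integral_neg, integral_smul] at key
    · exact (neg_add_eq_zero.1 key).symm
    · refine (Continuous.integrable_of_hasCompactSupport ?_
        (HasCompactSupport.of_compactSpace _)).neg
      exact (hc1.comp_continuous (f := fun x : unitSphere => a + t • (x : ℍ[ℝ])) (by fun_prop)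
        fun x => hI t ht x x.2).clm_apply (by fun_prop)
    · refine (Continuous.integrable_of_hasCompactSupport ?_
        (HasCompactSupport.of_compactSpace _)).smul t
      exact ((hc2.comp_continuous (f := fun x : unitSphere => a + t • (x : ℍ[ℝ])) (by fun_prop)
        fun x => hI t ht x x.2).clm_apply (by fun_prop)).clm_apply (by fun_prop)
  -- Harmonicity trades the normal second derivative for minus the three tangential ones, each of
  -- which contributes one `ψ`.
  have hODE : ∀ t ∈ I, t • χ t = (-3 : ℝ) • ψ t := by
    intro t ht
    have hsum : ∀ x : unitSphere, h₂ (a + t • (x : ℍ[ℝ])) x x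
        = -∑ l : Fin 3, h₂ (a + t • (x : ℍ[ℝ])) (x * quatBasis l.succ) (x * quatBasis l.succ) := by
      intro x
      have h3 := laplacian_eq_sum_mul_quatBasis h (mem_sphere_zero_iff_norm.1 x.2)
        (a + t • (x : ℍ[ℝ]))
      rw [(hI t ht x x.2).2.self_of_nhds, Fin.sum_univ_succ, quatBasis_zero, mul_one] at h3
      exact eq_neg_of_add_eq_zero_left h3.symm
    have hint : ∀ l : Fin 3, Integrable (fun x : unitSphere => h₂ (a + t • (x : ℍ[ℝ]))
        (x * quatBasis l.succ) (x * quatBasis l.succ)) sphereMeasure := by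
      intro l
      refine Continuous.integrable_of_hasCompactSupport ?_ (HasCompactSupport.of_compactSpace _)
      exact ((hc2.comp_continuous (f := fun x : unitSphere => a + t • (x : ℍ[ℝ])) (by fun_prop)
        fun x => hI t ht x x.2).clm_apply (by fun_prop)).clm_apply (by fun_prop)
    simp only [χ, hsum, integral_neg, integral_finsetSum _ fun l _ => hint l, smul_neg,
      Finset.smul_sum, hone t ht _ (quatBasis_mul_self (Fin.succ_ne_zero _))]
    simp [← Nat.cast_smul_eq_nsmul ℝ]
  -- The equation makes `t³ ψ(t)` constant, hence zero. This gives `ψ = 0` for `t > 0`; at `t = 0`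
  -- the equation itself reads `0 = -3 ψ(0)`.
  have hψ0 : ∀ t ∈ Icc 0 r, ψ t = 0 := by
    have hconst : ∀ t ∈ Icc 0 r, t ^ 3 • ψ t = (0 : ℝ) ^ 3 • ψ 0 := by
      have hd : ∀ t ∈ I, HasDerivAt (fun t : ℝ => t ^ 3 • ψ t) 0 t := fun t ht => by
        have h3 := (hasDerivAt_pow 3 t).smul (hψ t ht)
        convert h3 using 1
        · rfl
        have h4 : t ^ 3 • χ t = t ^ 2 • (t • χ t) := by rw [smul_smul]; ring_nf
        rw [h4, hODE t ht, smul_smul, ← add_smul]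
        norm_num
        rw [show -(t ^ 2 * 3) + 3 * t ^ 2 = 0 by ring, zero_smul]
      exact constant_of_has_deriv_right_zero
        (fun t ht => (hd t (hIr ht)).continuousAt.continuousWithinAt)
        fun t ht => (hd t (hIr (Ico_subset_Icc_self ht))).hasDerivWithinAt
    intro t ht
    rcases ht.1.eq_or_lt with rfl | h0
    · have := hODE 0 (hIr ht)
      rw [zero_smul] at this
      exact (smul_eq_zero.1 this.symm).resolve_left (by norm_num)
    · have := hconst t ht
      rw [zero_pow three_ne_zero, zero_smul] at this
      exact (smul_eq_zero.1 this).resolve_left (pow_pos h0 3).ne'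
  have hfin : φ r = φ 0 := by
    refine constant_of_has_deriv_right_zero
      (fun t ht => (hφ t (hIr ht)).continuousAt.continuousWithinAt) (fun t ht => ?_) r
      (right_mem_Icc.2 hr)
    rw [← hψ0 t (Ico_subset_Icc_self ht)]
    exact (hφ t (hIr (Ico_subset_Icc_self ht))).hasDerivWithinAt
  simpa [φ] using hfin

end MeanValue

/-! ### Harmonicity of integrals of the kernel `1 / (ζ² - 2 ζ Re x + |x|²)` -/

section Kernel

open MeasureTheory Metric Set InnerProductSpace Laplacian

variable {V : Type*} [NormedAddCommGroup V] [InnerProductSpace ℝ V]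

/-- Harmonicity includes `C²` regularity, which here comes from the continuity of the explicit
second derivative `h₂`; the Laplacian is its trace in the basis `b`. -/
theorem harmonicOnNhd_of_hasFDerivAt [FiniteDimensional ℝ V] {E : Type*}
    [NormedAddCommGroup E] [NormedSpace ℝ E]
    {U : Set V} (hU : IsOpen U) {h : V → E} {h₁ : V → V →L[ℝ] E}
    {h₂ : V → V →L[ℝ] V →L[ℝ] E} (hd1 : ∀ x ∈ U, HasFDerivAt h (h₁ x) x)
    (hd2 : ∀ x ∈ U, HasFDerivAt h₁ (h₂ x) x) (hc : ContinuousOn h₂ U)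
    {ι : Type*} [Fintype ι] (b : OrthonormalBasis ι ℝ V)
    (h0 : ∀ x ∈ U, ∑ i, h₂ x (b i) (b i) = 0) : HarmonicOnNhd h U := by
  have e1 : EqOn (fderiv ℝ h) h₁ U := fun x hx => (hd1 x hx).fderiv
  have e2 : EqOn (fderiv ℝ (fderiv ℝ h)) h₂ U := fun x hx => by
    rw [(e1.eventuallyEq_of_mem (hU.mem_nhds hx)).fderiv_eq]
    exact (hd2 x hx).fderiv
  have hcd1 : ContDiffOn ℝ 1 h₁ U := by
    rw [show (1 : WithTop ℕ∞) = 0 + 1 from (zero_add 1).symm,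
      contDiffOn_succ_iff_fderiv_of_isOpen hU]
    refine ⟨fun x hx => (hd2 x hx).differentiableAt.differentiableWithinAt, by simp, ?_⟩
    rw [contDiffOn_zero]
    exact hc.congr fun x hx => (hd2 x hx).fderiv
  have hcd : ContDiffOn ℝ 2 h U := by
    rw [show (2 : WithTop ℕ∞) = 1 + 1 from one_add_one_eq_two.symm,
      contDiffOn_succ_iff_fderiv_of_isOpen hU]
    exact ⟨fun x hx => (hd1 x hx).differentiableAt.differentiableWithinAt, by simp,
      hcd1.congr e1⟩
  refine fun x hx => ⟨hcd.contDiffAt (hU.mem_nhds hx), ?_⟩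
  filter_upwards [hU.mem_nhds hx] with y hy
  rw [laplacian_eq_iteratedFDeriv_orthonormalBasis h b]
  simpa [iteratedFDeriv_two_apply, e2 hy] using h0 y hy

/-- The bilinear form `2 ⟪x, y⟫`, with complex values. -/
def twoInner (V : Type*) [NormedAddCommGroup V] [InnerProductSpace ℝ V] : V →L[ℝ] V →L[ℝ] ℂ :=
  (2 : ℝ) • ((ContinuousLinearMap.compL ℝ V ℝ ℂ Complex.ofRealCLM).comp (innerSL ℝ))

theorem twoInner_apply (x y : V) : twoInner V x y = 2 * (inner ℝ x y : ℝ) := by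
  simp [twoInner]

/-- The complex quadratic polynomial `ζ² - 2 ζ Re x + |x|²` in the vector `x`. -/
def kernelDen (e : V) (ζ : ℂ) (x : V) : ℂ := ζ ^ 2 - 2 * ζ * (inner ℝ e x : ℝ) + (‖x‖ ^ 2 : ℝ)

/-- The derivative of `kernelDen e ζ`. -/
def kernelDenDeriv (e : V) (ζ : ℂ) (x : V) : V →L[ℝ] ℂ :=
  twoInner V x - (ContinuousLinearMap.mul ℝ ℂ ζ).comp (twoInner V e)

theorem hasFDerivAt_kernelDen e (ζ : ℂ) (x : V) :
    HasFDerivAt (kernelDen e ζ) (kernelDenDeriv e ζ x) x := by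
  have h1 : kernelDen e ζ = fun x => (ζ ^ 2 + ((‖x‖ ^ 2 : ℝ) : ℂ))
      - (ContinuousLinearMap.mul ℝ ℂ ζ).comp (twoInner V e) x := by
    funext x
    simp only [kernelDen, ContinuousLinearMap.comp_apply, ContinuousLinearMap.mul_apply',
      twoInner_apply]
    ring
  rw [h1]
  have h2 : HasFDerivAt (fun x : V => ((‖x‖ ^ 2 : ℝ) : ℂ)) (twoInner V x) x :=
    (Complex.ofRealCLM.hasFDerivAt.comp x (hasStrictFDerivAt_norm_sq x).hasFDerivAt).congr_fderiv
      (ContinuousLinearMap.ext fun v => by simp [twoInner])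
  exact (h2.const_add (ζ ^ 2)).sub (ContinuousLinearMap.hasFDerivAt _)

theorem hasFDerivAt_kernelDenDeriv e (ζ : ℂ) (x : V) :
    HasFDerivAt (kernelDenDeriv e ζ) (twoInner V) x := by
  have h1 : kernelDenDeriv e ζ = fun x => twoInner V x -
      (ContinuousLinearMap.mul ℝ ℂ ζ).comp (twoInner V e) := rfl
  rw [h1]
  exact HasFDerivAt.sub_const (F := V →L[ℝ] ℂ) (f := twoInner V) _ (twoInner V).hasFDerivAt

/-- The first derivative of `c / kernelDen e ζ`. -/
def kernelDeriv (e : V) (c ζ : ℂ) (x : V) : V →L[ℝ] ℂ :=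
  (ContinuousLinearMap.mul ℝ ℂ (-c * (kernelDen e ζ x ^ 2)⁻¹)).comp (kernelDenDeriv e ζ x)

/-- The second derivative of `c / kernelDen e ζ`. -/
def kernelDeriv₂ (e : V) (c ζ : ℂ) (x : V) : V →L[ℝ] V →L[ℝ] ℂ :=
  (ContinuousLinearMap.compL ℝ V ℂ ℂ
      (ContinuousLinearMap.mul ℝ ℂ (-c * (kernelDen e ζ x ^ 2)⁻¹))).comp (twoInner V)
    + ((ContinuousLinearMap.compL ℝ V ℂ ℂ).flip (kernelDenDeriv e ζ x)).comp
      ((ContinuousLinearMap.mul ℝ ℂ).comp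
        ((ContinuousLinearMap.mul ℝ ℂ (2 * c * (kernelDen e ζ x ^ 3)⁻¹)).comp
          (kernelDenDeriv e ζ x)))

theorem hasFDerivAt_kernel (e : V) (c : ℂ) {ζ : ℂ} {x : V} (hx : kernelDen e ζ x ≠ 0) :
    HasFDerivAt (fun x => c * (kernelDen e ζ x)⁻¹) (kernelDeriv e c ζ x) x := by
  have h1 : HasDerivAt (fun w : ℂ => c * w⁻¹) (-c * (kernelDen e ζ x ^ 2)⁻¹) (kernelDen e ζ x) := by
    refine ((hasDerivAt_inv hx).const_mul c).congr_deriv ?_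
    ring
  refine ((h1.hasFDerivAt.restrictScalars ℝ).comp x (hasFDerivAt_kernelDen e ζ x)).congr_fderiv
    (ContinuousLinearMap.ext fun v => ?_)
  simp [kernelDeriv]
  ring

theorem hasFDerivAt_kernelDeriv e (c : ℂ) {ζ : ℂ} {x : V} (hx : kernelDen e ζ x ≠ 0) :
    HasFDerivAt (kernelDeriv e c ζ) (kernelDeriv₂ e c ζ x) x := by
  have h1 : HasDerivAt (fun w : ℂ => -c * (w ^ 2)⁻¹) (2 * c * (kernelDen e ζ x ^ 3)⁻¹)
      (kernelDen e ζ x) := by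
    refine ((((hasDerivAt_pow 2 (kernelDen e ζ x)).fun_inv
      (pow_ne_zero 2 hx))).const_mul (-c)).congr_deriv ?_
    have h3 : (kernelDen e ζ x ^ 2) ^ 2 = kernelDen e ζ x ^ 3 * kernelDen e ζ x := by ring
    rw [h3]
    field_simp
    norm_num
    ring
  have h2 : HasFDerivAt (fun x => -c * (kernelDen e ζ x ^ 2)⁻¹)
      ((ContinuousLinearMap.mul ℝ ℂ (2 * c * (kernelDen e ζ x ^ 3)⁻¹)).comp (kernelDenDeriv e ζ x))
      x := by
    refine ((h1.hasFDerivAt.restrictScalars ℝ).comp x (hasFDerivAt_kernelDen e ζ x)).congr_fderiv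
      (ContinuousLinearMap.ext fun v => ?_)
    simp
    ring
  have h3 := HasFDerivAt.comp (g := ContinuousLinearMap.mul ℝ ℂ) x
    (ContinuousLinearMap.mul ℝ ℂ).hasFDerivAt h2
  exact HasFDerivAt.clm_comp (d := kernelDenDeriv e ζ) h3 (hasFDerivAt_kernelDenDeriv e ζ x)

/-- For `N = kernelDen e ζ` the Hessian is twice the inner product, so `ΔN = 8` in dimension four,
and the complex bilinear square of the gradient is `4 N`. Hence `Δ(1/N) = 2 (4N) / N³ - 8 / N² = 0`,
and the dimension is exactly what makes the terms cancel. -/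
theorem sum_kernelDeriv₂ {e : V} (he : ‖e‖ = 1) (b : OrthonormalBasis (Fin 4) ℝ V) (c : ℂ) {ζ : ℂ}
    {x : V} (hx : kernelDen e ζ x ≠ 0) : ∑ i, kernelDeriv₂ e c ζ x (b i) (b i) = 0 := by
  have h1 : ∀ i, kernelDeriv₂ e c ζ x (b i) (b i)
      = -2 * c * (kernelDen e ζ x ^ 2)⁻¹
        + 2 * c * (kernelDen e ζ x ^ 3)⁻¹ * (kernelDenDeriv e ζ x (b i)) ^ 2 := by
    intro i
    have : inner ℝ (b i) (b i) = (1 : ℝ) := by simp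
    simp only [kernelDeriv₂, add_apply, ContinuousLinearMap.comp_apply,
      ContinuousLinearMap.compL_apply, ContinuousLinearMap.mul_apply', twoInner_apply, this,
      ContinuousLinearMap.flip_apply]
    push_cast
    ring
  -- Parseval's identity for real vectors, with complex coefficients kept outside; no conjugation of
  -- `ζ` occurs.
  have hp : ∀ y z : V, ∑ i, ((inner ℝ y (b i) : ℝ) : ℂ) * (inner ℝ z (b i) : ℝ)
      = (inner ℝ y z : ℝ) := by
    intro y z
    rw [← b.sum_inner_mul_inner y z]
    push_cast
    exact Finset.sum_congr rfl fun i _ => by rw [real_inner_comm z]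
  have h2 : ∑ i, (kernelDenDeriv e ζ x (b i)) ^ 2 = 4 * kernelDen e ζ x := by
    have h3 : ∀ i, (kernelDenDeriv e ζ x (b i)) ^ 2
        = 4 * (((inner ℝ x (b i) : ℝ) : ℂ) * (inner ℝ x (b i) : ℝ))
          - 8 * ζ * (((inner ℝ e (b i) : ℝ) : ℂ) * (inner ℝ x (b i) : ℝ))
          + 4 * ζ ^ 2 * (((inner ℝ e (b i) : ℝ) : ℂ) * (inner ℝ e (b i) : ℝ)) := by
      intro i
      simp only [kernelDenDeriv, sub_apply, ContinuousLinearMap.comp_apply,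
        ContinuousLinearMap.mul_apply', twoInner_apply]
      ring
    simp only [h3, Finset.sum_add_distrib, Finset.sum_sub_distrib, ← Finset.mul_sum, hp,
      real_inner_self_eq_norm_sq, he, kernelDen]
    push_cast
    ring
  rw [Finset.sum_congr rfl fun i _ => h1 i, Finset.sum_add_distrib,
    ← Finset.mul_sum Finset.univ (fun i => kernelDenDeriv e ζ x (b i) ^ 2), h2]
  simp
  field_simp
  ring

/-- Each integrand is harmonic in `x`, since a real linear map `g θ` independent of `x` commutes
with the Laplacian; compactness of `s` permits two differentiations under the integral sign. -/
theorem harmonicOnNhd_integral_kernel [FiniteDimensional ℝ V] {E : Type*} [NormedAddCommGroup E]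
    [NormedSpace ℝ E] [CompleteSpace E]
    (b : OrthonormalBasis (Fin 4) ℝ V) {e : V} (he : ‖e‖ = 1) {s : Set ℝ} (hs : IsCompact s)
    {U : Set V} (hU : IsOpen U) {c ζ : ℝ → ℂ} (hc : ContinuousOn c s) (hζ : ContinuousOn ζ s)
    {g : ℝ → ℂ →L[ℝ] E}
    (hg : ContinuousOn g s) (hne : ∀ x ∈ U, ∀ θ ∈ s, kernelDen e (ζ θ) x ≠ 0) :
    HarmonicOnNhd (fun x => ∫ θ in s, g θ (c θ * (kernelDen e (ζ θ) x)⁻¹)) U := by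
  have hfst : ContinuousOn (fun p : V × ℝ => p.1) (U ×ˢ s) := continuousOn_fst
  have hc' : ContinuousOn (fun p : V × ℝ => c p.2) (U ×ˢ s) :=
    hc.comp continuousOn_snd fun p hp => hp.2
  have hζ' : ContinuousOn (fun p : V × ℝ => ζ p.2) (U ×ˢ s) :=
    hζ.comp continuousOn_snd fun p hp => hp.2
  have hg' : ContinuousOn (fun p : V × ℝ => g p.2) (U ×ˢ s) :=
    hg.comp continuousOn_snd fun p hp => hp.2
  have hN : ContinuousOn (fun p : V × ℝ => kernelDen e (ζ p.2) p.1) (U ×ˢ s) := by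
    simp only [kernelDen]
    fun_prop
  have hN' : ContinuousOn (fun p : V × ℝ => kernelDenDeriv e (ζ p.2) p.1) (U ×ˢ s) := by
    exact ((twoInner V).continuous.comp_continuousOn hfst).sub
      (((ContinuousLinearMap.mul ℝ ℂ).continuous.comp_continuousOn hζ').clm_comp
        continuousOn_const)
  have hk0 : ContinuousOn (fun p : V × ℝ => c p.2 * (kernelDen e (ζ p.2) p.1)⁻¹) (U ×ˢ s) :=
    hc'.mul (hN.inv₀ fun p hp => hne p.1 hp.1 p.2 hp.2)
  have hsc : ∀ n, ContinuousOn (fun p : V × ℝ => (kernelDen e (ζ p.2) p.1 ^ n)⁻¹) (U ×ˢ s) :=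
    fun n => (hN.pow n).inv₀ fun p hp => pow_ne_zero n (hne p.1 hp.1 p.2 hp.2)
  have hmul := (ContinuousLinearMap.mul ℝ ℂ).continuous
  have hk1 : ContinuousOn (fun p : V × ℝ => kernelDeriv e (c p.2) (ζ p.2) p.1) (U ×ˢ s) :=
    (hmul.comp_continuousOn ((hc'.neg).mul (hsc 2))).clm_comp hN'
  have hk2 : ContinuousOn (fun p : V × ℝ => kernelDeriv₂ e (c p.2) (ζ p.2) p.1) (U ×ˢ s) := by
    have h4 := (hmul.comp_continuousOn
      (((continuousOn_const (c := (2 : ℂ))).mul hc').mul (hsc 3))).clm_comp hN'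
    have h5 := (ContinuousLinearMap.compL ℝ V ℂ ℂ).continuous.comp_continuousOn
      (hmul.comp_continuousOn ((hc'.neg).mul (hsc 2)))
    have h6 := (ContinuousLinearMap.compL ℝ V ℂ ℂ).flip.continuous.comp_continuousOn hN'
    exact (h5.clm_comp continuousOn_const).add
      (h6.clm_comp (continuousOn_const.clm_comp h4))
  have hK1 : ContinuousOn (fun p : V × ℝ =>
      (g p.2).comp (kernelDeriv e (c p.2) (ζ p.2) p.1)) (U ×ˢ s) := hg'.clm_comp hk1
  have hg2 : ContinuousOn (fun p : V × ℝ =>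
      ContinuousLinearMap.compL ℝ V ℂ E (g p.2)) (U ×ˢ s) :=
    (ContinuousLinearMap.compL ℝ V ℂ E).continuous.comp_continuousOn hg'
  have hK2 : ContinuousOn (fun p : V × ℝ =>
      (ContinuousLinearMap.compL ℝ V ℂ E (g p.2)).comp
        (kernelDeriv₂ e (c p.2) (ζ p.2) p.1)) (U ×ˢ s) := hg2.clm_comp hk2
  have : ProperSpace V := FiniteDimensional.proper ℝ V
  refine harmonicOnNhd_of_hasFDerivAt hU (b := b)
    (h₁ := fun x => ∫ θ in s, (g θ).comp (kernelDeriv e (c θ) (ζ θ) x))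
    (h₂ := fun x => ∫ θ in s, (ContinuousLinearMap.compL ℝ V ℂ E (g θ)).comp
        (kernelDeriv₂ e (c θ) (ζ θ) x)) ?_ ?_ ?_ ?_
  · intro x hx
    exact hasFDerivAt_setIntegral_of_isCompact hs hs.measurableSet hU (hg'.clm_apply hk0) hK1
      (fun x hx θ hθ => (g θ).hasFDerivAt.comp x (hasFDerivAt_kernel e (c θ) (hne x hx θ hθ))) hx
  · intro x hx
    exact hasFDerivAt_setIntegral_of_isCompact hs hs.measurableSet hU hK1 hK2
      (fun x hx θ hθ => (ContinuousLinearMap.compL ℝ V ℂ E (g θ)).hasFDerivAt.comp x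
        (hasFDerivAt_kernelDeriv e (c θ) (hne x hx θ hθ))) hx
  · exact continuousOn_setIntegral_of_isCompact hs hs.measurableSet hU hK2
  · intro x hx
    · have hint : IntegrableOn (fun θ => (ContinuousLinearMap.compL ℝ V ℂ E (g θ)).comp
          (kernelDeriv₂ e (c θ) (ζ θ) x)) s :=
        (hK2.comp (f := fun θ => (x, θ)) (by fun_prop) fun θ hθ => ⟨hx, hθ⟩).integrableOn_compact'
          hs hs.measurableSet
      have happ : ∀ v : V, (∫ θ in s, (ContinuousLinearMap.compL ℝ V ℂ E (g θ)).comp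
          (kernelDeriv₂ e (c θ) (ζ θ) x)) v v
            = ∫ θ in s, g θ (kernelDeriv₂ e (c θ) (ζ θ) x v v) := by
        intro v
        rw [ContinuousLinearMap.integral_apply hint,
          ContinuousLinearMap.integral_apply (hint.apply_continuousLinearMap v)]
        rfl
      simp only [happ]
      rw [← integral_finsetSum _ fun i _ => ?_]
      · refine (setIntegral_congr_fun hs.measurableSet fun θ hθ => ?_).trans (integral_zero _ _)
        simp only [← map_sum, sum_kernelDeriv₂ he b (c θ) (hne x hx θ hθ), map_zero]
      · exact (hint.apply_continuousLinearMap _).apply_continuousLinearMap _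

end Kernel

/-! ### A Cauchy formula for the spherical derivative in one variable -/

section Cauchy

open MeasureTheory Metric Set InnerProductSpace Laplacian ComplexConjugate

variable {E : Type*} [NormedAddCommGroup E] [NormedSpace ℝ E]

/-- The Cauchy-Riemann equations on `U` for the pair `u + i v`. -/
structure IsCauchyRiemannOn (U : Set ℂ) (u v : ℂ → E) : Prop where
  diff_left : ∀ z ∈ U, DifferentiableAt ℝ u z
  diff_right : ∀ z ∈ U, DifferentiableAt ℝ v z
  re_eq : ∀ z ∈ U, fderiv ℝ u z 1 = fderiv ℝ v z Complex.I
  im_eq : ∀ z ∈ U, fderiv ℝ u z Complex.I = -fderiv ℝ v z 1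

/-- `E` is only a real space, so `u + i v` has no literal meaning. Testing with a real functional
`L` produces an ordinary holomorphic function. -/
theorem IsCauchyRiemannOn.differentiableAt {U : Set ℂ} {u v : ℂ → E}
    (h : IsCauchyRiemannOn U u v) (L : E →L[ℝ] ℝ) {z : ℂ} (hz : z ∈ U) :
    DifferentiableAt ℂ (fun w => (L (u w) : ℂ) + L (v w) * Complex.I) z := by
  have hu := (Complex.ofRealCLM.comp L).hasFDerivAt.comp z (h.diff_left z hz).hasFDerivAt
  have hv := ((Complex.ofRealCLM.comp L).hasFDerivAt.comp z
    (h.diff_right z hz).hasFDerivAt).mul_const Complex.I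
  have hs := hu.add hv
  refine differentiableAt_complex_iff_differentiableAt_real.2 ⟨hs.differentiableAt, ?_⟩
  have he : fderiv ℝ (fun w => (L (u w) : ℂ) + L (v w) * Complex.I) z = _ := hs.fderiv
  rw [he]
  simp only [add_apply, ContinuousLinearMap.comp_apply, h.re_eq z hz,
    h.im_eq z hz, map_neg, Complex.ofRealCLM_apply, smul_apply, smul_eq_mul]
  linear_combination -(L (fderiv ℝ v z 1) : ℂ) * Complex.I_mul_I

/-- The circle of center `z₀` and radius `ρ` is admissible for the Cauchy formula with the factor
`κ` if it is centered on the real axis and `κ = 1`, or if it does not meet the real axis and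
`κ = 2`. -/
def IsAdmissibleCircle (z₀ : ℂ) (ρ κ : ℝ) : Prop :=
  0 < ρ ∧ ((z₀.im = 0 ∧ κ = 1) ∨ (ρ < |z₀.im| ∧ κ = 2))

theorem exists_isAdmissibleCircle {U : Set ℂ} (hU : IsOpen U) {z₀ : ℂ} (hz₀ : z₀ ∈ U) :
    ∃ ρ κ : ℝ, IsAdmissibleCircle z₀ ρ κ ∧ closedBall z₀ ρ ⊆ U := by
  obtain ⟨ρ, hρ, hsub⟩ := Metric.nhds_basis_closedBall.mem_iff.1 (hU.mem_nhds hz₀)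
  by_cases h0 : z₀.im = 0
  · exact ⟨ρ, 1, ⟨hρ, Or.inl ⟨h0, rfl⟩⟩, hsub⟩
  · have h1 : 0 < |z₀.im| := abs_pos.2 h0
    refine ⟨min ρ (|z₀.im| / 2), 2, ⟨lt_min hρ (by positivity), Or.inr ⟨?_, rfl⟩⟩,
      (closedBall_subset_closedBall (min_le_left _ _)).trans hsub⟩
    exact (min_le_right _ _).trans_lt (by linarith)

/-- If the centre is real, `conj z` is again in the open disc. Otherwise the disc lies strictly on
one side of the real axis and `conj z` on the other. -/
theorem IsAdmissibleCircle.sub_conj_ne_zero {z₀ : ℂ} {ρ κ : ℝ}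
    (h : IsAdmissibleCircle z₀ ρ κ) {z : ℂ}
    (hz : z ∈ ball z₀ ρ) {ζ : ℂ} (hζ : ζ ∈ sphere z₀ ρ) : ζ - conj z ≠ 0 := by
  rw [sub_ne_zero]
  rintro rfl
  rw [mem_sphere, Complex.dist_eq] at hζ
  rw [mem_ball, Complex.dist_eq] at hz
  rcases h.2 with ⟨h0, -⟩ | ⟨h0, -⟩
  · rw [← Complex.conj_eq_iff_im] at h0
    rw [← h0, ← map_sub, Complex.norm_conj] at hζ
    exact hz.ne hζ
  · have h1 : |(conj z - z₀).im| ≤ ρ := (Complex.abs_im_le_norm _).trans hζ.le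
    have h2 : |(z - z₀).im| < ρ := (Complex.abs_im_le_norm _).trans_lt hz
    simp only [Complex.sub_im, Complex.conj_im] at h1 h2
    rw [abs_le] at h1
    rw [abs_lt] at h2
    rcases abs_cases z₀.im with ⟨h3, -⟩ | ⟨h3, -⟩ <;> rw [h3] at h0 <;> linarith [h1.1, h1.2]

theorem IsAdmissibleCircle.den_ne_zero {z₀ : ℂ} {ρ κ : ℝ} (h : IsAdmissibleCircle z₀ ρ κ) {z : ℂ}
    (hz : z ∈ ball z₀ ρ) {ζ : ℂ} (hζ : ζ ∈ sphere z₀ ρ) : (ζ - z) * (ζ - conj z) ≠ 0 := by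
  refine mul_ne_zero (sub_ne_zero.2 ?_) (h.sub_conj_ne_zero hz hζ)
  rintro rfl
  exact (mem_ball.1 hz).ne (mem_sphere.1 hζ)

/-- The Cauchy integrals with poles `z` and `conj z` are subtracted. For a real centre the
difference is `φ z - conj (φ z)`, twice the imaginary part up to `i`; for a disc off the axis the
second pole is outside and the difference is only `φ z`, which explains `κ = 2`. -/
theorem im_eq_im_mul_integral {φ : ℂ → ℂ} {z₀ : ℂ} {ρ κ : ℝ} (h : IsAdmissibleCircle z₀ ρ κ)
    (hφ : DifferentiableOn ℂ φ (closedBall z₀ ρ))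
    (hconj : z₀.im = 0 → ∀ z ∈ ball z₀ ρ, φ (conj z) = conj (φ z)) {z : ℂ} (hz : z ∈ ball z₀ ρ) :
    (φ z).im = z.im * ∫ θ in Icc 0 (2 * Real.pi), ((κ / (2 * Real.pi) : ℝ) * circleMap 0 ρ θ *
      ((circleMap z₀ ρ θ - z) * (circleMap z₀ ρ θ - conj z))⁻¹ * φ (circleMap z₀ ρ θ)).re := by
  have hρ := h.1
  -- `ψ` is the normalized Cauchy integral at `conj z`: it is `conj (φ z)` for a real centre and `0`
  -- otherwise.
  obtain ⟨ψ, hψ, hψ'⟩ : ∃ ψ : ℂ, (∮ ζ in C(z₀, ρ), (ζ - conj z)⁻¹ • φ ζ)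
      = (2 * Real.pi * Complex.I : ℂ) • ψ ∧ (κ / 2 * ((φ z - ψ) / Complex.I)).re = (φ z).im := by
    rcases h.2 with ⟨h0, rfl⟩ | ⟨h0, rfl⟩
    · refine ⟨conj (φ z), ?_, ?_⟩
      · rw [← hconj h0 z hz]
        refine hφ.circleIntegral_sub_inv_smul ?_
        rw [mem_ball, Complex.dist_eq] at hz ⊢
        rw [← Complex.conj_eq_iff_im] at h0
        rwa [← h0, ← map_sub, Complex.norm_conj]
      · rw [Complex.sub_conj]
        have : ((2 * (φ z).im : ℝ) * Complex.I) / Complex.I = (2 * (φ z).im : ℝ) :=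
          mul_div_cancel_right₀ _ Complex.I_ne_zero
        rw [this]
        simp
    · refine ⟨0, ?_, ?_⟩
      · rw [smul_zero]
        refine DiffContOnCl.circleIntegral_eq_zero hρ.le (DifferentiableOn.diffContOnCl ?_)
        refine DifferentiableOn.smul (𝕜' := ℂ) (fun ζ hζ => ?_)
          (hφ.mono closure_ball_subset_closedBall)
        refine (DifferentiableAt.inv (by fun_prop) ?_).differentiableWithinAt
        have hζ' := closure_ball_subset_closedBall hζ
        rw [sub_ne_zero]
        rintro rfl
        rw [mem_closedBall, Complex.dist_eq] at hζ'
        rw [mem_ball, Complex.dist_eq] at hz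
        have h1 : |(conj z - z₀).im| ≤ ρ := (Complex.abs_im_le_norm _).trans hζ'
        have h2 : |(z - z₀).im| < ρ := (Complex.abs_im_le_norm _).trans_lt hz
        simp only [Complex.sub_im, Complex.conj_im] at h1 h2
        rw [abs_le] at h1
        rw [abs_lt] at h2
        rcases abs_cases z₀.im with ⟨h3, -⟩ | ⟨h3, -⟩ <;> rw [h3] at h0 <;>
          linarith [h1.1, h1.2, h2.1, h2.2]
      · simp [Complex.div_I]
  set N : ℂ → ℂ := fun ζ => (ζ - z) * (ζ - conj z)
  have hN : ∀ ζ ∈ sphere z₀ ρ, N ζ ≠ 0 := fun ζ hζ => h.den_ne_zero hz hζ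
  have hφc : ContinuousOn φ (sphere z₀ ρ) := hφ.continuousOn.mono sphere_subset_closedBall
  have hi : ∀ w : ℂ, (∀ ζ ∈ sphere z₀ ρ, ζ - w ≠ 0) →
      CircleIntegrable (fun ζ => (ζ - w)⁻¹ • φ ζ) z₀ ρ := fun w hw =>
    ContinuousOn.circleIntegrable hρ.le
      (((continuousOn_id.sub continuousOn_const).inv₀ hw).smul hφc)
  have h1 := hφ.circleIntegral_sub_inv_smul hz
  have h2 : (∮ ζ in C(z₀, ρ), (2 * z.im * Complex.I) * ((N ζ)⁻¹ * φ ζ))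
      = (2 * Real.pi * Complex.I : ℂ) * (φ z - ψ) := by
    rw [mul_sub, ← smul_eq_mul (2 * Real.pi * Complex.I : ℂ) (φ z), ← h1,
      ← smul_eq_mul (2 * Real.pi * Complex.I : ℂ) ψ, ← hψ, ← circleIntegral.integral_sub
      (hi z fun ζ hζ => left_ne_zero_of_mul (hN ζ hζ))
      (hi (conj z) fun ζ hζ => right_ne_zero_of_mul (hN ζ hζ))]
    refine circleIntegral.integral_congr hρ.le fun ζ hζ => ?_
    have e1 := left_ne_zero_of_mul (hN ζ hζ)
    have e2 := right_ne_zero_of_mul (hN ζ hζ)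
    -- Partial fractions: the difference of the two Cauchy kernels is `2 i Im z / N`, which is the
    -- source of the factor `Im z`.
    have e3 : (2 * z.im * Complex.I : ℂ) = (ζ - conj z) - (ζ - z) := by
      rw [sub_sub_sub_cancel_left, Complex.sub_conj]
      push_cast; ring
    simp only [N, e3, smul_eq_mul]
    field_simp
  set W : ℝ → ℂ := fun θ => circleMap 0 ρ θ * (N (circleMap z₀ ρ θ))⁻¹ * φ (circleMap z₀ ρ θ)
  have hWc : Continuous W := by
    have hc : Continuous fun θ => circleMap z₀ ρ θ := continuous_circleMap z₀ ρ
    have hm : ∀ θ, circleMap z₀ ρ θ ∈ sphere z₀ ρ := fun θ => circleMap_mem_sphere z₀ hρ.le θ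
    refine ((continuous_circleMap 0 ρ).mul (Continuous.inv₀ ?_ fun θ => hN _ (hm θ))).mul
      (hφc.comp_continuous hc hm)
    exact (hc.sub continuous_const).mul (hc.sub continuous_const)
  have h3 : (2 * z.im * Complex.I) * Complex.I * ∫ θ in Icc 0 (2 * Real.pi), W θ
      = (2 * Real.pi * Complex.I : ℂ) * (φ z - ψ) := by
    rw [← h2, circleIntegral, intervalIntegral.integral_of_le Real.two_pi_pos.le,
      integral_Icc_eq_integral_Ioc, ← integral_const_mul]
    refine integral_congr_ae (Filter.Eventually.of_forall fun θ => ?_)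
    simp only [W, deriv_circleMap, smul_eq_mul]
    ring
  have h4 : (z.im : ℂ) * ((κ / (2 * Real.pi) : ℝ) * ∫ θ in Icc 0 (2 * Real.pi), W θ)
      = κ / 2 * ((φ z - ψ) / Complex.I) := by
    have hpi : (Real.pi : ℂ) ≠ 0 := Complex.ofReal_ne_zero.2 Real.pi_ne_zero
    set A := ∫ θ in Icc 0 (2 * Real.pi), W θ
    have h5 : z.im * A = -(Real.pi * Complex.I * (φ z - ψ)) := by
      linear_combination (-1 / 2 : ℂ) * h3 + z.im * A * Complex.I_mul_I
    rw [mul_left_comm, h5, Complex.div_I]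
    push_cast
    field_simp
  have h5 : (∫ θ in Icc 0 (2 * Real.pi), ((κ / (2 * Real.pi) : ℝ) * circleMap 0 ρ θ *
      ((circleMap z₀ ρ θ - z) * (circleMap z₀ ρ θ - conj z))⁻¹ * φ (circleMap z₀ ρ θ)).re)
      = ((κ / (2 * Real.pi) : ℝ) * ∫ θ in Icc 0 (2 * Real.pi), W θ).re := by
    rw [← integral_const_mul]
    have := Complex.reCLM.integral_comp_comm (μ := volume.restrict (Icc 0 (2 * Real.pi)))
      (φ := fun θ => ((κ / (2 * Real.pi) : ℝ) : ℂ) * W θ)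
      ((continuous_const.mul hWc).integrableOn_Icc)
    simp only [Complex.reCLM_apply] at this
    rw [← this]
    simp only [W, N, mul_assoc]
  rw [h5, ← hψ', ← h4, Complex.re_ofReal_mul]

/-- The real linear map `w ↦ Re w • a - Im w • b`, the real part of `w (a + i b)`. -/
def reMulCLM (a b : E) : ℂ →L[ℝ] E := Complex.reCLM.smulRight a - Complex.imCLM.smulRight b

theorem reMulCLM_apply (a b : E) (w : ℂ) : reMulCLM a b w = w.re • a - w.im • b := by
  simp [reMulCLM]

theorem continuousOn_reMulCLM {X : Type*} [TopologicalSpace X] {s : Set X} {a b : X → E}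
    (ha : ContinuousOn a s) (hb : ContinuousOn b s) :
    ContinuousOn (fun x => reMulCLM (a x) (b x)) s :=
  ((ContinuousLinearMap.smulRightL ℝ ℂ E Complex.reCLM).continuous.comp_continuousOn ha).sub
    ((ContinuousLinearMap.smulRightL ℝ ℂ E Complex.imCLM).continuous.comp_continuousOn hb)

/-- Cauchy's formula for the quotient `v z / Im z`. -/
theorem IsCauchyRiemannOn.eq_im_smul_integral [CompleteSpace E] {U : Set ℂ} {u v : ℂ → E}
    (h : IsCauchyRiemannOn U u v) (hu : ∀ z ∈ U, u (conj z) = u z)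
    (hv : ∀ z ∈ U, v (conj z) = -v z) {z₀ : ℂ} {ρ κ : ℝ} (hρ : IsAdmissibleCircle z₀ ρ κ)
    (hsub : closedBall z₀ ρ ⊆ U) {z : ℂ} (hz : z ∈ ball z₀ ρ) :
    v z = z.im • ∫ θ in Icc 0 (2 * Real.pi),
      reMulCLM (u (circleMap z₀ ρ θ)) (v (circleMap z₀ ρ θ))
        ((κ / (2 * Real.pi) : ℝ) * circleMap 0 ρ θ *
          ((circleMap z₀ ρ θ - z) * (circleMap z₀ ρ θ - conj z))⁻¹) := by
  have hc : Continuous fun θ => circleMap z₀ ρ θ := continuous_circleMap z₀ ρ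
  have hm : ∀ θ, circleMap z₀ ρ θ ∈ sphere z₀ ρ := fun θ => circleMap_mem_sphere z₀ hρ.1.le θ
  have hmU : ∀ θ, circleMap z₀ ρ θ ∈ U := fun θ => hsub (sphere_subset_closedBall (hm θ))
  have huc : Continuous fun θ => u (circleMap z₀ ρ θ) := continuous_iff_continuousAt.2 fun θ =>
    (h.diff_left _ (hmU θ)).continuousAt.comp hc.continuousAt
  have hvc : Continuous fun θ => v (circleMap z₀ ρ θ) := continuous_iff_continuousAt.2 fun θ =>
    (h.diff_right _ (hmU θ)).continuousAt.comp hc.continuousAt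
  -- By Hahn-Banach it suffices to test the identity against real functionals, which reduces it to
  -- the scalar case.
  rw [SeparatingDual.eq_iff_forall_dual_eq (R := ℝ)]
  intro L
  have key := im_eq_im_mul_integral hρ
    (fun w hw => (h.differentiableAt L (hsub hw)).differentiableWithinAt)
    (fun _ w hw => by
      have hwU := hsub (ball_subset_closedBall hw)
      simp only [hu w hwU, hv w hwU, map_neg, map_add, map_mul, Complex.conj_ofReal,
        Complex.conj_I]
      push_cast; ring) hz
  rw [map_smul, ← L.integral_comp_comm, smul_eq_mul]
  · rw [show L (v z) = ((L (u z) : ℂ) + L (v z) * Complex.I).im by simp, key]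
    congr 1
    refine integral_congr_ae (Filter.Eventually.of_forall fun θ => ?_)
    simp only [reMulCLM_apply, map_sub, map_smul, smul_eq_mul]
    rw [Complex.mul_re]
    simp
  · refine Continuous.integrableOn_Icc ?_
    refine Continuous.clm_apply ?_ ?_
    · exact continuousOn_univ.1 (continuousOn_reMulCLM huc.continuousOn hvc.continuousOn)
    · refine (continuous_const.mul (continuous_circleMap 0 ρ)).mul (Continuous.inv₀ ?_
        fun θ => hρ.den_ne_zero hz (hm θ))
      exact (hc.sub continuous_const).mul (hc.sub continuous_const)

end Cauchy

/-! ### The mean value property of spherical derivatives in one variable -/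

section OneVariable

open MeasureTheory Metric Set InnerProductSpace Laplacian ComplexConjugate

variable {E : Type*} [NormedAddCommGroup E] [NormedSpace ℝ E]

/-- The factor can be cancelled on a dense set, and continuity does the rest. Identities for
quotients by imaginary parts are transferred to real points in this way. -/
theorem eqOn_of_smul_eq_smul {X : Type*} [TopologicalSpace X] {V : Set X} (hV : IsOpen V)
    {β : X → ℝ} (hβ : Dense {x | β x ≠ 0}) {f g : X → E} (hf : ContinuousOn f V)
    (hg : ContinuousOn g V) (h : ∀ x ∈ V, β x • f x = β x • g x) : EqOn f g V := by
  refine EqOn.of_subset_closure (s := V ∩ {x | β x ≠ 0}) (fun x hx => ?_) hf hg inter_subset_left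
    (hβ.open_subset_closure_inter hV)
  exact smul_right_injective E hx.2 (h x hx.1)

theorem dense_im_ne_zero : Dense {z : ℂ | z.im ≠ 0} :=
  (dense_compl_singleton (0 : ℝ)).preimage Complex.isOpenMap_im

/-- The complex number `Re x + i |Im x|` attached to a quaternion `x`. -/
def sliceCoord (x : ℍ[ℝ]) : ℂ := ⟨x.re, ‖x.im‖⟩

theorem continuous_sliceCoord : Continuous sliceCoord := by
  have h : sliceCoord = fun x => Complex.equivRealProdCLM.symm (x.re, ‖x.im‖) := rfl
  rw [h]
  exact Complex.equivRealProdCLM.symm.continuous.comp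
    (Quaternion.continuous_re.prodMk Quaternion.continuous_im.norm)

/-- The product depends on `x` only through `Re x` and `|x|²`, hence polynomially on the real
coordinates of `x`, although `sliceCoord` is not differentiable at real points. -/
theorem kernelDen_one_eq (ζ : ℂ) (x : ℍ[ℝ]) :
    kernelDen 1 ζ x = (ζ - sliceCoord x) * (ζ - conj (sliceCoord x)) := by
  have h1 : inner ℝ (1 : ℍ[ℝ]) x = x.re := by rw [Quaternion.inner_def]; simp
  have h2 : ‖x‖ ^ 2 = x.re ^ 2 + ‖x.im‖ ^ 2 := by
    rw [norm_sq_eq, norm_sq_eq]; simp; ring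
  have h3 : sliceCoord x = x.re + ‖x.im‖ * Complex.I := (Complex.mk_eq_add_mul_I _ _)
  rw [kernelDen, h1, h2, h3]
  simp only [map_add, map_mul, Complex.conj_ofReal, Complex.conj_I]
  push_cast
  linear_combination (‖x.im‖ : ℂ) ^ 2 * Complex.I_mul_I

/-- Near `sliceCoord x` the function `Q` coincides with a Cauchy integral, by cancellation of `Im z`
off the real axis and continuity. Composed with `sliceCoord`, this integral has a harmonic kernel.
-/
theorem harmonicAt_comp_sliceCoord [CompleteSpace E] {U : Set ℂ} (hU : IsOpen U) {u v Q : ℂ → E}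
    (h : IsCauchyRiemannOn U u v) (hu : ∀ z ∈ U, u (conj z) = u z)
    (hv : ∀ z ∈ U, v (conj z) = -v z) (hQ : ContinuousOn Q U) (hvQ : ∀ z ∈ U, v z = z.im • Q z)
    {x : ℍ[ℝ]} (hx : sliceCoord x ∈ U) : HarmonicAt (fun x => Q (sliceCoord x)) x := by
  obtain ⟨ρ, κ, hρ, hsub⟩ := exists_isAdmissibleCircle hU hx
  set z₀ := sliceCoord x
  have hc : Continuous fun θ => circleMap z₀ ρ θ := continuous_circleMap z₀ ρ
  have hm : ∀ θ, circleMap z₀ ρ θ ∈ sphere z₀ ρ := fun θ => circleMap_mem_sphere z₀ hρ.1.le θ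
  have hmU : ∀ θ, circleMap z₀ ρ θ ∈ U := fun θ => hsub (sphere_subset_closedBall (hm θ))
  have huc : Continuous fun θ => u (circleMap z₀ ρ θ) := continuous_iff_continuousAt.2 fun θ =>
    (h.diff_left _ (hmU θ)).continuousAt.comp hc.continuousAt
  have hvc : Continuous fun θ => v (circleMap z₀ ρ θ) := continuous_iff_continuousAt.2 fun θ =>
    (h.diff_right _ (hmU θ)).continuousAt.comp hc.continuousAt
  have hg : Continuous fun θ => reMulCLM (u (circleMap z₀ ρ θ)) (v (circleMap z₀ ρ θ)) :=
    continuousOn_univ.1 (continuousOn_reMulCLM huc.continuousOn hvc.continuousOn)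
  have hw : Continuous fun θ => ((κ / (2 * Real.pi) : ℝ) : ℂ) * circleMap 0 ρ θ :=
    continuous_const.mul (continuous_circleMap 0 ρ)
  have hcont : ContinuousOn (fun z => ∫ θ in Icc 0 (2 * Real.pi),
      reMulCLM (u (circleMap z₀ ρ θ)) (v (circleMap z₀ ρ θ))
        ((κ / (2 * Real.pi) : ℝ) * circleMap 0 ρ θ *
          ((circleMap z₀ ρ θ - z) * (circleMap z₀ ρ θ - conj z))⁻¹)) (ball z₀ ρ) := by
    refine continuousOn_setIntegral_of_isCompact isCompact_Icc measurableSet_Icc isOpen_ball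
      (ContinuousOn.clm_apply (hg.comp continuous_snd).continuousOn
        ((hw.comp continuous_snd).continuousOn.mul (ContinuousOn.inv₀ ?_ ?_)))
    · refine Continuous.continuousOn ?_
      have h1 : Continuous fun p : ℂ × ℝ => circleMap z₀ ρ p.2 := hc.comp continuous_snd
      exact (h1.sub continuous_fst).mul (h1.sub (Complex.continuous_conj.comp continuous_fst))
    · exact fun p hp => hρ.den_ne_zero hp.1 (hm p.2)
  have heq := eqOn_of_smul_eq_smul isOpen_ball dense_im_ne_zero
    (hQ.mono (ball_subset_closedBall.trans hsub)) hcont fun z hz => by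
      rw [← h.eq_im_smul_integral hu hv hρ hsub hz, hvQ z (hsub (ball_subset_closedBall hz))]
  have hWo : IsOpen (sliceCoord ⁻¹' ball z₀ ρ) := isOpen_ball.preimage continuous_sliceCoord
  have hxW : x ∈ sliceCoord ⁻¹' ball z₀ ρ := mem_ball_self hρ.1
  have hharm := harmonicOnNhd_integral_kernel (mulQuatBasis (x := 1) norm_one)
    (e := (1 : ℍ[ℝ])) norm_one (s := Icc 0 (2 * Real.pi)) isCompact_Icc hWo hw.continuousOn
    hc.continuousOn hg.continuousOn (fun y hy θ _ => by
      rw [kernelDen_one_eq]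
      exact hρ.den_ne_zero hy (hm θ))
  refine (harmonicAt_congr_nhds ?_).2 (hharm x hxW)
  filter_upwards [hWo.mem_nhds hxW] with y hy
  simp only [kernelDen_one_eq]
  exact heq hy

/-- The mean value property of the quotient `v z / Im z` as a function on the quaternions. -/
theorem integral_comp_sliceCoord [CompleteSpace E] {U : Set ℂ} (hU : IsOpen U) {u v Q : ℂ → E}
    (h : IsCauchyRiemannOn U u v) (hu : ∀ z ∈ U, u (conj z) = u z)
    (hv : ∀ z ∈ U, v (conj z) = -v z) (hQ : ContinuousOn Q U) (hvQ : ∀ z ∈ U, v z = z.im • Q z)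
    {a : ℍ[ℝ]} {r : ℝ} (hr : 0 ≤ r) (ha : ∀ x ∈ closedBall a r, sliceCoord x ∈ U) :
    ∫ x : unitSphere, Q (sliceCoord (a + r • (x : ℍ[ℝ]))) ∂sphereMeasure = Q (sliceCoord a) :=
  integral_sphere_of_harmonicOnNhd (h := fun x => Q (sliceCoord x)) hr fun x hx =>
    harmonicAt_comp_sliceCoord hU h hu hv hQ hvQ (ha x hx)

end OneVariable

/-! ### Division of holomorphic stem functions by the imaginary parts -/

section Quotient

open MeasureTheory Metric Set ComplexConjugate

variable {n : ℕ} {D : Set (Fin n → ℂ)} {R : Finset (Fin n)} {G : (Fin n → ℂ) → StemValue n}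

/-- A function that behaves as a holomorphic stem function in the variables with index in `R`. -/
structure IsHolomorphicStemIn (D : Set (Fin n → ℂ)) (R : Finset (Fin n))
    (G : (Fin n → ℂ) → StemValue n) : Prop where
  conjAt_mem_iff : ∀ (h : Fin n) (z : Fin n → ℂ), conjAt h z ∈ D ↔ z ∈ D
  contDiffOn : ContDiffOn ℝ 1 G D
  parity : ∀ h ∈ R, ∀ z ∈ D, ∀ K : Finset (Fin n),
    G (conjAt h z) K = (-1 : ℝ) ^ (K ∩ {h}).card • G z K
  dbar_eq_zero : ∀ h ∈ R, ∀ z ∈ D, stemDbar h G z = 0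

theorem IsHolomorphicStem.isHolomorphicStemIn (hG : IsHolomorphicStem D G) (R : Finset (Fin n)) :
    IsHolomorphicStemIn D R G where
  conjAt_mem_iff := hG.isStem.conjAt_mem_iff
  contDiffOn := hG.contDiffOn
  parity h _ z hz K := hG.isStem.parity z hz K h
  dbar_eq_zero h _ := hG.dbar_eq_zero h

theorem dense_im_apply_ne_zero (h : Fin n) : Dense {z : Fin n → ℂ | (z h).im ≠ 0} :=
  dense_im_ne_zero.preimage (isOpenMap_eval h)

theorem hasFDerivAt_comp_update {T : Finset (Fin n)} {h : Fin n} {z : Fin n → ℂ} {w : ℂ}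
    (hd : DifferentiableAt ℝ G (Function.update z h w)) :
    HasFDerivAt (fun w => G (Function.update z h w) T)
      (((ContinuousLinearMap.proj T).comp (fderiv ℝ G (Function.update z h w))).comp
        (ContinuousLinearMap.single ℝ (fun _ : Fin n => ℂ) h)) w := by
  have h1 : HasFDerivAt (fun w => Function.update z h w)
      (ContinuousLinearMap.single ℝ (fun _ : Fin n => ℂ) h) w := by
    refine (hasFDerivAt_update z w).congr_fderiv ?_
    ext v i
    by_cases hi : i = h
    · subst hi; simp
    · simp [hi]
  exact ((ContinuousLinearMap.proj (R := ℝ) (φ := fun _ : Finset (Fin n) => ℍ[ℝ])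
    T).hasFDerivAt.comp _ hd.hasFDerivAt).comp w h1

theorem stemDbar_apply_eq_zero_iff {h : Fin n} {z : Fin n → ℂ} {T : Finset (Fin n)} :
    stemDbar h G z T = 0 ↔
      partialRe h G z T + complexStructure h (partialIm h G z) T = 0 := by
  rw [stemDbar, Pi.smul_apply, smul_eq_zero_iff_right (by norm_num)]
  rfl

theorem complexStructure_of_notMem {h : Fin n} {T : Finset (Fin n)} (hT : h ∉ T)
    (v : StemValue n) : complexStructure h v T = -v (insert h T) := by
  have h1 : T ∆ {h} = insert h T := by
    ext i; by_cases hi : i = h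
    · subst hi; simp [Finset.mem_symmDiff, hT]
    · simp [Finset.mem_symmDiff, hi]
  rw [complexStructure, h1, Finset.inter_singleton_of_mem (Finset.mem_insert_self h T)]
  simp

theorem complexStructure_insert {h : Fin n} {T : Finset (Fin n)} (hT : h ∉ T)
    (v : StemValue n) : complexStructure h v (insert h T) = v T := by
  have h1 : (insert h T) ∆ {h} = T := by
    ext i; by_cases hi : i = h
    · subst hi; simp [Finset.mem_symmDiff, hT]
    · simp [Finset.mem_symmDiff, hi]
  rw [complexStructure, h1, Finset.inter_singleton_of_notMem hT]
  simp

/-- The operator `𝓙_h` only exchanges the components `T` and `T ∪ {h}`, up to sign, so these two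
components of `∂̄_h G = 0` are the two Cauchy-Riemann equations. -/
theorem IsHolomorphicStemIn.isCauchyRiemannOn (hD : IsOpen D) (hG : IsHolomorphicStemIn D R G)
    {h : Fin n} (hR : h ∈ R) {T : Finset (Fin n)} (hT : h ∉ T) (z : Fin n → ℂ) :
    IsCauchyRiemannOn {w | Function.update z h w ∈ D} (fun w => G (Function.update z h w) T)
      (fun w => G (Function.update z h w) (insert h T)) := by
  have hd : ∀ w ∈ {w | Function.update z h w ∈ D}, DifferentiableAt ℝ G (Function.update z h w) :=
    fun w hw => (hG.contDiffOn.differentiableOn one_ne_zero).differentiableAt (hD.mem_nhds hw)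
  refine ⟨fun w hw => (hasFDerivAt_comp_update (hd w hw)).differentiableAt,
    fun w hw => (hasFDerivAt_comp_update (hd w hw)).differentiableAt, fun w hw => ?_,
    fun w hw => ?_⟩
  · rw [(hasFDerivAt_comp_update (hd w hw)).fderiv, (hasFDerivAt_comp_update (hd w hw)).fderiv]
    have h1 := stemDbar_apply_eq_zero_iff.1 (congrFun (hG.dbar_eq_zero h hR _ hw) T)
    rw [complexStructure_of_notMem hT] at h1
    exact eq_of_sub_eq_zero ((sub_eq_add_neg _ _).trans h1)
  · rw [(hasFDerivAt_comp_update (hd w hw)).fderiv, (hasFDerivAt_comp_update (hd w hw)).fderiv]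
    have h1 := stemDbar_apply_eq_zero_iff.1 (congrFun (hG.dbar_eq_zero h hR _ hw) (insert h T))
    rw [complexStructure_insert hT] at h1
    exact eq_neg_of_add_eq_zero_right h1

theorem update_conj_eq_conjAt (h : Fin n) (z : Fin n → ℂ) (w : ℂ) :
    Function.update z h (conj w) = conjAt h (Function.update z h w) := by
  simp [conjAt]

theorem IsHolomorphicStemIn.even_update (hG : IsHolomorphicStemIn D R G)
    {h : Fin n} (hR : h ∈ R) {T : Finset (Fin n)} (hT : h ∉ T) (z : Fin n → ℂ) :
    ∀ w ∈ {w | Function.update z h w ∈ D},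
      G (Function.update z h (conj w)) T = G (Function.update z h w) T := fun w hw => by
  rw [update_conj_eq_conjAt, hG.parity h hR _ hw, Finset.inter_singleton_of_notMem hT]
  simp

theorem IsHolomorphicStemIn.odd_update (hG : IsHolomorphicStemIn D R G)
    {h : Fin n} (hR : h ∈ R) {T : Finset (Fin n)} (hT : h ∈ T) (z : Fin n → ℂ) :
    ∀ w ∈ {w | Function.update z h w ∈ D},
      G (Function.update z h (conj w)) T = -G (Function.update z h w) T := fun w hw => by
  rw [update_conj_eq_conjAt, hG.parity h hR _ hw, Finset.inter_singleton_of_mem hT]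
  simp

theorem isOpen_update_preimage (hD : IsOpen D) (h : Fin n) (z : Fin n → ℂ) :
    IsOpen {w | Function.update z h w ∈ D} :=
  hD.preimage (continuous_const.update h continuous_id)

/-- Near a point with `z_h` real, the component `G_(T ∪ {h})` is the product of `Im z_h` and
a function of class `C¹`. -/
theorem IsHolomorphicStemIn.exists_local_quotient (hD : IsOpen D) (hG : IsHolomorphicStemIn D R G)
    {h : Fin n} (hR : h ∈ R) {T : Finset (Fin n)} (hT : h ∉ T) {z₀ : Fin n → ℂ} (hz₀ : z₀ ∈ D)
    (h0 : (z₀ h).im = 0) : ∃ W : Set (Fin n → ℂ), IsOpen W ∧ z₀ ∈ W ∧ W ⊆ D ∧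
      ∃ I : (Fin n → ℂ) → ℍ[ℝ], ContDiffOn ℝ 1 I W ∧
        ∀ z ∈ W, G z (insert h T) = (z h).im • I z := by
  obtain ⟨δ, hδ, hball⟩ := Metric.isOpen_iff.1 hD z₀ hz₀
  -- Half the radius leaves the same margin for every coordinate in the supremum metric. The circle
  -- is centred at the fixed real point `z₀ h`, so it does not move with `z` and the case `κ = 1`
  -- applies.
  set ρ := δ / 2 with hρdef
  have hρ : IsAdmissibleCircle (z₀ h) ρ 1 := ⟨by positivity, Or.inl ⟨h0, rfl⟩⟩
  have hlt : ρ < δ := half_lt_self hδ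
  have hupd : ∀ z ∈ ball z₀ ρ, ∀ w ∈ closedBall (z₀ h) ρ, Function.update z h w ∈ D := by
    intro z hz w hw
    refine hball ((dist_pi_lt_iff hδ).2 fun i => ?_)
    by_cases hi : i = h
    · subst hi
      rw [Function.update_self]
      exact (mem_closedBall.1 hw).trans_lt hlt
    · rw [Function.update_of_ne hi]
      exact ((dist_le_pi_dist z z₀ i).trans_lt hz).trans hlt
  have hzh : ∀ z ∈ ball z₀ ρ, z h ∈ ball (z₀ h) ρ := fun z hz =>
    (dist_le_pi_dist z z₀ h).trans_lt hz
  have hm : ∀ θ, circleMap (z₀ h) ρ θ ∈ sphere (z₀ h) ρ := fun θ =>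
    circleMap_mem_sphere _ hρ.1.le θ
  refine ⟨ball z₀ ρ, isOpen_ball, mem_ball_self hρ.1,
    (ball_subset_ball hlt.le).trans hball, fun z => ∫ θ in Icc 0 (2 * Real.pi),
      reMulCLM (G (Function.update z h (circleMap (z₀ h) ρ θ)) T)
        (G (Function.update z h (circleMap (z₀ h) ρ θ)) (insert h T))
        (((1 : ℝ) / (2 * Real.pi) : ℝ) * circleMap 0 ρ θ *
          ((circleMap (z₀ h) ρ θ - z h) * (circleMap (z₀ h) ρ θ - conj (z h)))⁻¹), ?_, ?_⟩
  -- The Cauchy integrand is jointly `C¹` in all variables and the angle: `G` is evaluated on the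
  -- circle, and the kernel is smooth because its denominator does not vanish. Division by `Im z_h`
  -- thus loses no regularity.
  · refine (contDiffOn_setIntegral_of_isCompact isCompact_Icc measurableSet_Icc isOpen_univ
      (subset_univ _) isOpen_ball ?_).1
    simp only [reMulCLM_apply]
    have hcm : ∀ c, ContDiff ℝ 1 fun p : (Fin n → ℂ) × ℝ => circleMap c ρ p.2 := fun c =>
      (contDiff_circleMap c ρ).comp contDiff_snd
    have hev : ContDiff ℝ 1 fun p : (Fin n → ℂ) × ℝ => p.1 h :=
      (contDiff_apply ℝ ℂ h).comp contDiff_fst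
    have hup : ContDiff ℝ 1 fun p : (Fin n → ℂ) × ℝ =>
        Function.update p.1 h (circleMap (z₀ h) ρ p.2) := by
      refine contDiff_pi.2 fun i => ?_
      by_cases hi : i = h
      · subst hi
        simpa using hcm _
      · simpa [hi, Function.comp_def] using
          (contDiff_apply ℝ ℂ i).comp (contDiff_fst (F := ℝ) (E := Fin n → ℂ))
    have hGc : ∀ S, ContDiffOn ℝ 1 (fun p : (Fin n → ℂ) × ℝ =>
        G (Function.update p.1 h (circleMap (z₀ h) ρ p.2)) S) (ball z₀ ρ ×ˢ univ) := fun S =>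
      (contDiff_apply ℝ ℍ[ℝ] S).comp_contDiffOn (hG.contDiffOn.comp hup.contDiffOn
        fun p hp => hupd p.1 hp.1 _ (sphere_subset_closedBall (hm p.2)))
    have hden : ContDiffOn ℝ 1 (fun p : (Fin n → ℂ) × ℝ =>
        (((1 : ℝ) / (2 * Real.pi) : ℝ) : ℂ) * circleMap 0 ρ p.2 *
          ((circleMap (z₀ h) ρ p.2 - p.1 h) * (circleMap (z₀ h) ρ p.2 - conj (p.1 h)))⁻¹)
        (ball z₀ ρ ×ˢ univ) := by
      refine (contDiff_const.mul (hcm 0)).contDiffOn.mul (ContDiffOn.inv ?_ ?_)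
      · exact (((hcm _).sub hev).mul
          ((hcm _).sub (Complex.conjCLE.contDiff.comp hev))).contDiffOn
      · exact fun p hp => hρ.den_ne_zero (hzh p.1 hp.1) (hm p.2)
    exact ((Complex.reCLM.contDiff.comp_contDiffOn hden).smul (hGc T)).sub
      ((Complex.imCLM.contDiff.comp_contDiffOn hden).smul (hGc _))
  · intro z hz
    have h1 := (hG.isCauchyRiemannOn hD hR hT z).eq_im_smul_integral (hG.even_update hR hT z)
      (hG.odd_update hR (Finset.mem_insert_self h T) z) hρ (fun w hw => hupd z hz w hw) (hzh z hz)
    simpa only [Function.update_eq_self] using h1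

/-- The components `G_(T ∪ {h}) / Im z_h`, extended to the points where `z_h` is real. -/
def stemQuotient (h : Fin n) (G : (Fin n → ℂ) → StemValue n) (z : Fin n → ℂ) : StemValue n :=
  fun T => if h ∈ T then 0 else
    if (z h).im = 0 then partialIm h G z (insert h T) else (z h).im⁻¹ • G z (insert h T)

theorem IsHolomorphicStemIn.im_smul_stemQuotient (hG : IsHolomorphicStemIn D R G)
    {h : Fin n} (hR : h ∈ R) {z : Fin n → ℂ} (hz : z ∈ D) {T : Finset (Fin n)} (hT : h ∉ T) :
    (z h).im • stemQuotient h G z T = G z (insert h T) := by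
  by_cases h0 : (z h).im = 0
  · have h1 := hG.parity h hR z hz (insert h T)
    rw [conjAt, Complex.conj_eq_iff_im.2 h0, Function.update_eq_self,
      Finset.inter_singleton_of_mem (Finset.mem_insert_self h T), Finset.card_singleton, pow_one,
      neg_one_smul] at h1
    have h2 : (2 : ℝ) • G z (insert h T) = 0 := by
      rw [two_smul]
      nth_rewrite 2 [h1]
      exact add_neg_cancel _
    rw [h0, zero_smul, (smul_eq_zero.1 h2).resolve_left two_ne_zero]
  · simp [stemQuotient, hT, h0]

/-- Away from `Im z_h = 0` this is ordinary division. At a real value the local Cauchy quotient is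
`C¹`, and it agrees nearby with `stemQuotient`, including the value prescribed on the real locus. -/
theorem IsHolomorphicStemIn.contDiffOn_stemQuotient (hD : IsOpen D)
    (hG : IsHolomorphicStemIn D R G) {h : Fin n} (hR : h ∈ R) :
    ContDiffOn ℝ 1 (stemQuotient h G) D := by
  refine contDiffOn_pi.2 fun T => ?_
  by_cases hT : h ∈ T
  · simpa [stemQuotient, hT] using contDiffOn_const
  intro z₀ hz₀
  refine ContDiffAt.contDiffWithinAt ?_
  have him : ContDiff ℝ 1 fun z : Fin n → ℂ => (z h).im :=
    Complex.imCLM.contDiff.comp (contDiff_apply ℝ ℂ h)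
  by_cases h0 : (z₀ h).im = 0
  · obtain ⟨W, hWo, hzW, hWD, I, hI, hGI⟩ := hG.exists_local_quotient hD hR hT hz₀ h0
    refine (hI.contDiffAt (hWo.mem_nhds hzW)).congr_of_eventuallyEq ?_
    filter_upwards [hWo.mem_nhds hzW] with z hz
    by_cases h1 : (z h).im = 0
    · simp only [stemQuotient, hT, h1, if_true, if_false]
      have hd : HasFDerivAt I (fderiv ℝ I z) z :=
        ((hI.differentiableOn one_ne_zero).differentiableAt (hWo.mem_nhds hz)).hasFDerivAt
      have hd1 : HasFDerivAt (fun z : Fin n → ℂ => (z h).im)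
          (Complex.imCLM.comp (ContinuousLinearMap.proj h)) z :=
        (Complex.imCLM.comp (ContinuousLinearMap.proj (R := ℝ) (φ := fun _ : Fin n => ℂ)
          h)).hasFDerivAt
      -- Differentiating `(Im z_h) I` in the direction of `Im z_h` at a real value leaves only `I`,
      -- which is why `stemQuotient` takes the partial derivative as its value there.
      have hd2 := hd1.smul hd
      have hd3 : HasFDerivAt (fun z => G z (insert h T))
          ((ContinuousLinearMap.proj (insert h T)).comp (fderiv ℝ G z)) z :=
        (ContinuousLinearMap.proj (R := ℝ) (φ := fun _ : Finset (Fin n) => ℍ[ℝ])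
          (insert h T)).hasFDerivAt.comp z ((hG.contDiffOn.differentiableOn
            one_ne_zero).differentiableAt (hD.mem_nhds (hWD hz))).hasFDerivAt
      have hd4 := hd3.unique (hd2.congr_of_eventuallyEq (by
        filter_upwards [hWo.mem_nhds hz] with y hy using hGI y hy))
      have := DFunLike.congr_fun hd4 (Pi.single h Complex.I)
      simpa [h1, partialIm] using this
    · simp only [stemQuotient, hT, h1, if_false, hGI z hz]
      rw [inv_smul_smul₀ h1]
  · have hGT : ContDiffAt ℝ 1 (fun z => G z (insert h T)) z₀ :=
      (contDiff_apply ℝ ℍ[ℝ] (insert h T)).contDiffAt.comp z₀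
        (hG.contDiffOn.contDiffAt (hD.mem_nhds hz₀))
    refine ((him.contDiffAt.inv h0).smul hGT).congr_of_eventuallyEq ?_
    filter_upwards [him.continuous.continuousAt.eventually_ne h0] with z hz
    simp [stemQuotient, hT, hz]

end Quotient

/-! ### Holomorphy of the quotients in the remaining variables, iterated division, and mean values
-/

section QuotientHolomorphic

open MeasureTheory Metric Set ComplexConjugate

variable {n : ℕ} {D : Set (Fin n → ℂ)} {R : Finset (Fin n)} {G : (Fin n → ℂ) → StemValue n}

theorem conjAt_apply_of_ne {h l : Fin n} (hl : h ≠ l) (z : Fin n → ℂ) : conjAt l z h = z h := by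
  simp [conjAt, hl]

theorem continuous_conjAt (l : Fin n) : Continuous (conjAt l) :=
  continuous_id.update l (Complex.continuous_conj.comp (continuous_apply l))

theorem insert_inter_singleton_of_ne {h l : Fin n} (hl : h ≠ l) (T : Finset (Fin n)) :
    insert h T ∩ {l} = T ∩ {l} := by
  ext i
  simp only [Finset.mem_inter, Finset.mem_insert, Finset.mem_singleton]
  constructor
  · rintro ⟨rfl | hi, rfl⟩
    · exact absurd rfl hl
    · exact ⟨hi, rfl⟩
  · exact fun ⟨hi, hil⟩ => ⟨Or.inr hi, hil⟩

theorem insert_symmDiff_singleton_of_ne {h l : Fin n} (hl : h ≠ l) (T : Finset (Fin n)) :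
    insert h T ∆ {l} = insert h (T ∆ {l}) := by
  ext i
  simp only [Finset.mem_symmDiff, Finset.mem_insert, Finset.mem_singleton]
  by_cases hi : i = h
  · subst hi; simp [hl]
  · simp [hi]

theorem mem_symmDiff_singleton_of_ne {h l : Fin n} (hl : h ≠ l) (T : Finset (Fin n)) :
    h ∈ T ∆ {l} ↔ h ∈ T := by
  simp [Finset.mem_symmDiff, hl]

/-- Along a direction with `v h = 0` the factor `Im z_h` is constant, so it passes through the
derivative. -/
theorem IsHolomorphicStemIn.im_smul_fderiv_stemQuotient (hD : IsOpen D)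
    (hG : IsHolomorphicStemIn D R G) {h : Fin n} (hR : h ∈ R) {z : Fin n → ℂ} (hz : z ∈ D)
    {T : Finset (Fin n)} (hT : h ∉ T) {v : Fin n → ℂ} (hv : v h = 0) :
    (z h).im • fderiv ℝ (stemQuotient h G) z v T = fderiv ℝ G z v (insert h T) := by
  have hd1 : HasFDerivAt (fun z : Fin n → ℂ => (z h).im)
      (Complex.imCLM.comp (ContinuousLinearMap.proj h)) z :=
    (Complex.imCLM.comp (ContinuousLinearMap.proj (R := ℝ) (φ := fun _ : Fin n => ℂ)
      h)).hasFDerivAt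
  have hd2 : HasFDerivAt (fun z => stemQuotient h G z T)
      ((ContinuousLinearMap.proj T).comp (fderiv ℝ (stemQuotient h G) z)) z :=
    (ContinuousLinearMap.proj (R := ℝ) (φ := fun _ : Finset (Fin n) => ℍ[ℝ])
      T).hasFDerivAt.comp z (((hG.contDiffOn_stemQuotient hD hR).differentiableOn
        one_ne_zero).differentiableAt (hD.mem_nhds hz)).hasFDerivAt
  have hd3 : HasFDerivAt (fun z => G z (insert h T))
      ((ContinuousLinearMap.proj (insert h T)).comp (fderiv ℝ G z)) z :=
    (ContinuousLinearMap.proj (R := ℝ) (φ := fun _ : Finset (Fin n) => ℍ[ℝ])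
      (insert h T)).hasFDerivAt.comp z ((hG.contDiffOn.differentiableOn
        one_ne_zero).differentiableAt (hD.mem_nhds hz)).hasFDerivAt
  have hd4 := hd3.unique ((hd1.smul hd2).congr_of_eventuallyEq (by
    filter_upwards [hD.mem_nhds hz] with y hy using (hG.im_smul_stemQuotient hR hy hT).symm))
  have := DFunLike.congr_fun hd4 v
  simpa [hv] using this.symm

theorem complexStructure_stemQuotient {h l : Fin n} (hl : h ≠ l) {c : ℝ} {v w : StemValue n}
    (hvw : ∀ T, h ∉ T → c • v T = w (insert h T)) {T : Finset (Fin n)} (hT : h ∉ T) :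
    c • complexStructure l v T = complexStructure l w (insert h T) := by
  rw [complexStructure, complexStructure, smul_comm, insert_symmDiff_singleton_of_ne hl,
    hvw _ (by rwa [mem_symmDiff_singleton_of_ne hl]), insert_inter_singleton_of_ne hl]

/-- For `l ≠ h` both conjugation of `z_l` and `∂̄_l` commute with multiplication by `Im z_h`. The
parity and the equation for the quotient therefore follow from those of `G` after multiplication by
`Im z_h`, and density removes this factor. The index `h` itself is given up. -/
theorem IsHolomorphicStemIn.stemQuotient (hD : IsOpen D) (hG : IsHolomorphicStemIn D R G)
    {h : Fin n} (hR : h ∈ R) : IsHolomorphicStemIn D (R.erase h) (stemQuotient h G) := by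
  have hcd := hG.contDiffOn_stemQuotient hD hR
  have hcont : ∀ T, ContinuousOn (fun z => SeveralQuaternions.stemQuotient h G z T) D := fun T =>
    (continuous_apply T).comp_continuousOn hcd.continuousOn
  refine ⟨hG.conjAt_mem_iff, hcd, fun l hl z hz T => ?_, fun l hl z hz => ?_⟩
  · have hlh : h ≠ l := (Finset.ne_of_mem_erase hl).symm
    by_cases hT : h ∈ T
    · simp [SeveralQuaternions.stemQuotient, hT]
    refine eqOn_of_smul_eq_smul hD (dense_im_apply_ne_zero h)
      ((hcont T).comp (continuous_conjAt l).continuousOn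
        fun w hw => (hG.conjAt_mem_iff l w).2 hw)
      ((hcont T).const_smul ((-1 : ℝ) ^ (T ∩ {l}).card)) (fun w hw => ?_) hz
    have h1 := hG.im_smul_stemQuotient hR ((hG.conjAt_mem_iff l w).2 hw) hT
    rw [conjAt_apply_of_ne hlh, hG.parity l (Finset.mem_of_mem_erase hl) w hw,
      insert_inter_singleton_of_ne hlh, ← hG.im_smul_stemQuotient hR hw hT] at h1
    exact h1.trans (smul_comm _ _ _)
  · have hlh : h ≠ l := (Finset.ne_of_mem_erase hl).symm
    have hfd := hcd.continuousOn_fderiv_of_isOpen hD le_rfl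
    have hp : ∀ (v : Fin n → ℂ) (T : Finset (Fin n)),
        ContinuousOn (fun z => fderiv ℝ (SeveralQuaternions.stemQuotient h G) z v T) D := fun v T =>
      (continuous_apply T).comp_continuousOn (hfd.clm_apply continuousOn_const)
    have hmem : ∀ (z : Fin n → ℂ) (v : Fin n → ℂ) (T : Finset (Fin n)), z ∈ D → h ∈ T →
        fderiv ℝ (SeveralQuaternions.stemQuotient h G) z v T = 0 := by
      intro z v T hz hT
      have h1 : HasFDerivAt (fun z => SeveralQuaternions.stemQuotient h G z T)
          ((ContinuousLinearMap.proj T).comp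
            (fderiv ℝ (SeveralQuaternions.stemQuotient h G) z)) z :=
        (ContinuousLinearMap.proj (R := ℝ) (φ := fun _ : Finset (Fin n) => ℍ[ℝ])
          T).hasFDerivAt.comp z
            ((hcd.differentiableOn one_ne_zero).differentiableAt (hD.mem_nhds hz)).hasFDerivAt
      have h2 : (fun z => SeveralQuaternions.stemQuotient h G z T) = fun _ => 0 := by
        funext z; simp [SeveralQuaternions.stemQuotient, hT]
      rw [h2] at h1
      exact DFunLike.congr_fun (h1.unique (hasFDerivAt_const 0 z)) v
    funext T
    rw [Pi.zero_apply, stemDbar_apply_eq_zero_iff]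
    by_cases hT : h ∈ T
    · rw [partialRe, hmem z _ T hz hT, complexStructure, partialIm,
        hmem z _ _ hz (by rwa [mem_symmDiff_singleton_of_ne hlh])]
      simp
    refine eqOn_of_smul_eq_smul (g := fun _ => (0 : ℍ[ℝ])) hD
      (dense_im_apply_ne_zero h) (f := fun z =>
      partialRe l (SeveralQuaternions.stemQuotient h G) z T
        + complexStructure l (partialIm l (SeveralQuaternions.stemQuotient h G) z) T)
      ((hp _ T).add (((hp (Pi.single l Complex.I) (T ∆ {l})).const_smul
        ((-1 : ℝ) ^ ((T ∆ {l}) ∩ {l}).card)).congr fun _ _ => rfl))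
      continuousOn_const (fun w hw => ?_) hz
    have hs : ∀ c : ℂ, (Pi.single l c : Fin n → ℂ) h = 0 := fun c => by
      rw [Pi.single_apply, if_neg hlh]
    rw [smul_add, smul_zero, complexStructure_stemQuotient hlh
      (v := partialIm l (SeveralQuaternions.stemQuotient h G) w) (w := partialIm l G w)
      (fun T hT => hG.im_smul_fderiv_stemQuotient hD hR hw hT (hs _)) hT, partialRe,
      hG.im_smul_fderiv_stemQuotient hD hR hw hT (hs _)]
    exact stemDbar_apply_eq_zero_iff.1
      (congrFun (hG.dbar_eq_zero l (Finset.mem_of_mem_erase hl) w hw) (insert h T))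

/-- Division of the components of a holomorphic stem function by several imaginary parts. -/
theorem IsHolomorphicStemIn.exists_quotient (hD : IsOpen D) (hG : IsHolomorphicStemIn D R G)
    (P : Finset (Fin n)) (hP : P ⊆ R) : ∃ G', IsHolomorphicStemIn D (R \ P) G' ∧
      ∀ z ∈ D, ∀ T, Disjoint T P → (∏ h ∈ P, (z h).im) • G' z T = G z (T ∪ P) := by
  induction P using Finset.induction_on with
  | empty => exact ⟨G, by simpa using hG, by simp⟩
  | insert h P hh ih =>
    obtain ⟨G₁, hG₁, h₁⟩ := ih ((Finset.subset_insert h P).trans hP)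
    have hmem : h ∈ R \ P := Finset.mem_sdiff.2 ⟨hP (Finset.mem_insert_self h P), hh⟩
    refine ⟨SeveralQuaternions.stemQuotient h G₁, ?_, fun z hz T hT => ?_⟩
    · rw [Finset.sdiff_insert]
      exact hG₁.stemQuotient hD hmem
    · rw [Finset.disjoint_insert_right] at hT
      rw [Finset.prod_insert hh, mul_comm, mul_smul, hG₁.im_smul_stemQuotient hmem hz hT.1,
        h₁ z hz _ (Finset.disjoint_insert_left.2 ⟨hh, hT.2⟩), Finset.insert_union,
        Finset.union_insert]

theorem dense_prod_im_ne_zero (P : Finset (Fin n)) :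
    Dense {z : Fin n → ℂ | ∏ h ∈ P, (z h).im ≠ 0} := by
  induction P using Finset.induction_on with
  | empty => simp
  | insert h P hh ih =>
    have hopen : IsOpen {z : Fin n → ℂ | ∏ h ∈ P, (z h).im ≠ 0} :=
      isOpen_ne.preimage (continuous_finsetProd _ fun i _ =>
        Complex.continuous_im.comp (continuous_apply i))
    have := (dense_im_apply_ne_zero h).inter_of_isOpen_right ih hopen
    refine this.mono fun z hz => ?_
    rw [mem_ofPred_eq, Finset.prod_insert hh]
    exact mul_ne_zero hz.1 hz.2

/-- The continuous quotient `G_P / ∏_(h ∈ P) Im z_h`. -/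
theorem IsHolomorphicStemIn.exists_continuousOn_quotient (hD : IsOpen D)
    (hG : IsHolomorphicStemIn D Finset.univ G) (P : Finset (Fin n)) :
    ∃ Q : (Fin n → ℂ) → ℍ[ℝ], ContinuousOn Q D ∧ ∀ z ∈ D, (∏ h ∈ P, (z h).im) • Q z = G z P := by
  obtain ⟨G', hG', h'⟩ := hG.exists_quotient hD P (Finset.subset_univ P)
  exact ⟨fun z => G' z ∅, (continuous_apply _).comp_continuousOn hG'.contDiffOn.continuousOn,
    fun z hz => by simpa using h' z hz ∅ (Finset.disjoint_empty_left P)⟩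

theorem update_canonicalPoint (x : Fin n → ℍ[ℝ]) (h : Fin n) (y : ℍ[ℝ]) :
    canonicalPoint (Function.update x h y)
      = Function.update (canonicalPoint x) h (sliceCoord y) := by
  funext i
  by_cases hi : i = h
  · subst hi; simp [canonicalPoint, sliceCoord]
  · simp [canonicalPoint, hi]

/-- The mean value property of the quotients `G_P / ∏_(h ∈ P) Im z_h` in a variable `x_h` with
`h ∈ P`. -/
theorem IsHolomorphicStemIn.integral_quotient (hD : IsOpen D)
    (hG : IsHolomorphicStemIn D Finset.univ G) {P : Finset (Fin n)} {h : Fin n} (hP : h ∈ P)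
    {Q : (Fin n → ℂ) → ℍ[ℝ]} (hQ : ContinuousOn Q D)
    (hGQ : ∀ z ∈ D, (∏ h ∈ P, (z h).im) • Q z = G z P) {x : Fin n → ℍ[ℝ]} {a : ℍ[ℝ]} {r : ℝ}
    (hr : 0 ≤ r) (ha : ∀ y ∈ closedBall a r, canonicalPoint (Function.update x h y) ∈ D) :
    ∫ y : unitSphere, Q (canonicalPoint (Function.update x h (a + r • (y : ℍ[ℝ])))) ∂sphereMeasure
      = Q (canonicalPoint (Function.update x h a)) := by
  -- All imaginary parts except that of `z_h` are divided out first. Then `G'_∅` and `G'_{h}` still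
  -- form a Cauchy-Riemann pair in `z_h`, and `Q` is the remaining quotient of `G'_{h}` by `Im z_h`.
  obtain ⟨G', hG', h'⟩ := hG.exists_quotient hD (P.erase h) (Finset.subset_univ _)
  have hmem : h ∈ Finset.univ \ P.erase h := by simp
  have hc' : ContinuousOn (fun z => G' z {h}) D :=
    (continuous_apply _).comp_continuousOn hG'.contDiffOn.continuousOn
  have him : Continuous fun z : Fin n → ℂ => (z h).im :=
    Complex.continuous_im.comp (continuous_apply h)
  have hkey : EqOn (fun z => G' z {h}) (fun z => (z h).im • Q z) D := by
    refine eqOn_of_smul_eq_smul hD (dense_prod_im_ne_zero (P.erase h)) hc'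
      (him.continuousOn.smul hQ) fun z hz => ?_
    rw [h' z hz {h} (by simp), smul_smul, mul_comm, Finset.mul_prod_erase P (fun i => (z i).im) hP,
      hGQ z hz]
    congr 1
    ext i
    by_cases hi : i = h
    · subst hi; simp [hP]
    · simp [hi]
  simp only [update_canonicalPoint] at ha ⊢
  set z := canonicalPoint x
  have hupd : Continuous fun w => Function.update z h w := continuous_const.update h continuous_id
  exact integral_comp_sliceCoord (isOpen_update_preimage hD h z)
    (hG'.isCauchyRiemannOn hD hmem (Finset.notMem_empty h) z)
    (hG'.even_update hmem (Finset.notMem_empty h) z)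
    (hG'.odd_update hmem (Finset.mem_insert_self h ∅) z)
    (Q := fun w => Q (Function.update z h w)) (hQ.comp hupd.continuousOn fun w hw => hw)
    (fun w hw => by simpa using hkey hw) hr ha

end QuotientHolomorphic

/-! ### The product with the coordinate stem functions -/

section StemAlgebra

open Set

variable {n : ℕ} {D : Set (Fin n → ℂ)} {G : (Fin n → ℂ) → StemValue n}

/-- Parity of cardinality is additive under symmetric difference; all sign rules for the product `⊗`
reduce to this. -/
theorem neg_one_pow_card_symmDiff {α : Type*} [DecidableEq α] (A B : Finset α) :
    (-1 : ℝ) ^ (A ∆ B).card = (-1) ^ A.card * (-1) ^ B.card := by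
  have h1 : (A ∆ B).card + 2 * (A ∩ B).card = A.card + B.card := by
    have h2 := Finset.card_sdiff_add_card_inter A B
    have h3 := Finset.card_sdiff_add_card_inter B A
    rw [symmDiff_def, Finset.sup_eq_union, Finset.card_union_of_disjoint disjoint_sdiff_sdiff]
    rw [Finset.inter_comm] at h3
    omega
  rw [← pow_add, ← h1, pow_add, pow_mul]
  simp

theorem complexStructure_add (j : Fin n) (v w : StemValue n) :
    complexStructure j (v + w) = complexStructure j v + complexStructure j w := by
  funext L; simp [complexStructure]

theorem complexStructure_smul (j : Fin n) (c : ℝ) (v : StemValue n) :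
    complexStructure j (c • v) = c • complexStructure j v := by
  funext L; simp [complexStructure, smul_comm c]

theorem complexStructure_complexStructure_self (j : Fin n) (v : StemValue n) :
    complexStructure j (complexStructure j v) = -v := by
  funext L
  rw [Pi.neg_apply, complexStructure, complexStructure, smul_smul, symmDiff_symmDiff_cancel_right,
    ← Finset.inf_eq_inter, inf_symmDiff_distrib_right, Finset.inf_eq_inter, Finset.inf_eq_inter,
    neg_one_pow_card_symmDiff, mul_right_comm, ← mul_pow]
  simp

theorem complexStructure_comm (j h : Fin n) (v : StemValue n) :
    complexStructure j (complexStructure h v) = complexStructure h (complexStructure j v) := by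
  by_cases hjh : j = h
  · rw [hjh]
  have h1 : ∀ (a b : Fin n) (L : Finset (Fin n)), a ≠ b → (L ∆ {b}) ∩ {a} = L ∩ {a} := by
    intro a b L hab
    ext i
    simp only [Finset.mem_inter, Finset.mem_singleton, Finset.mem_symmDiff]
    constructor
    · rintro ⟨hi, rfl⟩; simpa [hab] using hi
    · rintro ⟨hi, rfl⟩; simpa [hab] using hi
  funext L
  simp only [complexStructure, smul_smul]
  rw [symmDiff_right_comm L {j} {h}, h1 h j (L ∆ {h}) (Ne.symm hjh),
    symmDiff_right_comm L {h} {j}, h1 j h (L ∆ {j}) hjh, mul_comm]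

theorem stemMul_single (K : Finset (Fin n)) (q : ℍ[ℝ]) (w : StemValue n) :
    stemMul (Pi.single K q) w = fun L => (-1 : ℝ) ^ ((L ∆ K) ∩ K).card • (q * w (L ∆ K)) := by
  funext L
  rw [stemMul, Finset.sum_eq_single K, Finset.sum_eq_single (L ∆ K)]
  · rw [symmDiff_comm L K, symmDiff_symmDiff_cancel_left, if_pos rfl, Pi.single_eq_same]
  · intro H _ hH
    rw [if_neg]
    rintro rfl
    exact hH (by rw [symmDiff_comm K H, symmDiff_symmDiff_cancel_right])
  · simp
  · intro K' _ hK'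
    simp [hK']
  · simp

theorem stemMul_add_left (v v' w : StemValue n) :
    stemMul (v + v') w = stemMul v w + stemMul v' w := by
  funext L
  simp only [stemMul, Pi.add_apply, ← Finset.sum_add_distrib]
  refine Finset.sum_congr rfl fun K _ => Finset.sum_congr rfl fun H _ => ?_
  split_ifs
  · rw [add_mul, smul_add]
  · rw [add_zero]

theorem stemMul_smul_left (c : ℝ) (v w : StemValue n) :
    stemMul (c • v) w = c • stemMul v w := by
  funext L
  simp only [stemMul, Pi.smul_apply, Finset.smul_sum]
  refine Finset.sum_congr rfl fun K _ => Finset.sum_congr rfl fun H _ => ?_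
  split_ifs
  · rw [smul_mul_assoc, smul_comm]
  · rw [smul_zero]

/-- `𝓙_j` is multiplication by `e_j`, so this is the instance `(e_j v) w = e_j (v w)` of
associativity, obtained by reindexing the sum with `K ↦ K ∆ {j}` and comparing signs. -/
theorem stemMul_complexStructure_left (j : Fin n) (v w : StemValue n) :
    stemMul (complexStructure j v) w = complexStructure j (stemMul v w) := by
  funext L
  rw [complexStructure, stemMul, stemMul, Finset.smul_sum]
  refine Finset.sum_equiv
    ⟨fun K => K ∆ {j}, fun K => K ∆ {j}, fun K => symmDiff_symmDiff_cancel_right _ _,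
      fun K => symmDiff_symmDiff_cancel_right _ _⟩ (by simp) fun K _ => ?_
  rw [Finset.smul_sum]
  refine Finset.sum_congr rfl fun H _ => ?_
  simp only [Equiv.coe_fn_mk, smul_ite, smul_zero]
  have hiff : K ∆ {j} ∆ H = L ∆ {j} ↔ K ∆ H = L := by
    rw [symmDiff_right_comm, symmDiff_left_inj]
  by_cases hL : K ∆ H = L
  · rw [if_pos hL, if_pos (hiff.2 hL), complexStructure, smul_mul_assoc, smul_smul, smul_smul]
    congr 1
    subst hL
    rw [symmDiff_right_comm, ← Finset.inf_eq_inter (s := (K ∆ {j}) ∆ H), inf_symmDiff_distrib_right,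
      Finset.inf_eq_inter, Finset.inf_eq_inter, neg_one_pow_card_symmDiff,
      ← Finset.inf_eq_inter (s := H) (t := K ∆ {j}), inf_symmDiff_distrib_left,
      Finset.inf_eq_inter, Finset.inf_eq_inter, neg_one_pow_card_symmDiff]
    have h1 : ((-1 : ℝ) ^ (H ∩ {j}).card) * (-1) ^ (H ∩ {j}).card = 1 := by
      rw [← mul_pow]; simp
    linear_combination (-(-1 : ℝ) ^ ((K ∆ {j}) ∩ {j}).card * (-1) ^ (H ∩ K).card) * h1
  · rw [if_neg hL, if_neg (hL ∘ hiff.1)]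

/-- The product `Z_j ⊗ v`, where `Z_j = α_j + e_j β_j`. -/
def stemCoordMul (j : Fin n) (z : Fin n → ℂ) (v : StemValue n) : StemValue n :=
  (z j).re • v + (z j).im • complexStructure j v

theorem stemMul_stemCoord (j : Fin n) (z : Fin n → ℂ) (v : StemValue n) :
    stemMul (stemCoord j z) v = stemCoordMul j z v := by
  rw [stemCoord, stemMul_add_left, stemMul_single, stemMul_single, stemCoordMul]
  funext L
  simp only [Pi.add_apply, Pi.smul_apply, complexStructure]
  congr 1
  · have : L ∆ (∅ : Finset (Fin n)) = L := symmDiff_bot L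
    simp [this, Quaternion.coe_mul_eq_smul]
  · rw [Quaternion.coe_mul_eq_smul, smul_comm]

theorem stemMul_stemCoordMul (j : Fin n) (z : Fin n → ℂ) (v w : StemValue n) :
    stemMul (stemCoordMul j z v) w = stemCoordMul j z (stemMul v w) := by
  rw [stemCoordMul, stemMul_add_left, stemMul_smul_left, stemMul_smul_left,
    stemMul_complexStructure_left, stemCoordMul]

/-- The product `Z_{j_1} ⊗ (⋯ ⊗ (Z_{j_p} ⊗ v))`. -/
def stemListMul (l : List (Fin n)) (z : Fin n → ℂ) (v : StemValue n) : StemValue n :=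
  l.foldr (fun j v => stemCoordMul j z v) v

/-- Multiplication by `Z_K` becomes a composition of the operators `α_j + β_j 𝓙_j`, so that later
inductions never meet the double sum defining `⊗`. -/
theorem stemMul_stemMonomial (K : Finset (Fin n)) (z : Fin n → ℂ) (v : StemValue n) :
    stemMul (stemMonomial K z) v = stemListMul (K.sort (· ≤ ·)) z v := by
  have key : ∀ l : List (Fin n),
      stemMul ((l.map fun j => stemCoord j z).foldr stemMul (Pi.single ∅ 1)) v
        = stemListMul l z v := by
    intro l
    induction l with
    | nil =>
      rw [List.map_nil, List.foldr_nil, stemMul_single]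
      funext L
      have : L ∆ (∅ : Finset (Fin n)) = L := symmDiff_bot L
      simp [this, stemListMul]
    | cons j l ih =>
      rw [List.map_cons, List.foldr_cons, stemMul_stemCoord, stemMul_stemCoordMul, ih]
      rfl
  exact key _

theorem hasFDerivAt_stemCoordMul (j : Fin n) {z : Fin n → ℂ} (hG : DifferentiableAt ℝ G z)
    (L : Finset (Fin n)) : HasFDerivAt (fun z => stemCoordMul j z (G z) L)
      (((z j).re • (ContinuousLinearMap.proj L).comp (fderiv ℝ G z)
        + (Complex.reCLM.comp (ContinuousLinearMap.proj j)).smulRight (G z L))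
      + ((z j).im • (-1 : ℝ) ^ ((L ∆ {j}) ∩ {j}).card •
          (ContinuousLinearMap.proj (L ∆ {j})).comp (fderiv ℝ G z)
        + (Complex.imCLM.comp (ContinuousLinearMap.proj j)).smulRight
          (complexStructure j (G z) L))) z := by
  have hre : HasFDerivAt (fun z : Fin n → ℂ => (z j).re)
      (Complex.reCLM.comp (ContinuousLinearMap.proj j)) z :=
    (Complex.reCLM.comp (ContinuousLinearMap.proj (R := ℝ) (φ := fun _ : Fin n => ℂ)
      j)).hasFDerivAt
  have him : HasFDerivAt (fun z : Fin n → ℂ => (z j).im)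
      (Complex.imCLM.comp (ContinuousLinearMap.proj j)) z :=
    (Complex.imCLM.comp (ContinuousLinearMap.proj (R := ℝ) (φ := fun _ : Fin n => ℂ)
      j)).hasFDerivAt
  have hGd : ∀ L, HasFDerivAt (fun z => G z L)
      ((ContinuousLinearMap.proj L).comp (fderiv ℝ G z)) z := fun L =>
    (ContinuousLinearMap.proj (R := ℝ) (φ := fun _ : Finset (Fin n) => ℍ[ℝ])
      L).hasFDerivAt.comp z hG.hasFDerivAt
  have hc : HasFDerivAt (fun z => complexStructure j (G z) L)
      ((-1 : ℝ) ^ ((L ∆ {j}) ∩ {j}).card •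
        (ContinuousLinearMap.proj (L ∆ {j})).comp (fderiv ℝ G z)) z :=
    (hGd (L ∆ {j})).const_smul ((-1 : ℝ) ^ ((L ∆ {j}) ∩ {j}).card)
  exact (hre.smul (hGd L)).add (him.smul hc)

/-- Leibniz rule: `stemCoordMul j z v` is real bilinear in `z` and `v`. -/
theorem fderiv_stemCoordMul (j : Fin n) {z : Fin n → ℂ} (hG : DifferentiableAt ℝ G z)
    (v : Fin n → ℂ) : fderiv ℝ (fun z => stemCoordMul j z (G z)) z v
      = stemCoordMul j z (fderiv ℝ G z v) + stemCoordMul j v (G z) := by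
  have h1 : HasFDerivAt (fun z => stemCoordMul j z (G z)) (ContinuousLinearMap.pi fun L => _) z :=
    hasFDerivAt_pi.2 fun L => hasFDerivAt_stemCoordMul j hG L
  rw [h1.fderiv]
  funext L
  simp [stemCoordMul, complexStructure]
  abel

theorem IsHolomorphicStem.stemCoordMul (hD : IsOpen D) (hG : IsHolomorphicStem D G) (j : Fin n) :
    IsHolomorphicStem D fun z => stemCoordMul j z (G z) := by
  refine ⟨⟨hG.isStem.conjAt_mem_iff, fun z hz K h => ?_⟩, ?_, fun h z hz => ?_⟩
  · have h1 : ∀ A : Finset (Fin n), G (conjAt h z) A = (-1 : ℝ) ^ (A ∩ {h}).card • G z A :=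
      fun A => hG.isStem.parity z hz A h
    have hre : (conjAt h z j).re = (z j).re := by
      by_cases hj : j = h
      · subst hj; simp [conjAt]
      · simp [conjAt, hj]
    have him : (conjAt h z j).im = (-1 : ℝ) ^ (({j} : Finset (Fin n)) ∩ {h}).card * (z j).im := by
      by_cases hj : j = h
      · subst hj; simp [conjAt]
      · simp [conjAt, hj]
    have hs : ((-1 : ℝ) ^ (({j} : Finset (Fin n)) ∩ {h}).card)
        * (-1 : ℝ) ^ (({j} : Finset (Fin n)) ∩ {h}).card = 1 := by
      rw [← mul_pow]; simp
    simp only [SeveralQuaternions.stemCoordMul, Pi.add_apply, Pi.smul_apply, complexStructure, h1,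
      hre, him, smul_add, smul_smul]
    congr 2
    · ring
    · rw [← Finset.inf_eq_inter (s := K ∆ {j}) (t := {h}), inf_symmDiff_distrib_right,
        Finset.inf_eq_inter, Finset.inf_eq_inter, neg_one_pow_card_symmDiff]
      linear_combination ((z j).im * (-1 : ℝ) ^ ((K ∆ {j}) ∩ {j}).card
        * (-1 : ℝ) ^ (K ∩ {h}).card) * hs
  · have hj : ContDiff ℝ 1 fun z : Fin n → ℂ => z j := contDiff_apply ℝ ℂ j
    have hGL : ∀ L, ContDiffOn ℝ 1 (fun z => G z L) D := fun L =>
      (contDiff_apply ℝ ℍ[ℝ] L).comp_contDiffOn hG.contDiffOn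
    refine contDiffOn_pi.2 fun L => ?_
    have hc : ContDiffOn ℝ 1 (fun z => complexStructure j (G z) L) D :=
      (hGL (L ∆ {j})).const_smul ((-1 : ℝ) ^ ((L ∆ {j}) ∩ {j}).card)
    exact ((Complex.reCLM.contDiff.comp hj).contDiffOn.smul (hGL L)).add
      ((Complex.imCLM.contDiff.comp hj).contDiffOn.smul hc)
  · have hd : DifferentiableAt ℝ G z :=
      (hG.contDiffOn.differentiableOn one_ne_zero).differentiableAt (hD.mem_nhds hz)
    have h0 : partialRe h G z + complexStructure h (partialIm h G z) = 0 :=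
      (smul_eq_zero.1 (hG.dbar_eq_zero h z hz)).resolve_left (by norm_num)
    rw [stemDbar, partialRe, partialIm, fderiv_stemCoordMul j hd, fderiv_stemCoordMul j hd]
    change (1 / 2 : ℝ) • (SeveralQuaternions.stemCoordMul j z (partialRe h G z) + _
      + complexStructure h (SeveralQuaternions.stemCoordMul j z (partialIm h G z) + _)) = 0
    rw [eq_neg_of_add_eq_zero_left h0]
    simp only [SeveralQuaternions.stemCoordMul, complexStructure_add, complexStructure_smul]
    have hneg : ∀ v : StemValue n, complexStructure j (-v) = -complexStructure j v := fun v => by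
      rw [← neg_one_smul ℝ v, complexStructure_smul, neg_one_smul]
    rw [hneg, complexStructure_comm h j (partialIm h G z)]
    -- The terms that differentiate `G` cancel because `𝓙_h` and `𝓙_j` commute. The others
    -- differentiate `Z_j`: for `j = h` they give `(1 + 𝓙_j²) G = 0`, and for `j ≠ h` they vanish.
    by_cases hjh : j = h
    · subst hjh
      simp [complexStructure_complexStructure_self]
      abel
    · simp [hjh]
      abel

theorem IsHolomorphicStem.stemListMul (hD : IsOpen D) (hG : IsHolomorphicStem D G)
    (l : List (Fin n)) : IsHolomorphicStem D fun z => stemListMul l z (G z) := by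
  induction l with
  | nil => exact hG
  | cons j l ih => exact ih.stemCoordMul hD j

theorem IsHolomorphicStem.stemMul_stemMonomial (hD : IsOpen D) (hG : IsHolomorphicStem D G)
    (K : Finset (Fin n)) : IsHolomorphicStem D fun z => stemMul (stemMonomial K z) (G z) := by
  simpa only [SeveralQuaternions.stemMul_stemMonomial] using hG.stemListMul hD _

end StemAlgebra

/-! ### The algebraic identity behind the decomposition -/

section Decomposition

variable {n : ℕ}

theorem sort_union {A B : Finset (Fin n)} (hAB : ∀ a ∈ A, ∀ b ∈ B, a < b) :
    (A ∪ B).sort (· ≤ ·) = A.sort (· ≤ ·) ++ B.sort (· ≤ ·) := by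
  have hd : Disjoint A B := Finset.disjoint_left.2 fun a ha hb => lt_irrefl a (hAB a ha a hb)
  refine List.Perm.eq_of_pairwise (le := (· ≤ ·)) (fun a b _ _ h1 h2 => le_antisymm h1 h2)
    (Finset.pairwise_sort _ _) ?_ ?_
  · refine List.pairwise_append.2 ⟨Finset.pairwise_sort _ _, Finset.pairwise_sort _ _,
      fun a ha b hb => (hAB a ((Finset.mem_sort _).1 ha) b ((Finset.mem_sort _).1 hb)).le⟩
  · refine (List.perm_ext_iff_of_nodup (Finset.sort_nodup _ _) ?_).2 fun a => by simp
    exact List.Nodup.append (Finset.sort_nodup _ _) (Finset.sort_nodup _ _)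
      (by simpa [List.disjoint_left, Finset.disjoint_left] using hd)

theorem orderedProd_union {A B : Finset (Fin n)} (hAB : ∀ a ∈ A, ∀ b ∈ B, a < b)
    (q : Fin n → ℍ[ℝ]) : orderedProd (A ∪ B) q = orderedProd A q * orderedProd B q := by
  rw [orderedProd, sort_union hAB, List.map_append, List.prod_append]; rfl

theorem sort_insert_max {S : Finset (Fin n)} {s : Fin n} (hs : ∀ i ∈ S, i < s) :
    (insert s S).sort (· ≤ ·) = S.sort (· ≤ ·) ++ [s] := by
  rw [Finset.insert_eq, Finset.union_comm, sort_union (by simpa using hs), Finset.sort_singleton]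

theorem orderedProd_insert_max {S : Finset (Fin n)} {s : Fin n} (hs : ∀ i ∈ S, i < s)
    (q : Fin n → ℍ[ℝ]) : orderedProd (insert s S) q = orderedProd S q * q s := by
  simp [orderedProd, sort_insert_max hs]

theorem stemCoordMul_insert {s : Fin n} {L : Finset (Fin n)} (hs : s ∉ L) (z : Fin n → ℂ)
    (w : StemValue n) :
    stemCoordMul s z w (insert s L) = (z s).re • w (insert s L) + (z s).im • w L := by
  have h1 : insert s L ∆ {s} = L := by
    ext i
    by_cases hi : i = s
    · subst hi; simp [Finset.mem_symmDiff, hs]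
    · simp [Finset.mem_symmDiff, hi]
  simp [stemCoordMul, complexStructure, h1, hs]

/-- The linear identity that recovers the components of `w` from the components of the products
`Z_K ⊗ w`. -/
theorem sum_orderedProd_stemListMul (z : Fin n → ℂ) (J : Fin n → ℍ[ℝ]) (S : Finset (Fin n)) :
    ∀ (y : ℍ[ℝ]) (w : StemValue n) (T : Finset (Fin n)), Disjoint S T →
      ∑ K ∈ S.powerset, (-1 : ℝ) ^ (S \ K).card •
        (orderedProd (S \ K) (fun h => ((z h).re : ℍ[ℝ]) - (z h).im • J h) * y
          * stemListMul (K.sort (· ≤ ·)) z w (S ∪ T))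
      = (∏ h ∈ S, (z h).im) • ∑ N ∈ S.powerset, orderedProd N J * y * w (N ∪ T) := by
  induction S using Finset.induction_on_max with
  | empty => intro y w T _; simp [orderedProd, stemListMul]
  -- The largest index `s` contributes the last factor of each ordered product, next to `y`, and the
  -- innermost operator applied to `w`. Both can be absorbed: terms without `s` in `K` change `y`,
  -- terms with `s` change `w`. This is why the statement is general in `y` and `w`, and `T` absorbs
  -- `s` in the component index.
  | insert s S hs ih =>
    intro y w T hT
    have hsS : s ∉ S := fun h => lt_irrefl s (hs s h)
    have hsT : s ∉ T := (Finset.disjoint_insert_left.1 hT).1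
    have hST : Disjoint S (insert s T) :=
      Finset.disjoint_insert_right.2 ⟨hsS, (Finset.disjoint_insert_left.1 hT).2⟩
    rw [Finset.sum_powerset_insert hsS, Finset.sum_powerset_insert hsS, Finset.prod_insert hsS]
    have hU : insert s S ∪ T = S ∪ insert s T := by
      rw [Finset.insert_union, Finset.union_insert]
    have h1 : ∀ K ∈ S.powerset, (-1 : ℝ) ^ (insert s S \ K).card •
        (orderedProd (insert s S \ K) (fun h => ((z h).re : ℍ[ℝ]) - (z h).im • J h) * y
          * stemListMul (K.sort (· ≤ ·)) z w (insert s S ∪ T))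
        = -((-1 : ℝ) ^ (S \ K).card •
        (orderedProd (S \ K) (fun h => ((z h).re : ℍ[ℝ]) - (z h).im • J h)
          * ((((z s).re : ℍ[ℝ]) - (z s).im • J s) * y)
          * stemListMul (K.sort (· ≤ ·)) z w (S ∪ insert s T))) := by
      intro K hK
      have hsK : s ∉ K := fun h => hsS (Finset.mem_powerset.1 hK h)
      rw [Finset.insert_sdiff_of_notMem _ hsK, Finset.card_insert_of_notMem (by simp [hsS]),
        orderedProd_insert_max (fun i hi => hs i (Finset.mem_sdiff.1 hi).1), hU, pow_succ,
        mul_neg_one, neg_smul, ← mul_assoc (orderedProd _ _) _ y]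
    have h2 : ∀ K ∈ S.powerset, (-1 : ℝ) ^ (insert s S \ insert s K).card •
        (orderedProd (insert s S \ insert s K)
            (fun h => ((z h).re : ℍ[ℝ]) - (z h).im • J h) * y
          * stemListMul ((insert s K).sort (· ≤ ·)) z w (insert s S ∪ T))
        = (-1 : ℝ) ^ (S \ K).card •
        (orderedProd (S \ K) (fun h => ((z h).re : ℍ[ℝ]) - (z h).im • J h) * y
          * stemListMul (K.sort (· ≤ ·)) z (stemCoordMul s z w) (S ∪ insert s T)) := by
      intro K hK
      have hK' := Finset.mem_powerset.1 hK
      have h3 : insert s S \ insert s K = S \ K := by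
        ext i
        by_cases hi : i = s
        · subst hi; simp [hsS]
        · simp [hi]
      rw [h3, hU, sort_insert_max fun i hi => hs i (hK' hi)]
      simp [stemListMul]
    rw [Finset.sum_congr rfl h1, Finset.sum_congr rfl h2, Finset.sum_neg_distrib,
      ih _ w _ hST, ih y _ _ hST, ← smul_neg, ← smul_add, mul_comm, mul_smul,
      ← Finset.sum_neg_distrib, ← Finset.sum_add_distrib, ← Finset.sum_add_distrib]
    congr 1
    rw [Finset.smul_sum]
    refine Finset.sum_congr rfl fun N hN => ?_
    have hN' := Finset.mem_powerset.1 hN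
    have hsN : s ∉ N ∪ T := by
      simp only [Finset.mem_union, not_or]; exact ⟨fun h => hsS (hN' h), hsT⟩
    rw [orderedProd_insert_max fun i hi => hs i (hN' hi), Finset.union_insert,
      stemCoordMul_insert hsN, Finset.insert_union]
    -- The one-variable identity `-(α - βJ) y w_1 + y (α w_1 + β w_0) = β (J y w_1 + y w_0)`, in
    -- which the terms with `α` cancel.
    simp only [mul_add, sub_mul, mul_sub, smul_mul_assoc, mul_smul_comm, smul_add, mul_assoc,
      Quaternion.coe_mul_eq_smul]
    abel

end Decomposition

/-! ### The components as continuous functions -/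

section Components

open Set

variable {n : ℕ} {D : Set (Fin n → ℂ)} {F G : (Fin n → ℂ) → StemValue n}

theorem canonicalPoint_mem (hF : IsStemFunction D F) {x : Fin n → ℍ[ℝ]}
    (hx : x ∈ circularization D) : canonicalPoint x ∈ D := by
  obtain ⟨z, hz, J, hJ, rfl⟩ := hx
  have him : ∀ h, (slicePoint z J h).im = (z h).im • J h := by
    intro h
    have := (imagUnits_props (hJ h)).1
    ext <;> simp [slicePoint, this, mul_comm]
  have hre : ∀ h, (slicePoint z J h).re = (z h).re := by
    intro h
    have := (imagUnits_props (hJ h)).1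
    simp [slicePoint, this]
  have hnorm : ∀ h, ‖(slicePoint z J h).im‖ = |(z h).im| := by
    intro h
    rw [him, norm_smul, (imagUnits_props (hJ h)).2, mul_one, Real.norm_eq_abs]
  convert (hF.conj_finset hz (Finset.univ.filter fun h => (z h).im < 0)).1 using 1
  funext h
  by_cases hh : (z h).im < 0
  · apply Complex.ext <;> simp [canonicalPoint, hh, hre, hnorm, abs_of_neg]
  · apply Complex.ext <;> simp [canonicalPoint, hh, hre, hnorm, abs_of_nonneg (not_lt.1 hh)]

theorem IsInducedBy.eq_sliceMap (hF : IsStemFunction D F) {f : (Fin n → ℍ[ℝ]) → ℍ[ℝ]}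
    (hf : IsInducedBy D F f) {x : Fin n → ℍ[ℝ]} (hx : x ∈ circularization D) :
    f x = sliceMap F x := by
  obtain ⟨z, hz, J, hJ, rfl⟩ := hx
  rw [hf z hz J hJ, isInducedBy_sliceMap hF z hz J hJ]

theorem continuous_canonicalPoint : Continuous (canonicalPoint (n := n)) :=
  continuous_pi fun h => continuous_sliceCoord.comp (continuous_apply h)

theorem continuous_orderedProd (K : Finset (Fin n)) :
    Continuous fun q : Fin n → ℍ[ℝ] => orderedProd K q :=
  continuous_list_prod (f := fun h (q : Fin n → ℍ[ℝ]) => q h) _ fun h _ => continuous_apply h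

theorem orderedProd_congr {K : Finset (Fin n)} {q q' : Fin n → ℍ[ℝ]} (h : ∀ i ∈ K, q i = q' i) :
    orderedProd K q = orderedProd K q' := by
  rw [orderedProd, orderedProd, List.map_congr_left fun i hi => h i ((Finset.mem_sort _).1 hi)]

/-- Keep the units `J` and perturb `z` inside the open set `D` to make the relevant imaginary parts
nonzero. This makes the continuous extension unique. -/
theorem circularization_subset_closure_nonrealPart (hD : IsOpen D) (H : Finset (Fin n)) :
    circularization D ⊆ closure (nonrealPart D H) := by
  rintro x ⟨z, hz, J, hJ, rfl⟩
  have hz' : z ∈ closure (D ∩ {z : Fin n → ℂ | ∏ h ∈ H, (z h).im ≠ 0}) :=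
    (dense_prod_im_ne_zero H).open_subset_closure_inter hD hz
  have hc : Continuous fun w => slicePoint w J := by
    refine continuous_pi fun h => ?_
    exact (Quaternion.continuous_coe.comp (Complex.continuous_re.comp (continuous_apply h))).add
      (continuous_const.mul
        (Quaternion.continuous_coe.comp (Complex.continuous_im.comp (continuous_apply h))))
  refine map_mem_closure (f := fun w => slicePoint w J) hc hz'
    fun w hw => ⟨⟨w, hw.1, J, hJ, rfl⟩, fun h hh h0 => ?_⟩
  have hJ' := imagUnits_props (hJ h)
  have him : (slicePoint w J h).im = (w h).im • J h := by
    ext <;> simp [slicePoint, hJ'.1, mul_comm]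
  have h1 : (w h).im ≠ 0 := Finset.prod_ne_zero_iff.1 hw.2 h hh
  rw [him, smul_eq_zero] at h0
  refine h0.elim h1 fun h2 => ?_
  rw [h2, norm_zero] at hJ'
  exact zero_ne_one hJ'.2

/-- The function `∑_(T ∩ M = ∅) (Im x)_T Q_(T ∪ M)(α + iβ)`, where `β_h = |Im x_h|`. -/
def quotientSliceMap (M : Finset (Fin n)) (Q : Finset (Fin n) → (Fin n → ℂ) → ℍ[ℝ])
    (x : Fin n → ℍ[ℝ]) : ℍ[ℝ] :=
  ∑ T ∈ Mᶜ.powerset, orderedProd T (fun h => (x h).im) * Q (T ∪ M) (canonicalPoint x)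

/-- The units `J_h` have no limit at real coordinates, but `Im x_h = J_h β_h` is continuous
everywhere. Dividing the stem components by the `β_h` with `h ∈ T` as well is what allows `J_T` to
be replaced by `(Im x)_T`. -/
theorem continuousOn_quotientSliceMap (hF : IsStemFunction D F) (M : Finset (Fin n))
    {Q : Finset (Fin n) → (Fin n → ℂ) → ℍ[ℝ]} (hQ : ∀ P, ContinuousOn (Q P) D) :
    ContinuousOn (quotientSliceMap M Q) (circularization D) := by
  refine continuousOn_finsetSum _ fun T _ => ContinuousOn.mul ?_ ?_
  · exact ((continuous_orderedProd T).comp (continuous_pi fun h =>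
      Quaternion.continuous_im.comp (continuous_apply h))).continuousOn
  · exact (hQ _).comp continuous_canonicalPoint.continuousOn fun x hx => canonicalPoint_mem hF hx

theorem norm_im_smul_canonicalUnit (x : Fin n → ℍ[ℝ]) (h : Fin n) :
    ‖(x h).im‖ • canonicalUnit x h = (x h).im := by
  by_cases h0 : (x h).im = 0
  · simp [h0]
  · rw [canonicalUnit, smul_smul, mul_inv_cancel₀ (norm_ne_zero_iff.2 h0), one_smul]

theorem disjoint_iff_mem_powerset_compl {M T : Finset (Fin n)} :
    Disjoint T M ↔ T ∈ Mᶜ.powerset := by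
  rw [Finset.mem_powerset, Finset.subset_compl_iff_disjoint_right]

/-- The slice function of `G'_M` is `quotientSliceMap M Q`, if the functions `Q_P` are the quotients
`G_P / ∏_(h ∈ P) Im z_h`. -/
theorem sliceMap_sphericalDerivStem (M : Finset (Fin n))
    {Q : Finset (Fin n) → (Fin n → ℂ) → ℍ[ℝ]}
    (hGQ : ∀ P, ∀ z ∈ D, (∏ h ∈ P, (z h).im) • Q P z = G z P) {x : Fin n → ℍ[ℝ]}
    (hx : canonicalPoint x ∈ D) (hM : ∀ h ∈ M, (x h).im ≠ 0) :
    sliceMap (sphericalDerivStem M G) x = quotientSliceMap M Q x := by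
  have h0 : ∏ h ∈ M, (canonicalPoint x h).im ≠ 0 :=
    Finset.prod_ne_zero_iff.2 fun h hh => norm_ne_zero_iff.2 (hM h hh)
  rw [sliceMap, quotientSliceMap, ← Finset.sum_subset (Finset.subset_univ Mᶜ.powerset)]
  · refine Finset.sum_congr rfl fun T hT => ?_
    have hT' := disjoint_iff_mem_powerset_compl.2 hT
    rw [sphericalDerivStem, if_pos hT', ← hGQ _ _ hx, Finset.prod_union hT', smul_smul,
      mul_comm (∏ h ∈ T, _), inv_mul_cancel_left₀ h0, mul_smul_comm, ← smul_mul_assoc,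
      ← orderedProd_smul]
    congr 1
    exact orderedProd_congr fun h _ => norm_im_smul_canonicalUnit x h
  · intro T _ hT
    rw [sphericalDerivStem, if_neg (hT ∘ disjoint_iff_mem_powerset_compl.1), mul_zero]

/-- The Almansi component is a continuous function on all of `Ω_D`. -/
theorem eqOn_almansiComponent (hD : IsOpen D) (hF : IsStemFunction D F) (M K : Finset (Fin n))
    {Q : Finset (Fin n) → (Fin n → ℂ) → ℍ[ℝ]} (hQ : ∀ P, ContinuousOn (Q P) D)
    (hGQ : ∀ P, ∀ z ∈ D, (∏ h ∈ P, (z h).im) • Q P z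
      = stemMul (stemMonomial K z) (F z) P) :
    EqOn (almansiComponent D M K F) (quotientSliceMap M Q) (circularization D) := by
  have heq : ∀ x ∈ nonrealPart D M, sliceMap (almansiStem M K F) x = quotientSliceMap M Q x :=
    fun x hx => sliceMap_sphericalDerivStem M hGQ (canonicalPoint_mem hF hx.1) hx.2
  intro x hx
  rw [almansiComponent]
  split_ifs with h
  · exact heq x h
  · refine extendFrom_eq (circularization_subset_closure_nonrealPart hD M hx) ?_
    refine Filter.Tendsto.congr' (f₁ := quotientSliceMap M Q) ?_
      ((continuousOn_quotientSliceMap hF M hQ x hx).mono_left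
        (nhdsWithin_mono x fun y hy => hy.1))
    filter_upwards [self_mem_nhdsWithin] with y hy using (heq y hy).symm

theorem sum_finset_eq_sum_powerset {A : Type*} [AddCommMonoid A] (M : Finset (Fin n))
    (f : Finset (Fin n) → A) :
    ∑ L, f L = ∑ T ∈ Mᶜ.powerset, ∑ N ∈ M.powerset, f (N ∪ T) := by
  rw [← Finset.sum_product']
  refine Finset.sum_nbij' (fun L => (L \ M, L ∩ M)) (fun p => p.2 ∪ p.1) ?_ ?_ ?_ ?_ ?_
  · intro L _
    rw [Finset.mem_product, ← disjoint_iff_mem_powerset_compl, Finset.mem_powerset]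
    exact ⟨Finset.sdiff_disjoint, Finset.inter_subset_right⟩
  · simp
  · intro L _
    exact (Finset.union_comm _ _).trans (Finset.sdiff_union_inter L M)
  · rintro ⟨T, N⟩ hp
    rw [Finset.mem_product, ← disjoint_iff_mem_powerset_compl, Finset.mem_powerset] at hp
    have hT := Finset.disjoint_left.1 hp.1
    refine Prod.ext ?_ ?_ <;> ext i
    · simp only [Finset.mem_sdiff, Finset.mem_union]
      exact ⟨fun ⟨h1, h2⟩ => h1.resolve_left fun h => h2 (hp.2 h), fun h => ⟨Or.inr h, hT h⟩⟩
    · simp only [Finset.mem_inter, Finset.mem_union]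
      exact ⟨fun ⟨h1, h2⟩ => h1.resolve_right fun h => hT h h2, fun h => ⟨Or.inl h, hp.2 h⟩⟩
  · intro L _
    congr 1
    exact ((Finset.union_comm _ _).trans (Finset.sdiff_union_inter L M)).symm

/-- The decomposition of a slice function, at the points whose coordinates in `M` are non-real. -/
theorem sliceMap_eq_sum (F : (Fin n → ℂ) → StemValue n) {M : Finset (Fin n)}
    (hM : ∀ i ∈ M, ∀ j ∉ M, i < j) {x : Fin n → ℍ[ℝ]} (hx : ∀ h ∈ M, (x h).im ≠ 0) :
    sliceMap F x = ∑ K ∈ M.powerset, (-1 : ℝ) ^ (M \ K).card •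
      (orderedProd (M \ K) (fun i => star (x i)) * sliceMap (almansiStem M K F) x) := by
  set z := canonicalPoint x with hz
  have h0 : ∏ h ∈ M, (z h).im ≠ 0 :=
    Finset.prod_ne_zero_iff.2 fun h hh => norm_ne_zero_iff.2 (hx h hh)
  have hstar : (fun i => star (x i))
      = fun h => ((z h).re : ℍ[ℝ]) - (z h).im • canonicalUnit x h := by
    funext h
    have h1 : (z h).im • canonicalUnit x h = (x h).im := norm_im_smul_canonicalUnit x h
    rw [h1]
    ext <;> simp [hz, canonicalPoint]
  have h1 : ∀ K, sliceMap (almansiStem M K F) x = (∏ h ∈ M, (z h).im)⁻¹ •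
      ∑ T ∈ Mᶜ.powerset, orderedProd T (canonicalUnit x)
        * stemListMul (K.sort (· ≤ ·)) z (F z) (M ∪ T) := by
    intro K
    rw [sliceMap, Finset.smul_sum, ← Finset.sum_subset (Finset.subset_univ Mᶜ.powerset)]
    · refine Finset.sum_congr rfl fun T hT => ?_
      rw [almansiStem, sphericalDerivStem, if_pos (disjoint_iff_mem_powerset_compl.2 hT),
        mul_smul_comm, stemMul_stemMonomial, Finset.union_comm]
    · intro T _ hT
      rw [almansiStem, sphericalDerivStem, if_neg (hT ∘ disjoint_iff_mem_powerset_compl.1),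
        mul_zero]
  have h2 : ∀ T ∈ Mᶜ.powerset, ∀ N ∈ M.powerset,
      orderedProd (N ∪ T) (canonicalUnit x) * F z (N ∪ T)
        = orderedProd N (canonicalUnit x) * orderedProd T (canonicalUnit x) * F z (N ∪ T) := by
    intro T hT N hN
    -- Since `M` precedes its complement, the ordered product over `N ∪ T` splits with the indices
    -- of `M` on the left.
    rw [orderedProd_union fun i hi j hj => hM i (Finset.mem_powerset.1 hN hi) j
      (Finset.mem_compl.1 (Finset.mem_powerset.1 hT hj))]
  rw [sliceMap, sum_finset_eq_sum_powerset M]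
  have h3 : ∀ K, (∏ h ∈ M, (z h).im) • (-1 : ℝ) ^ (M \ K).card •
      (orderedProd (M \ K) (fun i => star (x i)) * sliceMap (almansiStem M K F) x)
      = ∑ T ∈ Mᶜ.powerset, (-1 : ℝ) ^ (M \ K).card •
        (orderedProd (M \ K) (fun h => ((z h).re : ℍ[ℝ]) - (z h).im • canonicalUnit x h)
          * orderedProd T (canonicalUnit x)
          * stemListMul (K.sort (· ≤ ·)) z (F z) (M ∪ T)) := by
    intro K
    rw [h1, hstar, mul_smul_comm, smul_comm _ (∏ h ∈ M, (z h).im)⁻¹, smul_inv_smul₀ h0,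
      Finset.mul_sum, Finset.smul_sum]
    simp only [mul_assoc]
  refine (smul_right_inj h0).1 ?_
  rw [Finset.smul_sum, Finset.smul_sum, Finset.sum_congr rfl fun K _ => h3 K,
    Finset.sum_comm (s := M.powerset)]
  refine Finset.sum_congr rfl fun T hT => ?_
  -- For each fixed `T` the linear identity is used with `y = J_T`.
  rw [Finset.sum_congr rfl (h2 T hT), sum_orderedProd_stemListMul z (canonicalUnit x) M _ _ T
      (disjoint_iff_mem_powerset_compl.2 hT).symm]

end Components

/-! ### Iterated mean values -/

section IteratedMean

open MeasureTheory Metric Set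

/-- Replacing one coordinate by an independent sample does not change the product law: a box pulls
back to a box whose `i`-th side is the whole space, times the old `i`-th side. It lets Fubini
isolate a variable without splitting the index type. -/
theorem measurePreserving_update {ι X : Type*} [Fintype ι] [DecidableEq ι] [MeasurableSpace X]
    (μ : Measure X) [IsProbabilityMeasure μ] (i : ι) :
    MeasurePreserving (fun p : (ι → X) × X => Function.update p.1 i p.2)
      ((Measure.pi fun _ => μ).prod μ) (Measure.pi fun _ => μ) := by
  have hm : Measurable fun p : (ι → X) × X => Function.update p.1 i p.2 := by
    refine measurable_pi_iff.2 fun j => ?_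
    by_cases hj : j = i
    · subst hj
      simpa using measurable_snd
    · simp only [Function.update_of_ne hj]
      exact (measurable_pi_apply j).comp measurable_fst
  refine ⟨hm, (Measure.pi_eq fun s hs => ?_).symm⟩
  have hpre : (fun p : (ι → X) × X => Function.update p.1 i p.2) ⁻¹' univ.pi s
      = (univ.pi (Function.update s i univ)) ×ˢ s i := by
    ext p
    simp only [mem_preimage, mem_univ_pi, mem_prod]
    constructor
    · intro h
      refine ⟨fun j => ?_, by simpa using h i⟩
      by_cases hj : j = i
      · subst hj; simp
      · simpa [hj] using h j
    · rintro ⟨h1, h2⟩ j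
      by_cases hj : j = i
      · subst hj; simpa using h2
      · simpa [hj] using h1 j
  rw [Measure.map_apply hm (MeasurableSet.univ_pi hs), hpre, Measure.prod_prod, Measure.pi_pi,
    ← Finset.mul_prod_erase Finset.univ _ (Finset.mem_univ i),
    ← Finset.mul_prod_erase Finset.univ (fun j => μ (s j)) (Finset.mem_univ i)]
  rw [Function.update_self, measure_univ, one_mul, mul_comm]
  congr 1
  refine Finset.prod_congr rfl fun j hj => ?_
  rw [Function.update_of_ne (Finset.ne_of_mem_erase hj)]

theorem integrable_of_continuous_of_compactSpace {X E : Type*} [TopologicalSpace X]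
    [CompactSpace X] [MeasurableSpace X] [OpensMeasurableSpace X] [NormedAddCommGroup E]
    [SecondCountableTopology E] (μ : Measure X) [IsFiniteMeasure μ] {f : X → E}
    (hf : Continuous f) : Integrable f μ := by
  borelize E
  exact hf.integrable_of_hasCompactSupport (HasCompactSupport.of_compactSpace f)

/-- If averaging over any one variable replaces that variable by a centre, then the mean over all
variables is the value at the centres. -/
theorem integral_pi_eq_of_integral_update {ι X E : Type*} [Fintype ι] [DecidableEq ι]
    [TopologicalSpace X] [CompactSpace X] [SecondCountableTopology X] [MeasurableSpace X]
    [BorelSpace X] [NormedAddCommGroup E] [NormedSpace ℝ E] [CompleteSpace E]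
    [SecondCountableTopology E] (μ : Measure X) [IsProbabilityMeasure μ]
    {Φ : Finset ι → (ι → X) → E} (hΦ : ∀ S, Continuous (Φ S))
    (hmean : ∀ (S : Finset ι) (i : ι), i ∉ S → ∀ x,
      ∫ y, Φ (insert i S) (Function.update x i y) ∂μ = Φ S x) (S : Finset ι) :
    ∫ x, Φ S x ∂(Measure.pi fun _ => μ) = ∫ x, Φ ∅ x ∂(Measure.pi fun _ => μ) := by
  induction S using Finset.induction_on with
  | empty => rfl
  | insert i S hi ih =>
    have hp := measurePreserving_update μ i
    have hint := integrable_of_continuous_of_compactSpace (Measure.pi fun _ : ι => μ)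
      (hΦ (insert i S))
    have h1 : ∫ x, Φ (insert i S) x ∂(Measure.pi fun _ => μ)
        = ∫ p : (ι → X) × X, Φ (insert i S) (Function.update p.1 i p.2)
          ∂((Measure.pi fun _ => μ).prod μ) := by
      have := integral_map (f := Φ (insert i S)) hp.measurable.aemeasurable
        (by rw [hp.map_eq]; exact hint.aestronglyMeasurable)
      rwa [hp.map_eq] at this
    have h2 : Integrable (fun p : (ι → X) × X => Φ (insert i S) (Function.update p.1 i p.2))
        ((Measure.pi fun _ => μ).prod μ) := hp.integrable_comp_of_integrable hint
    rw [← ih, h1, integral_prod _ h2]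
    simp only [hmean S i hi]

variable {n : ℕ} {D : Set (Fin n → ℂ)} {G : (Fin n → ℂ) → StemValue n}

/-- The mean value property of `quotientSliceMap` in the variables with index in `M`. -/
theorem integral_quotientSliceMap (hD : IsOpen D) (hG : IsHolomorphicStem D G)
    {M : Finset (Fin n)} {Q : Finset (Fin n) → (Fin n → ℂ) → ℍ[ℝ]}
    (hQ : ∀ P, ContinuousOn (Q P) D)
    (hGQ : ∀ P, ∀ z ∈ D, (∏ h ∈ P, (z h).im) • Q P z = G z P) {h : Fin n} (hh : h ∈ M)
    {x : Fin n → ℍ[ℝ]} {a : ℍ[ℝ]} {r : ℝ} (hr : 0 ≤ r)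
    (ha : ∀ y ∈ closedBall a r, Function.update x h y ∈ circularization D) :
    ∫ y : unitSphere, quotientSliceMap M Q (Function.update x h (a + r • (y : ℍ[ℝ])))
      ∂sphereMeasure = quotientSliceMap M Q (Function.update x h a) := by
  have hcp : ∀ y ∈ closedBall a r, canonicalPoint (Function.update x h y) ∈ D := fun y hy =>
    canonicalPoint_mem hG.isStem (ha y hy)
  have hy : ∀ y : unitSphere, a + r • (y : ℍ[ℝ]) ∈ closedBall a r := fun y => by
    have : ‖(y : ℍ[ℝ])‖ = 1 := by simp
    rw [mem_closedBall, dist_eq_norm, add_sub_cancel_left, norm_smul, this, mul_one,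
      Real.norm_of_nonneg hr]
  have hcont : ∀ P, Continuous fun y : unitSphere =>
      Q P (canonicalPoint (Function.update x h (a + r • (y : ℍ[ℝ])))) := fun P =>
    (hQ P).comp_continuous (continuous_canonicalPoint.comp
      (continuous_const.update h (continuous_const.add (continuous_subtype_val.const_smul r))))
      fun y => hcp _ (hy y)
  have hprod : ∀ T ∈ Mᶜ.powerset, ∀ y : ℍ[ℝ],
      orderedProd T (fun i => (Function.update x h y i).im)
        = orderedProd T fun i => (x i).im := by
    intro T hT y
    refine orderedProd_congr fun i hi => ?_
    have : i ≠ h := by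
      rintro rfl
      exact Finset.mem_compl.1 (Finset.mem_powerset.1 hT hi) hh
    rw [Function.update_of_ne this]
  have hint : ∀ P, Integrable (fun y : unitSphere =>
      Q P (canonicalPoint (Function.update x h (a + r • (y : ℍ[ℝ]))))) sphereMeasure := fun P =>
    integrable_of_continuous_of_compactSpace _ (hcont P)
  have hsum : ∀ y : ℍ[ℝ], quotientSliceMap M Q (Function.update x h y)
      = ∑ T ∈ Mᶜ.powerset, orderedProd T (fun i => (x i).im)
        * Q (T ∪ M) (canonicalPoint (Function.update x h y)) := fun y =>
    Finset.sum_congr rfl fun T hT => by rw [hprod T hT]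
  simp only [hsum]
  rw [integral_finsetSum _ fun T _ => (hint _).const_mul _]
  refine Finset.sum_congr rfl fun T _ => ?_
  rw [integral_const_mul_of_integrable (hint _)]
  congr 1
  exact (hG.isHolomorphicStemIn Finset.univ).integral_quotient hD
    (Finset.mem_union_right T hh) (hQ _) (hGQ _) hr hcp

/-- The point `a + ∑_(i ∈ S) r_i λ_i`. -/
def partialShift {m : ℕ} (a : Fin n → ℍ[ℝ]) (r : Fin n → ℝ) (S : Finset (Fin m))
    (lam : Fin m → unitSphere) : Fin n → ℍ[ℝ] :=
  fun i => if h : (i : ℕ) < m then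
    (if (⟨i, h⟩ : Fin m) ∈ S then a i + r i • (lam ⟨i, h⟩ : ℍ[ℝ]) else a i) else a i

variable {m : ℕ} {a : Fin n → ℍ[ℝ]} {r : Fin n → ℝ}

theorem partialShift_univ (lam : Fin m → unitSphere) :
    partialShift a r Finset.univ lam = shiftedPoint m a r lam := by
  funext i; simp [partialShift, shiftedPoint]

theorem partialShift_empty (lam : Fin m → unitSphere) : partialShift a r ∅ lam = a := by
  funext i; simp [partialShift]

theorem continuous_partialShift (S : Finset (Fin m)) : Continuous (partialShift a r S) := by
  refine continuous_pi fun i => ?_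
  by_cases h : (i : ℕ) < m
  · by_cases h' : (⟨i, h⟩ : Fin m) ∈ S
    · simp only [partialShift, h, h', dif_pos, if_true]
      exact continuous_const.add
        ((continuous_subtype_val.comp (continuous_apply _)).const_smul (r i))
    · simpa only [partialShift, h, h', dif_pos, if_false] using continuous_const
  · simpa only [partialShift, h, dif_neg, not_false_eq_true] using continuous_const

theorem partialShift_mem (hr : ∀ i, 0 ≤ r i) (S : Finset (Fin m)) (lam : Fin m → unitSphere) :
    partialShift a r S lam ∈ univ.pi fun i => closedBall (a i) (r i) := by
  intro i _
  have hi : ∀ y : unitSphere, a i + r i • (y : ℍ[ℝ]) ∈ closedBall (a i) (r i) := fun y => by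
    have : ‖(y : ℍ[ℝ])‖ = 1 := by simp
    rw [mem_closedBall, dist_eq_norm, add_sub_cancel_left, norm_smul, this, mul_one,
      Real.norm_of_nonneg (hr i)]
  unfold partialShift
  split_ifs
  · exact hi _
  · exact mem_closedBall_self (hr i)
  · exact mem_closedBall_self (hr i)

theorem partialShift_insert_update (hmn : m ≤ n) {S : Finset (Fin m)} {i : Fin m} (hi : i ∉ S)
    (lam : Fin m → unitSphere) (y : unitSphere) :
    partialShift a r (insert i S) (Function.update lam i y)
      = Function.update (partialShift a r S lam) (Fin.castLE hmn i)
        (a (Fin.castLE hmn i) + r (Fin.castLE hmn i) • (y : ℍ[ℝ])) := by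
  funext j
  by_cases hj : j = Fin.castLE hmn i
  · subst hj
    simp [partialShift]
  · rw [Function.update_of_ne hj]
    unfold partialShift
    by_cases h : (j : ℕ) < m
    · have hne : (⟨j, h⟩ : Fin m) ≠ i := by
        rintro rfl
        exact hj rfl
      simp [h, hne]
    · simp [h]

theorem partialShift_eq_update (hmn : m ≤ n) {S : Finset (Fin m)} {i : Fin m} (hi : i ∉ S)
    (lam : Fin m → unitSphere) : Function.update (partialShift a r S lam) (Fin.castLE hmn i)
      (a (Fin.castLE hmn i)) = partialShift a r S lam := by
  refine Function.update_eq_self_iff.2 ?_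
  simp [partialShift, hi]

theorem castLE_mem_initialSegment (hmn : m ≤ n) (i : Fin m) :
    Fin.castLE hmn i ∈ initialSegment n m := by
  simp [initialSegment]

theorem continuous_comp_partialShift (hr : ∀ i, 0 ≤ r i)
    (hball : univ.pi (fun i => closedBall (a i) (r i)) ⊆ circularization D)
    {g : (Fin n → ℍ[ℝ]) → ℍ[ℝ]} (hg : ContinuousOn g (circularization D)) (S : Finset (Fin m)) :
    Continuous fun lam => g (partialShift a r S lam) :=
  hg.comp_continuous (continuous_partialShift S) fun lam => hball (partialShift_mem hr S lam)

/-- The mean value property in the first `m` variables. -/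
theorem integral_quotientSliceMap_shiftedPoint (hD : IsOpen D) (hG : IsHolomorphicStem D G)
    (hmn : m ≤ n) (hr : ∀ i, 0 ≤ r i)
    (hball : univ.pi (fun i => closedBall (a i) (r i)) ⊆ circularization D)
    {Q : Finset (Fin n) → (Fin n → ℂ) → ℍ[ℝ]} (hQ : ∀ P, ContinuousOn (Q P) D)
    (hGQ : ∀ P, ∀ z ∈ D, (∏ h ∈ P, (z h).im) • Q P z = G z P) :
    ∫ lam : Fin m → unitSphere,
      quotientSliceMap (initialSegment n m) Q (shiftedPoint m a r lam)
        ∂(Measure.pi fun _ => sphereMeasure) = quotientSliceMap (initialSegment n m) Q a := by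
  have hc := continuousOn_quotientSliceMap hG.isStem (initialSegment n m) hQ
  -- `S` records which of the first `m` coordinates have been moved to the sphere; averaging over
  -- one of them returns it to its centre, since the quotient map is harmonic in that variable.
  have := integral_pi_eq_of_integral_update sphereMeasure
    (Φ := fun S lam => quotientSliceMap (initialSegment n m) Q (partialShift (m := m) a r S lam))
    (continuous_comp_partialShift hr hball hc) (fun S i hi lam => ?_) Finset.univ
  · simpa [partialShift_univ, partialShift_empty] using this
  · simp only [partialShift_insert_update hmn hi]
    rw [integral_quotientSliceMap hD hG hQ hGQ (castLE_mem_initialSegment hmn i) (hr _),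
      partialShift_eq_update hmn hi]
    intro y hy
    refine hball fun j _ => ?_
    by_cases hj : j = Fin.castLE hmn i
    · subst hj; simpa using hy
    · rw [Function.update_of_ne hj]
      exact partialShift_mem hr S lam j (mem_univ j)

/-- The decomposition of a slice regular function into its components, on all of `Ω_D`. -/
theorem sliceMap_eq_sum_quotientSliceMap (hD : IsOpen D) (hG : IsHolomorphicStem D G)
    {M : Finset (Fin n)} (hM : ∀ i ∈ M, ∀ j ∉ M, i < j)
    {Q : Finset (Fin n) → Finset (Fin n) → (Fin n → ℂ) → ℍ[ℝ]}
    (hQ : ∀ K P, ContinuousOn (Q K P) D)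
    (hGQ : ∀ K P, ∀ z ∈ D, (∏ h ∈ P, (z h).im) • Q K P z
      = stemMul (stemMonomial K z) (G z) P) {x : Fin n → ℍ[ℝ]} (hx : x ∈ circularization D) :
    sliceMap G x = ∑ K ∈ M.powerset, (-1 : ℝ) ^ (M \ K).card •
      (orderedProd (M \ K) (fun i => star (x i)) * quotientSliceMap M (Q K) x) := by
  have hG0 : ∀ P, ∀ z ∈ D, (∏ h ∈ P, (z h).im) • Q ∅ P z = G z P := fun P z hz => by
    rw [hGQ ∅ P z hz, stemMul_stemMonomial]
    simp [stemListMul]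
  -- With `M` and `K` empty the quotient map is the slice function itself, in a form whose
  -- continuity at real coordinates is already known.
  have h0 : ∀ y ∈ circularization D, quotientSliceMap ∅ (Q ∅) y = sliceMap G y := by
    intro y hy
    rw [← sliceMap_sphericalDerivStem ∅ hG0 (canonicalPoint_mem hG.isStem hy) (by simp)]
    simp [sliceMap, sphericalDerivStem]
  rw [← h0 x hx]
  -- Both sides are continuous on `Ω_D` and agree where the coordinates in `M` are non-real, which
  -- is a dense part.
  refine EqOn.of_subset_closure (s := nonrealPart D M) (t := circularization D)
    (f := quotientSliceMap ∅ (Q ∅)) (g := fun x => ∑ K ∈ M.powerset, (-1 : ℝ) ^ (M \ K).card •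
      (orderedProd (M \ K) (fun i => star (x i)) * quotientSliceMap M (Q K) x))
    (fun y hy => ?_) (continuousOn_quotientSliceMap hG.isStem ∅ (hQ ∅)) ?_ (fun y hy => hy.1)
    (circularization_subset_closure_nonrealPart hD M) hx
  · dsimp only
    rw [h0 y hy.1, sliceMap_eq_sum G hM hy.2]
    refine Finset.sum_congr rfl fun K _ => ?_
    rw [almansiStem, sliceMap_sphericalDerivStem M (hGQ K) (canonicalPoint_mem hG.isStem hy.1) hy.2]
  · refine continuousOn_finsetSum _ fun K _ => ?_
    have h1 : ContinuousOn (fun x : Fin n → ℍ[ℝ] => orderedProd (M \ K) fun i => star (x i))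
        (circularization D) :=
      ((continuous_orderedProd _).comp (continuous_pi fun i =>
        (continuous_apply i).star)).continuousOn
    exact (h1.mul (continuousOn_quotientSliceMap hG.isStem M (hQ K))).const_smul
      ((-1 : ℝ) ^ (M \ K).card)

end IteratedMean

end SeveralQuaternions

end

open scoped Quaternion in
theorem proposition4p9 {n : ℕ} (m : ℕ) (hm : 1 ≤ m) (hmn : m ≤ n)
    (D : Set (Fin n → ℂ)) (hD : IsOpen D)
    (F : (Fin n → ℂ) → SeveralQuaternions.StemValue n)
    (hF : SeveralQuaternions.IsHolomorphicStem D F)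
    (f : (Fin n → ℍ[ℝ]) → ℍ[ℝ]) (hf : SeveralQuaternions.IsInducedBy D F f)
    (a : Fin n → ℍ[ℝ]) (r : Fin n → ℝ) (hr : ∀ i, 0 ≤ r i)
    (hball : Set.univ.pi (fun i => Metric.closedBall (a i) (r i)) ⊆
      SeveralQuaternions.circularization D) :
    (∀ K ⊆ SeveralQuaternions.initialSegment n m,
      ContinuousOn
        (SeveralQuaternions.almansiComponent D (SeveralQuaternions.initialSegment n m) K F)
        (SeveralQuaternions.circularization D) ∧
      MeasureTheory.Integrable
        (fun lam : Fin m → SeveralQuaternions.unitSphere =>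
          SeveralQuaternions.almansiComponent D (SeveralQuaternions.initialSegment n m) K F
            (SeveralQuaternions.shiftedPoint m a r lam))
        (MeasureTheory.Measure.pi fun _ => SeveralQuaternions.sphereMeasure)) ∧
    f a = ∑ K ∈ (SeveralQuaternions.initialSegment n m).powerset,
      (-1 : ℝ) ^ (SeveralQuaternions.initialSegment n m \ K).card •
        (SeveralQuaternions.orderedProd (SeveralQuaternions.initialSegment n m \ K)
            (fun i => star (a i)) *
          ∫ lam : Fin m → SeveralQuaternions.unitSphere,
            SeveralQuaternions.almansiComponent D (SeveralQuaternions.initialSegment n m) K F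
              (SeveralQuaternions.shiftedPoint m a r lam)
            ∂(MeasureTheory.Measure.pi fun _ => SeveralQuaternions.sphereMeasure)) := by
  open SeveralQuaternions in
  have hZ : ∀ K, IsHolomorphicStem D fun z => stemMul (stemMonomial K z) (F z) := fun K =>
    hF.stemMul_stemMonomial hD K
  -- `Q K P` is the continuous quotient of the component `P` of `Z_K ⊗ F` by the imaginary parts
  -- with index in `P`. One family serves for the continuity, the decomposition and the mean values.
  choose Q hQ hGQ using fun K P =>
    ((hZ K).isHolomorphicStemIn Finset.univ).exists_continuousOn_quotient hD P
  have heq : ∀ K, Set.EqOn (almansiComponent D (initialSegment n m) K F)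
      (quotientSliceMap (initialSegment n m) (Q K)) (circularization D) := fun K =>
    eqOn_almansiComponent hD hF.isStem _ K (hQ K) (hGQ K)
  have hmem : ∀ lam : Fin m → unitSphere, shiftedPoint m a r lam ∈ circularization D := by
    intro lam
    rw [← partialShift_univ]
    exact hball (partialShift_mem hr _ lam)
  have hM : ∀ i ∈ initialSegment n m, ∀ j ∉ initialSegment n m, i < j := by
    intro i hi j hj
    simp only [initialSegment, Finset.mem_filter, Finset.mem_univ, true_and] at hi hj
    exact Fin.lt_def.2 (by omega)
  have ha : a ∈ circularization D := hball fun i _ => Metric.mem_closedBall_self (hr i)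
  have hcont : ∀ K, ContinuousOn (almansiComponent D (initialSegment n m) K F)
      (circularization D) := fun K =>
    (continuousOn_quotientSliceMap hF.isStem _ (hQ K)).congr (heq K)
  refine ⟨fun K _ => ⟨hcont K, ?_⟩, ?_⟩
  · refine integrable_of_continuous_of_compactSpace _ ?_
    simpa only [partialShift_univ] using
      continuous_comp_partialShift (m := m) hr hball (hcont K) Finset.univ
  · rw [hf.eq_sliceMap hF.isStem ha, sliceMap_eq_sum_quotientSliceMap hD hF hM hQ hGQ ha]
    refine Finset.sum_congr rfl fun K _ => ?_
    simp only [heq K (hmem _)]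
    rw [integral_quotientSliceMap_shiftedPoint hD (hZ K) hmn hr hball (hQ K) (hGQ K)]
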